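/- **Setting.** Let $\mathcal L$ be a many-sorted first-order language with set of sorts $\mathcal J$, and let $\mathfrak C$ be an $\mathcal L$-structure whose complete theory $T=\mathrm{Th}(\mathfrak C)$ has quantifier elimination and uniform elimination of imaginaries (every $\emptyset$-definable equivalence relation $E$ on a finite product of sorts has the form $E(x,y)\Leftrightarrow f(x)=f(y)$ for some $\emptyset$-definable function $f$ into a finite product of sorts); for instance, $\mathfrak C$ is a monster model of $T=(T_0^{\mathrm{eq}})^m$, the Morleyization of $T_0^{\mathrm{eq}}$. For a model $M$ of $T$ and a definably closed substructure $K$ of $M$ let $G(K)=\mathrm{Aut}(\mathrm{acl}(K)/K)$ be the group of elementary permutations of $\mathrm{acl}(K)$ over $K$, with the topology of pointwise convergence on the discrete set $\mathrm{acl}(K)$. For a finite tuple $J=(j_1,\dots,j_n)$ of sorts write $S_J=S_{j_1}\times\dots\times S_{j_n}$. For an open normal subgroup $N$ of $G(K)$ put $L=\mathrm{acl}(K)^N$ and let $\mathcal F(N)$ be the set of those $J$ for which $|\mathrm{Aut}_J(L/K)|=|\mathrm{Aut}(L/K)|$, where $\mathrm{Aut}_J(L/K)$ is the group of permutations of $S_J(L)$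 induced by $\mathrm{Aut}(L/K)$. The sorted complete system $SG(K)$ is the many-sorted structure with sorts, for $k\in\mathbb N$ and finite tuples $J$ of sorts, $$m(k,J)=\{gH : g\in G(K),\ H\text{ an open normal subgroup of }G(K),\ [G(K):H]\le k,\ J\in\mathcal F(H)\},$$ and with the following relations between all (combinations of) sorts: $gH\leqslant g'H'$ iff $H\subseteq H'$; $C(gH,g'H')$ iff $H\subseteq H'$ and $gH'=g'H'$; and, on each $m(k,J)$, $P(g_1H_1,g_2H_2,g_3H_3)$ iff $H_1=H_2=H_3$ and $g_1g_2H_1=g_3H_1$. **Theorem.** Let $\mathcal U$ be an ultrafilter on an infinite set $I$, let $K_i$ ($i\in I$) be definably closed substructures of $\mathfrak C$, and let $K^*=\prod_i K_i/\mathcal U$. Then the $\mathcal L$-structure $K^*$ embeds in a model of $T$. Moreover, for every model $N$ of $T$ and every embedding of $\mathcal L$-structures $\iota\colon K^*\to N$, the image $\iota(K^*)$ is definably closed in $N$, and, with $SG(K^*)$ formed by identifying $K^*$ with $\iota(K^*)\subseteq N$, $$\prod_i SG(K_i)/\mathcal U\;\cong\; SG\Big(\prod_i K_i/\mathcal U\Big)$$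 as many-sorted structures in the language $\{\leqslant,C,P\}$ with sorts $m(k,J)$. (Ultraproducts are taken sort by sort; their elements are classes of sections defined $\mathcal U$-almost everywhere, so that a sort may be empty in some factors.) -/

import Mathlib

open Filter

universe u uf ur v v' w

/-! ### Many-sorted first-order logic -/

/-- A many-sorted first-order language: a function symbol has a list of argument sorts and a value
sort, a relation symbol has a list of argument sorts. -/
structure MSLanguage where
  Sorts : Type u
  Functions : List Sorts → Sorts → Type uf
  Relations : List Sorts → Type ur

/-- `Tup M J` is the set `S_J(M) = S_{j₁}(M) × ⋯ × S_{jₙ}(M)` for a tuple `J = (j₁, …, jₙ)` of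
sorts. -/
abbrev Tup {S : Type u} (M : S → Type v) (J : List S) : Type v :=
  (j : Fin J.length) → M (J.get j)

namespace Tup

variable {S : Type u} {M : S → Type v}

/-- Put an element in front of a tuple. -/
def cons {s : S} {J : List S} (x : M s) (a : Tup M J) : Tup M (s :: J) :=
  fun j => Fin.cases (motive := fun j => M ((s :: J).get j)) x a j

/-- Concatenation of tuples. -/
def append : {J J' : List S} → Tup M J → Tup M J' → Tup M (J ++ J')
  | [], _, _, b => b
  | _ :: J, _, a, b => cons (a (0 : Fin (J.length + 1)))
      (append (J := J) (fun j => a (Fin.succ j)) b)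

end Tup

namespace MSLanguage

/-- A many-sorted `L`-structure on the family `M` of its sorts. -/
class Structure (L : MSLanguage.{u, uf, ur}) (M : L.Sorts → Type v) where
  funMap : ∀ {J : List L.Sorts} {s : L.Sorts}, L.Functions J s → Tup M J → M s
  RelMap : ∀ {J : List L.Sorts}, L.Relations J → Tup M J → Prop

/-- Terms with free variables of sorts `Γ`. -/
inductive Term (L : MSLanguage.{u, uf, ur}) (Γ : List L.Sorts) : L.Sorts → Type (max u uf)
  | var (j : Fin Γ.length) : Term L Γ (Γ.get j)
  | func {J : List L.Sorts} {s : L.Sorts} (f : L.Functions J s)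
      (t : (j : Fin J.length) → Term L Γ (J.get j)) : Term L Γ s

/-- Formulas with free variables of sorts `Γ`; `all s φ` quantifies over the first variable
of `φ`. -/
inductive Formula (L : MSLanguage.{u, uf, ur}) : List L.Sorts → Type (max u uf ur)
  | falsum {Γ : List L.Sorts} : Formula L Γ
  | equal {Γ : List L.Sorts} {s : L.Sorts} (t t' : L.Term Γ s) : Formula L Γ
  | rel {Γ J : List L.Sorts} (R : L.Relations J)
      (t : (j : Fin J.length) → L.Term Γ (J.get j)) : Formula L Γ
  | imp {Γ : List L.Sorts} (φ ψ : Formula L Γ) : Formula L Γ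
  | all {Γ : List L.Sorts} (s : L.Sorts) (φ : Formula L (s :: Γ)) : Formula L Γ

variable {L : MSLanguage.{u, uf, ur}}

/-- Value of a term. -/
def Term.realize {M : L.Sorts → Type v} [L.Structure M] {Γ : List L.Sorts} (a : Tup M Γ) :
    {s : L.Sorts} → L.Term Γ s → M s
  | _, .var j => a j
  | _, .func f t => Structure.funMap f fun j => (t j).realize a

/-- Truth of a formula at a tuple. -/
def Formula.Realize {M : L.Sorts → Type v} [L.Structure M] :
    {Γ : List L.Sorts} → L.Formula Γ → Tup M Γ → Prop
  | _, .falsum, _ => False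
  | _, .equal t t', a => t.realize a = t'.realize a
  | _, .rel R t, a => Structure.RelMap R fun j => (t j).realize a
  | _, .imp φ ψ, a => φ.Realize a → ψ.Realize a
  | _, .all s φ, a => ∀ x : M s, φ.Realize (Tup.cons x a)

/-- Quantifier-free formulas. -/
def Formula.IsQF : {Γ : List L.Sorts} → L.Formula Γ → Prop
  | _, .falsum => True
  | _, .equal _ _ => True
  | _, .rel _ _ => True
  | _, .imp φ ψ => φ.IsQF ∧ ψ.IsQF
  | _, .all _ _ => False

/-- `M` and `N` satisfy the same sentences, i.e. `N ⊨ Th(M)`. -/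
def ElementarilyEquivalent (L : MSLanguage.{u, uf, ur}) (M : L.Sorts → Type v) [L.Structure M]
    (N : L.Sorts → Type v') [L.Structure N] : Prop :=
  ∀ φ : L.Formula [], φ.Realize (M := M) (fun j => j.elim0) ↔ φ.Realize (M := N) (fun j => j.elim0)

/-- `Th(M)` has quantifier elimination. -/
def HasQE (L : MSLanguage.{u, uf, ur}) (M : L.Sorts → Type v) [L.Structure M] : Prop :=
  ∀ (Γ : List L.Sorts) (φ : L.Formula Γ), ∃ ψ : L.Formula Γ, ψ.IsQF ∧
    ∀ a : Tup M Γ, φ.Realize a ↔ ψ.Realize a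

/-- `Th(M)` has uniform elimination of imaginaries: every `∅`-definable equivalence relation `E`
on some `S_J` is of the form `f(x) = f(y)` for a `∅`-definable function `f : S_J → S_{J'}`. -/
def HasUniformEI (L : MSLanguage.{u, uf, ur}) (M : L.Sorts → Type v) [L.Structure M] : Prop :=
  ∀ (J : List L.Sorts) (E : L.Formula (J ++ J)),
    Equivalence (fun a b : Tup M J => E.Realize (a.append b)) →
    ∃ (J' : List L.Sorts) (F : L.Formula (J ++ J')) (f : Tup M J → Tup M J'),
      (∀ (a : Tup M J) (c : Tup M J'), F.Realize (a.append c) ↔ f a = c) ∧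
      ∀ a b : Tup M J, E.Realize (a.append b) ↔ f a = f b

/-! ### Substructures, embeddings, isomorphisms -/

/-- A substructure: a subset of each sort, closed under the function symbols. -/
structure Substructure (L : MSLanguage.{u, uf, ur}) (M : L.Sorts → Type v) [L.Structure M] where
  carrier : ∀ s : L.Sorts, Set (M s)
  fun_mem : ∀ {J : List L.Sorts} {s : L.Sorts} (f : L.Functions J s) (a : Tup M J),
    (∀ j, a j ∈ carrier (J.get j)) → Structure.funMap f a ∈ carrier s

/-- The sorts of a substructure, as types. -/
abbrev Substructure.toFam {M : L.Sorts → Type v} [L.Structure M] (K : L.Substructure M) :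
    L.Sorts → Type v :=
  fun s => K.carrier s

/-- The induced structure. -/
instance Substructure.inducedStructure {M : L.Sorts → Type v} [L.Structure M]
    (K : L.Substructure M) : L.Structure K.toFam where
  funMap f a := ⟨Structure.funMap f fun j => (a j).1, K.fun_mem f _ fun j => (a j).2⟩
  RelMap R a := Structure.RelMap R fun j => (a j).1

/-- An embedding of many-sorted structures. -/
structure Embedding (L : MSLanguage.{u, uf, ur}) (M : L.Sorts → Type v) [L.Structure M]
    (N : L.Sorts → Type v') [L.Structure N] where
  toFun : ∀ s : L.Sorts, M s → N s
  injective : ∀ s : L.Sorts, Function.Injective (toFun s)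
  map_fun : ∀ {J : List L.Sorts} {s : L.Sorts} (f : L.Functions J s) (a : Tup M J),
    toFun s (Structure.funMap f a) = Structure.funMap f fun j => toFun (J.get j) (a j)
  map_rel : ∀ {J : List L.Sorts} (R : L.Relations J) (a : Tup M J),
    Structure.RelMap R (fun j => toFun (J.get j) (a j)) ↔ Structure.RelMap R a

/-- The image of an embedding, as a substructure of the target. -/
def Embedding.range {M : L.Sorts → Type v} [L.Structure M] {N : L.Sorts → Type v'}
    [L.Structure N] (ι : L.Embedding M N) : L.Substructure N where
  carrier s := Set.range (ι.toFun s)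
  fun_mem f a ha := by
    choose b hb using ha
    exact ⟨Structure.funMap f b, by rw [ι.map_fun]; congr 1; funext j; exact hb j⟩

/-- An isomorphism of many-sorted structures. -/
structure Iso (L : MSLanguage.{u, uf, ur}) (M : L.Sorts → Type v) [L.Structure M]
    (N : L.Sorts → Type v') [L.Structure N] where
  toEquiv : ∀ s : L.Sorts, M s ≃ N s
  map_fun : ∀ {J : List L.Sorts} {s : L.Sorts} (f : L.Functions J s) (a : Tup M J),
    toEquiv s (Structure.funMap f a) = Structure.funMap f fun j => toEquiv (J.get j) (a j)
  map_rel : ∀ {J : List L.Sorts} (R : L.Relations J) (a : Tup M J),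
    Structure.RelMap R (fun j => toEquiv (J.get j) (a j)) ↔ Structure.RelMap R a

/-! ### Ultraproducts -/

section Ultraproduct

variable {I : Type w} (U : Ultrafilter I) {S : Type u}

/-- Sections of the sort `s` that are defined `U`-almost everywhere. -/
def PartialSection (M : I → S → Type v) (s : S) : Type (max v w) :=
  {x : (i : I) → Option (M i s) // ∀ᶠ i in (U : Filter I), (x i).isSome}

/-- Equality `U`-almost everywhere. -/
instance PartialSection.setoid (M : I → S → Type v) (s : S) : Setoid (PartialSection U M s) where
  r x y := ∀ᶠ i in (U : Filter I), x.1 i = y.1 i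
  iseqv :=
    { refl := fun _ => Eventually.of_forall fun _ => rfl
      symm := fun h => h.mono fun _ e => e.symm
      trans := fun h h' => (h.and h').mono fun _ e => e.1.trans e.2 }

/-- The sorts of the ultraproduct `∏ M_i / U`. For a sort that is nonempty in every `M_i` this is
the usual quotient of the full product; almost everywhere defined sections give the right answer
also when that sort is empty in some of the `M_i` (as may happen for substructures). -/
def Ultraproduct (M : I → S → Type v) (s : S) : Type (max v w) :=
  Quotient (PartialSection.setoid U M s)

/-- A representative of an element of the ultraproduct. -/
noncomputable def Ultraproduct.rep {M : I → S → Type v} {s : S} (x : Ultraproduct U M s) :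
    PartialSection U M s :=
  Quotient.out x

open Classical in
/-- The ultraproduct structure: functions are computed coordinatewise, and a relation holds when
it holds in `U`-almost every coordinate. -/
noncomputable instance Ultraproduct.ultraproductStructure {L : MSLanguage.{u, uf, ur}}
    (M : I → L.Sorts → Type v) [∀ i, L.Structure (M i)] : L.Structure (Ultraproduct U M) where
  funMap {J s} f x := Quotient.mk _
    ⟨fun i => if h : ∀ j, ((x j).rep.1 i).isSome then
        some (Structure.funMap f fun j => ((x j).rep.1 i).get (h j)) else none, by
      filter_upwards [eventually_all.2 fun j => (x j).rep.2] with i hi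
      simp [hi]⟩
  RelMap {J} R x := ∀ᶠ i in (U : Filter I),
    ∃ a : Tup (M i) J, (∀ j, (x j).rep.1 i = some (a j)) ∧ Structure.RelMap R a

end Ultraproduct

/-! ### Definable and algebraic closure, Galois groups -/

section Galois

variable {M : L.Sorts → Type v} [L.Structure M]

/-- Definable closure: elements that are the unique solution of a formula with parameters
in `A`. -/
def dcl (A : ∀ s : L.Sorts, Set (M s)) (s : L.Sorts) : Set (M s) :=
  {b | ∃ (Γ : List L.Sorts) (φ : L.Formula (s :: Γ)) (a : Tup M Γ),
    (∀ j, a j ∈ A (Γ.get j)) ∧ {x : M s | φ.Realize (Tup.cons x a)} = {b}}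

/-- Algebraic closure: elements of finite sets definable with parameters in `A`. -/
def acl (A : ∀ s : L.Sorts, Set (M s)) (s : L.Sorts) : Set (M s) :=
  {b | ∃ (Γ : List L.Sorts) (φ : L.Formula (s :: Γ)) (a : Tup M Γ),
    (∀ j, a j ∈ A (Γ.get j)) ∧ {x : M s | φ.Realize (Tup.cons x a)}.Finite ∧
      φ.Realize (Tup.cons b a)}

/-- `K = dcl(K)`. -/
def Substructure.IsDefinablyClosed (K : L.Substructure M) : Prop :=
  ∀ s, dcl K.carrier s = K.carrier s

/-- `Aut(B/A)`: the sort-preserving permutations of `B` that are elementary in `M` and fix the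
elements of `A`. (Under quantifier elimination, when `B` is a substructure, these are just the
automorphisms of the `L`-structure `B` over `A`.) -/
def autGroup (B A : ∀ s : L.Sorts, Set (M s)) : Subgroup (∀ s : L.Sorts, Equiv.Perm (B s)) where
  carrier := {σ | (∀ (Γ : List L.Sorts) (φ : L.Formula Γ) (b : Tup (fun s => B s) Γ),
      φ.Realize (fun j => (σ _ (b j)).1) ↔ φ.Realize (fun j => (b j).1)) ∧
    ∀ (s : L.Sorts) (x : B s), x.1 ∈ A s → σ s x = x}
  one_mem' := ⟨fun _ _ _ => Iff.rfl, fun _ _ _ => rfl⟩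
  mul_mem' {σ τ} hσ hτ :=
    ⟨fun Γ φ b => (hσ.1 Γ φ fun j => τ _ (b j)).trans (hτ.1 Γ φ b), fun s x hx => by
      rw [Pi.mul_apply, Equiv.Perm.mul_apply, hτ.2 s x hx, hσ.2 s x hx]⟩
  inv_mem' {σ} hσ :=
    ⟨fun Γ φ b => by
      have h := hσ.1 Γ φ fun j => (σ _)⁻¹ (b j)
      simpa using h.symm, fun s x hx => by
      rw [Pi.inv_apply, Equiv.Perm.inv_eq_iff_eq, hσ.2 s x hx]⟩

/-- `Aut(B/A)` carries the topology of pointwise convergence on the discrete set `B`. -/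
instance autGroup.topology (B A : ∀ s : L.Sorts, Set (M s)) : TopologicalSpace (autGroup B A) :=
  TopologicalSpace.induced (fun σ (p : Σ s : L.Sorts, B s) => σ.1 p.1 p.2)
    (@Pi.topologicalSpace _ _ fun _ => ⊥)

/-- The absolute Galois group `G(K) = Aut(acl(K)/K)` of a definably closed `K`. -/
abbrev absGal (K : L.Substructure M) : Type (max u v) :=
  autGroup (acl K.carrier) K.carrier

/-- The fixed points `acl(K)^H` of a subgroup `H` of `G(K)`. -/
def fixedPts (K : L.Substructure M) (H : Subgroup (absGal K)) (s : L.Sorts) : Set (M s) :=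
  {x | ∃ hx : x ∈ acl K.carrier s, ∀ σ ∈ H, σ.1 s ⟨x, hx⟩ = ⟨x, hx⟩}

/-- `Aut_J(B/A)`: the permutations of `S_J(B)` induced by the elements of `Aut(B/A)`. -/
def autTup (B A : ∀ s : L.Sorts, Set (M s)) (J : List L.Sorts) :
    Set (Equiv.Perm (Tup (fun s => B s) J)) :=
  Set.range fun σ : autGroup B A => Equiv.piCongrRight fun j => σ.1 (J.get j)

/-- The sorting data `F(N)` of an open normal subgroup `N` of `G(K)`: the tuples `J` of sorts with
`|Aut_J(acl(K)^N/K)| = |Aut(acl(K)^N/K)|`. (These groups are finite.) -/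
def sortData (K : L.Substructure M) (N : OpenNormalSubgroup (absGal K)) : Set (List L.Sorts) :=
  {J | Nat.card (autTup (fixedPts K N.toSubgroup) K.carrier J) =
    Nat.card (autGroup (fixedPts K N.toSubgroup) K.carrier)}

end Galois

/-! ### The sorted complete system of a definably closed substructure -/

/-- Relation symbols of the language of sorted complete systems. -/
inductive LGRel (S : Type u) : List (ℕ × List S) → Type u
  | le (m m' : ℕ × List S) : LGRel S [m, m']
  | C (m m' : ℕ × List S) : LGRel S [m, m']
  | P (m : ℕ × List S) : LGRel S [m, m, m]

/-- The language of sorted complete systems over the set `S` of sorts: its sorts are the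
`m(k,J)` for `k : ℕ` and finite tuples `J` from `S`. -/
def LG (S : Type u) : MSLanguage.{u, 0, u} where
  Sorts := ℕ × List S
  Functions _ _ := Empty
  Relations := LGRel S

section SG

variable {M : L.Sorts → Type v} [L.Structure M]

/-- The sort `m(k,J)` of `SG(K)`: the cosets `gH` where `H` is an open normal subgroup of `G(K)`
with `[G(K) : H] ≤ k` and `J ∈ F(H)`. -/
structure SGCoset (K : L.Substructure M) (k : ℕ) (J : List L.Sorts) where
  H : OpenNormalSubgroup (absGal K)
  coset : absGal K ⧸ H.toSubgroup
  finiteIndex : H.toSubgroup.FiniteIndex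
  index_le : H.toSubgroup.index ≤ k
  mem_sortData : J ∈ sortData K H

namespace SGCoset

variable {K : L.Substructure M}

/-- `gH ≤ g'H'` iff `H ⊆ H'`. -/
def le {k k' : ℕ} {J J' : List L.Sorts} (x : SGCoset K k J) (x' : SGCoset K k' J') : Prop :=
  x.H.toSubgroup ≤ x'.H.toSubgroup

/-- `C(gH, g'H')` iff `H ⊆ H'` and `gH' = g'H'`. -/
def C {k k' : ℕ} {J J' : List L.Sorts} (x : SGCoset K k J) (x' : SGCoset K k' J') : Prop :=
  x.H.toSubgroup ≤ x'.H.toSubgroup ∧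
    ∃ g : absGal K, x.coset = QuotientGroup.mk g ∧ x'.coset = QuotientGroup.mk g

/-- `P(g₁H₁, g₂H₂, g₃H₃)` iff `H₁ = H₂ = H₃` and `g₁g₂H₁ = g₃H₁`. -/
def P {k : ℕ} {J : List L.Sorts} (x₁ x₂ x₃ : SGCoset K k J) : Prop :=
  x₁.H = x₂.H ∧ x₂.H = x₃.H ∧ ∃ g₁ g₂ : absGal K, x₁.coset = QuotientGroup.mk g₁ ∧
    x₂.coset = QuotientGroup.mk g₂ ∧ x₃.coset = QuotientGroup.mk (g₁ * g₂)

end SGCoset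

/-- The sorts of `SG(K)`. -/
def SG (K : L.Substructure M) (m : (LG L.Sorts).Sorts) : Type (max u v) :=
  SGCoset K m.1 m.2

/-- The relations of `SG(K)`. -/
def SG.rel (K : L.Substructure M) :
    {w : List (ℕ × List L.Sorts)} → LGRel L.Sorts w → Tup (SG K) w → Prop
  | _, .le _ _, x => SGCoset.le (x (0 : Fin 2)) (x (1 : Fin 2))
  | _, .C _ _, x => SGCoset.C (x (0 : Fin 2)) (x (1 : Fin 2))
  | _, .P _, x => SGCoset.P (x (0 : Fin 3)) (x (1 : Fin 3)) (x (2 : Fin 3))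

/-- The sorted complete system `SG(K)` as a structure. -/
instance SG.sgStructure (K : L.Substructure M) : (LG L.Sorts).Structure (SG K) where
  funMap f _ := Empty.elim f
  RelMap R x := SG.rel K R x

end SG

end MSLanguage

/-!
The proof compares everything inside the ultrapower `C*` of `C`.

*The first assertion.* By the theorem of Łoś (`realize_ultraproduct_iff`) `C*` is a model of
`Th(C)`, and the ultraproduct `K*` of the `K i` is a substructure of it (`ultraIncl`).

*Coordinates.* Let `A` be the image of `K*` in a model `N` of `Th(C)`. By quantifier elimination
the embeddings of `K*` in `N` and in `C*` form an elementary relation between `N` and `C*`. By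
Zorn's lemma it extends to one whose domain and range are algebraically closed
(`IsElementary.exists_maximal`), since an algebraic element satisfies a formula with the least
possible number of solutions, which isolates its type. Hence every element of `acl(A)` has
coordinates in `C`, indexed by `I`, and truth in `N` is truth in almost every coordinate
(`Coordinates`, `exists_coordinates`). As a first consequence `A` is definably closed
(`Coordinates.isDefinablyClosed`).

*Galois theory in one structure.* The same extension lemma shows that elementary maps over `K`
between subsets of `acl(K)` come from `G(K)` (`exists_absGal_of_isElementary`), so that the fixed
points of `G(K)` are `K` if `K` is definably closed. Uniform elimination of imaginaries codes finite
sets of tuples from `acl(K)`, with one formula for all sets of bounded size and all `K`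
(`HasUniformEI.exists_code`). It follows that an open subgroup `H` is the group of all
automorphisms that fix its fixed points, that `Aut(L/K)` is `G(K)/H` for `L` the fixed points of a
normal `H`, and that `J` belongs to the sorting data of `H` exactly if `G(K)/H` acts faithfully
on `S_J(L)` (`HasUniformEI.mem_sortData_iff`). So the subgroups occurring in the sort `m(k,J)` are
stabilizers of fewer than `k` tuples of sorts `J` (`HasUniformEI.exists_generators`).

*Limits.* A sequence of automorphisms in the groups `G(K i)` acts on coordinates, and this gives a
homomorphism from the product of the `G(K i)` to `G(A)` (`Coordinates.lim`). Its image is dense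
(`Coordinates.exists_lim_eq_on`): the orbits of the coordinates of a tuple have bounded size, so
their codes give a code over `A` of a set that is preserved by `G(A)`. In the same way, sequences of
elements with boundedly many conjugates are coordinates of elements of `acl(A)`
(`Coordinates.exists_coord_eq`).

*The isomorphism.* An open subgroup of `G(A)` is the limit of subgroups of the `G(K i)` if
membership of limits of sequences in it is membership almost everywhere. By density, inclusion,
normality and bounds on the index pass between subgroups and their limits. Stabilizers of
coordinates converge to stabilizers, so sequences in the sorts `m(k,J)` of the `SG(K i)` have limits
in that of `SG(A)` (`exists_isLimitCoset`), and everything there is such a limit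
(`exists_isLimitCoset_of_mem`). Taking limits is the isomorphism (`nonempty_iso_SG`).
-/

namespace MSLanguage

/-! ### Tuples -/

section Tup

variable {S : Type u} {M : S → Type v} {N : S → Type v'}

theorem tup_eq_cons {s : S} {J : List S} (a : Tup M (s :: J)) :
    a = Tup.cons (a (0 : Fin (J.length + 1))) (fun j => a (Fin.succ j)) := by
  funext j
  exact Fin.cases (motive := fun j => a j = Tup.cons (M := M) (J := J)
    (a (0 : Fin (J.length + 1))) (fun j => a (Fin.succ j)) j) rfl (fun _ => rfl) j

theorem map_cons (g : ∀ s, M s → N s) {s : S} {J : List S} (x : M s) (a : Tup M J) :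
    (fun j => g _ (Tup.cons x a j)) = Tup.cons (g s x) (fun j => g _ (a j)) := by
  rw [tup_eq_cons (fun j => g _ (Tup.cons x a j))]
  rfl

theorem map_append (g : ∀ s, M s → N s) : ∀ {J J' : List S} (a : Tup M J) (b : Tup M J'),
    (fun j => g _ (a.append b j)) = Tup.append (fun j => g _ (a j)) (fun j => g _ (b j))
  | [], _, _, _ => rfl
  | s :: J, _, a, b => by
    have h := map_append g (J := J) (fun j => a (Fin.succ j)) b
    exact (map_cons g _ _).trans (congrArg _ h)

theorem cons_fst {s : S} {J : List S} (x : M s × N s) (a : Tup (fun s => M s × N s) J) :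
    (fun j => (Tup.cons (M := fun s => M s × N s) x a j).1) = Tup.cons x.1 fun j => (a j).1 :=
  map_cons (M := fun s => M s × N s) (fun _ z => z.1) x a

theorem cons_snd {s : S} {J : List S} (x : M s × N s) (a : Tup (fun s => M s × N s) J) :
    (fun j => (Tup.cons (M := fun s => M s × N s) x a j).2) = Tup.cons x.2 fun j => (a j).2 :=
  map_cons (M := fun s => M s × N s) (fun _ z => z.2) x a

theorem append_fst {J J' : List S} (a : Tup (fun s => M s × N s) J)
    (b : Tup (fun s => M s × N s) J') :
    (fun j => (a.append b j).1) = Tup.append (fun j => (a j).1) fun j => (b j).1 :=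
  map_append (M := fun s => M s × N s) (fun _ z => z.1) a b

theorem append_snd {J J' : List S} (a : Tup (fun s => M s × N s) J)
    (b : Tup (fun s => M s × N s) J') :
    (fun j => (a.append b j).2) = Tup.append (fun j => (a j).2) fun j => (b j).2 :=
  map_append (M := fun s => M s × N s) (fun _ z => z.2) a b

/-- The inclusion of tuples from a subset. -/
def valTup {A : ∀ s, Set (M s)} {Γ : List S} (a : Tup (fun s => A s) Γ) :
    Tup M Γ := fun j => (a j).1

theorem valTup_injective {A : ∀ s, Set (M s)} {Γ : List S} :
    Function.Injective (valTup (A := A) (Γ := Γ)) :=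
  fun _ _ h => funext fun j => Subtype.ext (congrFun h j)

theorem valTup_cons {A : ∀ s, Set (M s)} {s : S} (x : A s)
    {Γ : List S} (a : Tup (fun s => A s) Γ) :
    valTup (Tup.cons (M := fun s => A s) x a) = Tup.cons x.1 (valTup a) :=
  map_cons (M := fun s => A s) (fun _ z => z.1) x a

theorem valTup_append {A : ∀ s, Set (M s)} {Γ Δ : List S} (a : Tup (fun s => A s) Γ)
    (b : Tup (fun s => A s) Δ) : valTup (a.append b) = (valTup a).append (valTup b) :=
  map_append (M := fun s => A s) (fun _ z => z.1) a b

theorem forall_cons {s : S} {J : List S} (p : ∀ s, M s → N s → Prop) {x : M s} {y : N s}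
    {a : Tup M J} {b : Tup N J} (h : p s x y) (hab : ∀ j, p _ (a j) (b j)) :
    ∀ j, p _ (Tup.cons x a j) (Tup.cons y b j) :=
  fun j => Fin.cases (motive := fun j => p _ (Tup.cons x a j) (Tup.cons y b j)) h hab j

theorem forall_append (p : ∀ s, M s → N s → Prop) : ∀ {J J' : List S} {a : Tup M J} {b : Tup M J'}
    {a' : Tup N J} {b' : Tup N J'}, (∀ j, p _ (a j) (a' j)) → (∀ j, p _ (b j) (b' j)) →
    ∀ j, p _ (a.append b j) (a'.append b' j)
  | [], _, _, _, _, _, _, hb => hb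
  | _ :: J, _, _, _, _, _, ha, hb =>
    forall_cons p (ha (0 : Fin (J.length + 1)))
      (forall_append (J := J) p (fun j => ha (Fin.succ j)) hb)

theorem forall_cons_mem {s : S} {J : List S} (p : ∀ s, M s → Prop) {x : M s} {a : Tup M J}
    (h : p s x) (ha : ∀ j, p _ (a j)) : ∀ j, p _ (Tup.cons x a j) :=
  forall_cons (fun s x (_ : M s) => p s x) (y := x) (b := a) h ha

theorem forall_append_mem (p : ∀ s, M s → Prop) {J J' : List S} {a : Tup M J} {b : Tup M J'}
    (ha : ∀ j, p _ (a j)) (hb : ∀ j, p _ (b j)) : ∀ j, p _ (a.append b j) :=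
  forall_append (fun s x (_ : M s) => p s x) (a' := a) (b' := b) ha hb

theorem forall_append_iff {Γ Δ : List S} {p : Tup M (Γ ++ Δ) → Prop} :
    (∀ a, p a) ↔ ∀ (a : Tup M Γ) (b : Tup M Δ), p (a.append b) := by
  refine ⟨fun h a b => h _, fun h => ?_⟩
  induction Γ with
  | nil => exact fun a => h (fun j => j.elim0) a
  | cons s Γ ih =>
    intro a
    rw [show a = _ from tup_eq_cons (J := Γ ++ Δ) a]
    exact ih (p := fun d => p (Tup.cons (a (0 : Fin ((Γ ++ Δ).length + 1))) d))
      (fun c d => h (Tup.cons (a (0 : Fin ((Γ ++ Δ).length + 1))) c) d) _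

theorem exists_tup_range_eq {F : Set (Σ s, M s)} (hF : F.Finite) :
    ∃ (J : List S) (a : Tup M J), Set.range (fun j => (⟨_, a j⟩ : Σ s, M s)) = F := by
  induction F, hF using Set.Finite.induction_on with
  | empty => exact ⟨[], fun j => j.elim0, by ext; simp⟩
  | @insert p F _ _ ih =>
    obtain ⟨J, a, rfl⟩ := ih
    refine ⟨p.1 :: J, Tup.cons p.2 a, ?_⟩
    ext q
    constructor
    · rintro ⟨j, rfl⟩
      revert j
      exact forall_cons_mem (fun s x => (⟨s, x⟩ : Σ s, M s) ∈ insert p _) (Or.inl rfl)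
        (fun j => Or.inr ⟨j, rfl⟩)
    · rintro (rfl | ⟨j, rfl⟩)
      · exact ⟨(0 : Fin (J.length + 1)), rfl⟩
      · exact ⟨Fin.succ j, rfl⟩

end Tup

/-! ### Substitution and definable connectives -/

variable {L : MSLanguage.{u, uf, ur}}

section Formulas

/-- Simultaneous substitution of terms for the variables of a term. -/
def Term.subst {Γ Δ : List L.Sorts} (σ : Tup (L.Term Δ) Γ) :
    {s : L.Sorts} → L.Term Γ s → L.Term Δ s
  | _, .var j => σ j
  | _, .func f t => .func f fun j => (t j).subst σ

/-- The variables of `Γ`, as terms in `Γ` extended by one variable in front. -/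
def shift (s : L.Sorts) (Γ : List L.Sorts) : Tup (L.Term (s :: Γ)) Γ :=
  fun j => .var (Γ := s :: Γ) (Fin.succ j)

/-- The first variable, as a term. -/
def var₀ (s : L.Sorts) (Γ : List L.Sorts) : L.Term (s :: Γ) s :=
  .var (Γ := s :: Γ) (0 : Fin (Γ.length + 1))

/-- A substitution extended under a quantifier. -/
def lift (s : L.Sorts) {Γ Δ : List L.Sorts} (σ : Tup (L.Term Δ) Γ) :
    Tup (L.Term (s :: Δ)) (s :: Γ) :=
  Tup.cons (var₀ s Δ) fun j => (σ j).subst (shift s Δ)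

/-- Simultaneous substitution of terms for the free variables of a formula. -/
def Formula.subst : {Γ : List L.Sorts} → L.Formula Γ → {Δ : List L.Sorts} →
    Tup (L.Term Δ) Γ → L.Formula Δ
  | _, .falsum, _, _ => .falsum
  | _, .equal t t', _, σ => .equal (t.subst σ) (t'.subst σ)
  | _, .rel R t, _, σ => .rel R fun j => (t j).subst σ
  | _, .imp φ ψ, _, σ => .imp (φ.subst σ) (ψ.subst σ)
  | _, .all s φ, _, σ => .all s (φ.subst (lift s σ))

/-- The first block of variables of an appended context. -/
def inl : (Γ Δ : List L.Sorts) → Tup (L.Term (Γ ++ Δ)) Γ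
  | [], _ => fun j => j.elim0
  | s :: Γ, Δ => Tup.cons (var₀ s (Γ ++ Δ)) fun j => (inl Γ Δ j).subst (shift s (Γ ++ Δ))

/-- The second block of variables of an appended context. -/
def inr : (Γ Δ : List L.Sorts) → Tup (L.Term (Γ ++ Δ)) Δ
  | [], _ => fun j => .var j
  | s :: Γ, Δ => fun j => (inr Γ Δ j).subst (shift s (Γ ++ Δ))

variable {Γ Δ : List L.Sorts}

/-- Negation. -/
def Formula.not (φ : L.Formula Γ) : L.Formula Γ := .imp φ .falsum

/-- Conjunction. -/
def Formula.and (φ ψ : L.Formula Γ) : L.Formula Γ := (Formula.imp φ ψ.not).not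

/-- Disjunction. -/
def Formula.or (φ ψ : L.Formula Γ) : L.Formula Γ := .imp φ.not ψ

/-- Equivalence. -/
def Formula.iff (φ ψ : L.Formula Γ) : L.Formula Γ := (Formula.imp φ ψ).and (.imp ψ φ)

/-- Existential quantification over the first variable. -/
def Formula.ex (s : L.Sorts) (φ : L.Formula (s :: Γ)) : L.Formula Γ := (Formula.all s φ.not).not

/-- Universal quantification over the first block of variables. -/
def Formula.allBlock : (Γ : List L.Sorts) → {Δ : List L.Sorts} → L.Formula (Γ ++ Δ) → L.Formula Δ
  | [], _, φ => φ
  | s :: Γ, _, φ => Formula.allBlock Γ (.all s φ)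

/-- Existential quantification over the first block of variables. -/
def Formula.exBlock (Γ : List L.Sorts) (φ : L.Formula (Γ ++ Δ)) : L.Formula Δ :=
  (Formula.allBlock Γ φ.not).not

/-- The universal closure of a formula. -/
def Formula.close : {Γ : List L.Sorts} → L.Formula Γ → L.Formula []
  | [], φ => φ
  | s :: _, φ => Formula.close (.all s φ)

/-- Coordinatewise equality of two tuples of terms. -/
def Formula.equalTup : {Γ : List L.Sorts} → Tup (L.Term Δ) Γ → Tup (L.Term Δ) Γ → L.Formula Δ
  | [], _, _ => Formula.falsum.not
  | s :: Γ, σ, τ => (Formula.equal (s := s) (σ (0 : Fin (Γ.length + 1)))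
      (τ (0 : Fin (Γ.length + 1)))).and
      (Formula.equalTup (Γ := Γ) (fun j => σ (Fin.succ j)) (fun j => τ (Fin.succ j)))

/-- The formula expressing that at most `k` values of the first variable satisfy `φ`, by recursion
on `k`: there is no solution, or some value can be taken away to leave at most `k - 1`. -/
def Formula.cardLe (s : L.Sorts) : ℕ → {Γ : List L.Sorts} → L.Formula (s :: Γ) → L.Formula Γ
  | 0, _, φ => .all s φ.not
  | k + 1, Γ, φ => (Formula.all s φ.not).or <| .ex s <| Formula.cardLe s k <|
      (φ.subst (lift s (shift s Γ))).and
        (Formula.equal (var₀ s (s :: Γ)) ((var₀ s Γ).subst (shift s (s :: Γ)))).not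

end Formulas

section Realize

variable {M : L.Sorts → Type v} [L.Structure M] {Γ Δ : List L.Sorts}

@[simp] theorem realize_shift (s : L.Sorts) (x : M s) (a : Tup M Γ) (j : Fin Γ.length) :
    (shift (L := L) s Γ j).realize (Tup.cons x a) = a j := rfl

@[simp] theorem realize_var₀ (s : L.Sorts) (x : M s) (a : Tup M Γ) :
    (var₀ (L := L) s Γ).realize (Tup.cons x a) = x := rfl

@[simp] theorem Term.realize_subst (σ : Tup (L.Term Δ) Γ) (a : Tup M Δ) :
    ∀ {s : L.Sorts} (t : L.Term Γ s),
      (t.subst σ).realize a = t.realize fun j => (σ j).realize a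
  | _, .var _ => rfl
  | _, .func f t => congrArg (Structure.funMap f)
      (funext fun j => Term.realize_subst σ a (t j))

theorem realize_lift (s : L.Sorts) (σ : Tup (L.Term Δ) Γ) (x : M s) (a : Tup M Δ) :
    (fun j => (lift s σ j).realize (Tup.cons x a)) = Tup.cons x fun j => (σ j).realize a := by
  refine (map_cons (M := L.Term (s :: Δ)) (fun _ t => t.realize (Tup.cons x a)) _ _).trans ?_
  congr 1
  funext j
  simp

@[simp] theorem Formula.realize_subst : ∀ {Γ : List L.Sorts} (φ : L.Formula Γ)
    {Δ : List L.Sorts} (σ : Tup (L.Term Δ) Γ) (a : Tup M Δ),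
    (φ.subst σ).Realize a ↔ φ.Realize fun j => (σ j).realize a
  | _, .falsum, _, _, _ => Iff.rfl
  | _, .equal t t', _, σ, a => by simp [Formula.subst, Formula.Realize]
  | _, .rel R t, _, σ, a => by simp [Formula.subst, Formula.Realize]
  | _, .imp φ ψ, _, σ, a =>
    imp_congr (Formula.realize_subst φ σ a) (Formula.realize_subst ψ σ a)
  | _, .all s φ, _, σ, a => forall_congr' fun x => by
    rw [Formula.realize_subst φ, realize_lift]

theorem realize_inl : ∀ {Γ Δ : List L.Sorts} (a : Tup M Γ) (b : Tup M Δ),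
    (fun j => (inl (L := L) Γ Δ j).realize (a.append b)) = a
  | [], _, _, _ => funext fun j => j.elim0
  | s :: Γ, Δ, a, b => by
    rw [tup_eq_cons a]
    refine (map_cons (M := L.Term ((s :: Γ) ++ Δ)) (fun _ t => t.realize _) _ _).trans ?_
    congr 1
    funext j
    refine (Term.realize_subst _ _ _).trans ?_
    exact congrFun (realize_inl (fun j => a (Fin.succ j)) b) j

theorem realize_inr : ∀ {Γ Δ : List L.Sorts} (a : Tup M Γ) (b : Tup M Δ),
    (fun j => (inr (L := L) Γ Δ j).realize (a.append b)) = b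
  | [], _, _, _ => rfl
  | s :: Γ, Δ, a, b => by
    funext j
    refine (Term.realize_subst _ _ _).trans ?_
    exact congrFun (realize_inr (fun j => a (Fin.succ j)) b) j

theorem realize_append {J J' : List L.Sorts} (σ : Tup (L.Term Δ) J)
    (τ : Tup (L.Term Δ) J') (a : Tup M Δ) :
    (fun j => (σ.append τ j).realize a) =
      Tup.append (fun j => (σ j).realize a) (fun j => (τ j).realize a) :=
  map_append (fun _ t => t.realize a) σ τ

theorem realize_cons {J : List L.Sorts} {s : L.Sorts} (t : L.Term Δ s)
    (τ : Tup (L.Term Δ) J) (a : Tup M Δ) :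
    (fun j => (Tup.cons t τ j).realize a) =
      Tup.cons (t.realize a) (fun j => (τ j).realize a) :=
  map_cons (fun _ t => t.realize a) t τ

@[simp] theorem Formula.realize_equal {s : L.Sorts} (t t' : L.Term Γ s) (a : Tup M Γ) :
    (Formula.equal t t').Realize a ↔ t.realize a = t'.realize a := Iff.rfl

@[simp] theorem Formula.realize_imp (φ ψ : L.Formula Γ) (a : Tup M Γ) :
    (Formula.imp φ ψ).Realize a ↔ (φ.Realize a → ψ.Realize a) := Iff.rfl

@[simp] theorem Formula.realize_all (s : L.Sorts) (φ : L.Formula (s :: Γ)) (a : Tup M Γ) :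
    (Formula.all s φ).Realize a ↔ ∀ x : M s, φ.Realize (Tup.cons x a) := Iff.rfl

@[simp] theorem Formula.realize_not (φ : L.Formula Γ) (a : Tup M Γ) :
    φ.not.Realize a ↔ ¬ φ.Realize a := Iff.rfl

@[simp] theorem Formula.realize_and (φ ψ : L.Formula Γ) (a : Tup M Γ) :
    (φ.and ψ).Realize a ↔ φ.Realize a ∧ ψ.Realize a := by
  simp [Formula.and]

@[simp] theorem Formula.realize_or (φ ψ : L.Formula Γ) (a : Tup M Γ) :
    (φ.or ψ).Realize a ↔ φ.Realize a ∨ ψ.Realize a := by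
  simp [Formula.or, or_iff_not_imp_left]

@[simp] theorem Formula.realize_iff (φ ψ : L.Formula Γ) (a : Tup M Γ) :
    (φ.iff ψ).Realize a ↔ (φ.Realize a ↔ ψ.Realize a) := by
  simp [Formula.iff, iff_def]

@[simp] theorem Formula.realize_ex (s : L.Sorts) (φ : L.Formula (s :: Γ)) (a : Tup M Γ) :
    (Formula.ex s φ).Realize a ↔ ∃ x : M s, φ.Realize (Tup.cons x a) := by
  simp [Formula.ex]

@[simp] theorem Formula.realize_allBlock : ∀ {Γ Δ : List L.Sorts} (φ : L.Formula (Γ ++ Δ))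
    (b : Tup M Δ), (Formula.allBlock Γ φ).Realize b ↔ ∀ a : Tup M Γ, φ.Realize (a.append b)
  | [], _, φ, b => ⟨fun h _ => h, fun h => h fun j => j.elim0⟩
  | s :: Γ, _, φ, b => by
    refine (Formula.realize_allBlock (Γ := Γ) (.all s φ) b).trans ?_
    exact ⟨fun h a => h (fun j => a (Fin.succ j)) _, fun h a x => h (Tup.cons x a)⟩

@[simp] theorem Formula.realize_exBlock (φ : L.Formula (Γ ++ Δ)) (b : Tup M Δ) :
    (Formula.exBlock Γ φ).Realize b ↔ ∃ a : Tup M Γ, φ.Realize (a.append b) := by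
  simp [Formula.exBlock]

theorem Formula.realize_close : ∀ {Γ : List L.Sorts} (φ : L.Formula Γ),
    φ.close.Realize (M := M) (fun j => j.elim0) ↔ ∀ a : Tup M Γ, φ.Realize a
  | [], φ => ⟨fun h a => by
      rw [show a = fun j => j.elim0 from funext fun j => j.elim0]; exact h, fun h => h _⟩
  | s :: Γ, φ => by
    refine (Formula.realize_close (.all s φ)).trans ?_
    exact ⟨fun h a => by rw [tup_eq_cons a]; exact h _ _, fun h a x => h _⟩

@[simp] theorem Formula.realize_equalTup : ∀ {Γ : List L.Sorts} (σ τ : Tup (L.Term Δ) Γ)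
    (a : Tup M Δ), (Formula.equalTup σ τ).Realize a ↔
      (fun j => (σ j).realize a) = fun j => (τ j).realize a
  | [], _, _, _ => ⟨fun _ => funext fun j => j.elim0, fun _ h => h⟩
  | s :: Γ, σ, τ, a => by
    rw [Formula.equalTup, Formula.realize_and, Formula.realize_equalTup]
    constructor
    · rintro ⟨h, h'⟩
      funext j
      exact Fin.cases (motive := fun j => (σ j).realize a = (τ j).realize a) h
        (fun j => congrFun h' j) j
    · exact fun h => ⟨congrFun h (0 : Fin (Γ.length + 1)), funext fun j => congrFun h (Fin.succ j)⟩

theorem Formula.realize_cardLe (s : L.Sorts) : ∀ (k : ℕ) {Γ : List L.Sorts}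
    (φ : L.Formula (s :: Γ)) (a : Tup M Γ),
    (Formula.cardLe s k φ).Realize a ↔ {x : M s | φ.Realize (Tup.cons x a)}.encard ≤ k
  | 0, Γ, φ, a => by
    simp [Formula.cardLe, Set.eq_empty_iff_forall_notMem]
  | k + 1, Γ, φ, a => by
    rw [Formula.cardLe, Formula.realize_or, Formula.realize_ex]
    simp only [Formula.realize_cardLe s k, Formula.realize_and, Formula.realize_subst,
      realize_lift, realize_shift, Formula.realize_not, Formula.realize_equal, realize_var₀,
      Term.realize_subst, Formula.realize_all]
    constructor
    · rintro (h | ⟨z, hz⟩)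
      · have h0 : {x : M s | φ.Realize (Tup.cons x a)} = ∅ := Set.eq_empty_iff_forall_notMem.2 h
        rw [h0, Set.encard_empty]
        exact zero_le
      · refine (Set.encard_le_encard (t := insert z ({x : M s | φ.Realize (Tup.cons x a)} \ {z}))
          fun x hx => ?_).trans ((Set.encard_insert_le _ z).trans ?_)
        · by_cases h : x = z
          exacts [Or.inl h, Or.inr ⟨hx, h⟩]
        · push_cast
          exact add_le_add_left hz 1
    · intro h
      rcases Set.eq_empty_or_nonempty {x : M s | φ.Realize (Tup.cons x a)} with h0 | ⟨z, hz⟩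
      · exact Or.inl (Set.eq_empty_iff_forall_notMem.1 h0)
      · refine Or.inr ⟨z, ?_⟩
        rw [← Set.encard_sdiff_singleton_add_one hz] at h
        push_cast at h
        exact (ENat.add_le_add_iff_right (by simp)).1 h

end Realize

/-! ### Elementary relations between two structures -/

section Elementary

variable {L : MSLanguage.{u, uf, ur}} {M : L.Sorts → Type v} [L.Structure M]
  {N : L.Sorts → Type v'} [L.Structure N]

/-- A relation between two structures, given by its set of related pairs, is elementary when
coordinatewise related tuples satisfy the same formulas. An elementary relation is automatically
the graph of a partial injection, namely of a partial elementary map. -/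
def IsElementary (R : Set (Σ s : L.Sorts, M s × N s)) : Prop :=
  ∀ (Γ : List L.Sorts) (φ : L.Formula Γ) (p : Tup (fun s => M s × N s) Γ),
    (∀ j, (⟨_, p j⟩ : Σ s : L.Sorts, M s × N s) ∈ R) →
      (φ.Realize (fun j => (p j).1) ↔ φ.Realize (fun j => (p j).2))

/-- The domain of a relation. -/
def relDom (R : Set (Σ s : L.Sorts, M s × N s)) (s : L.Sorts) : Set (M s) :=
  {x | ∃ y, ⟨s, x, y⟩ ∈ R}

/-- The converse relation. -/
def relSwap (R : Set (Σ s : L.Sorts, M s × N s)) : Set (Σ s : L.Sorts, N s × M s) :=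
  {p | ⟨p.1, p.2.swap⟩ ∈ R}

theorem IsElementary.swap {R : Set (Σ s : L.Sorts, M s × N s)} (hR : IsElementary R) :
    IsElementary (relSwap R) :=
  fun Γ φ p hp => (hR Γ φ (fun j => (p j).swap) hp).symm

theorem IsElementary.mono {R R' : Set (Σ s : L.Sorts, M s × N s)} (hR : IsElementary R)
    (h : R' ⊆ R) : IsElementary R' :=
  fun Γ φ p hp => hR Γ φ p fun j => h (hp j)

/-- To be elementary it is enough that formulas are preserved in one direction. -/
theorem isElementary_of_imp {R : Set (Σ s : L.Sorts, M s × N s)}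
    (h : ∀ (Γ : List L.Sorts) (φ : L.Formula Γ) (p : Tup (fun s => M s × N s) Γ),
      (∀ j, (⟨_, p j⟩ : Σ s : L.Sorts, M s × N s) ∈ R) →
        φ.Realize (fun j => (p j).1) → φ.Realize (fun j => (p j).2)) : IsElementary R :=
  fun Γ φ p hp => ⟨h Γ φ p hp, not_imp_not.1 (h Γ φ.not p hp)⟩

theorem IsElementary.eq_iff {R : Set (Σ s : L.Sorts, M s × N s)} (hR : IsElementary R)
    {s : L.Sorts} {x x' : M s} {y y' : N s} (h : ⟨s, x, y⟩ ∈ R) (h' : ⟨s, x', y'⟩ ∈ R) :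
    x = x' ↔ y = y' :=
  hR [s, s] (.equal (var₀ s [s]) ((var₀ s []).subst (shift s [s])))
    (Tup.cons (x, y) (Tup.cons (x', y') fun j => j.elim0))
    (forall_cons_mem (fun s z => (⟨s, z⟩ : Σ s : L.Sorts, M s × N s) ∈ R) h
      (forall_cons_mem (fun s z => (⟨s, z⟩ : Σ s : L.Sorts, M s × N s) ∈ R) h' fun j => j.elim0))

/-- A formula with one distinguished variable is preserved by an elementary relation. -/
theorem IsElementary.realize_cons_iff {R : Set (Σ s : L.Sorts, M s × N s)} (hR : IsElementary R)
    {s : L.Sorts} {x : M s} {y : N s} (h : ⟨s, x, y⟩ ∈ R) {Γ : List L.Sorts}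
    (φ : L.Formula (s :: Γ)) (p : Tup (fun s => M s × N s) Γ)
    (hp : ∀ j, (⟨_, p j⟩ : Σ s : L.Sorts, M s × N s) ∈ R) :
    φ.Realize (Tup.cons x fun j => (p j).1) ↔ φ.Realize (Tup.cons y fun j => (p j).2) := by
  have := hR _ φ (Tup.cons (x, y) p)
    (forall_cons_mem (fun s z => (⟨s, z⟩ : Σ s : L.Sorts, M s × N s) ∈ R) h hp)
  rwa [cons_fst, cons_snd] at this

theorem acl_mono {A A' : ∀ s : L.Sorts, Set (M s)} (h : ∀ s, A s ⊆ A' s) (s : L.Sorts) :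
    acl A s ⊆ acl A' s :=
  fun _ ⟨Γ, φ, a, ha, h1, h2⟩ => ⟨Γ, φ, a, fun j => h _ (ha j), h1, h2⟩

theorem subset_acl (A : ∀ s : L.Sorts, Set (M s)) (s : L.Sorts) : A s ⊆ acl A s := fun x hx =>
  ⟨[s], .equal (var₀ s [s]) ((var₀ s []).subst (shift s [s])), Tup.cons x fun j => j.elim0,
    forall_cons_mem (fun s z => z ∈ A s) hx fun j => j.elim0,
    (Set.finite_singleton x).subset fun _ hy => hy, rfl⟩

/-- A tuple from a relation with one pair added is obtained by substitution from a tuple of the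
old relation together with the new pair. -/
theorem exists_subst_of_forall_mem_insert {R : Set (Σ s : L.Sorts, M s × N s)} {s : L.Sorts}
    (b : M s) (b' : N s) : ∀ {Δ : List L.Sorts} (p : Tup (fun s => M s × N s) Δ),
    (∀ j, (⟨_, p j⟩ : Σ s : L.Sorts, M s × N s) ∈ insert ⟨s, b, b'⟩ R) →
    ∃ (Θ : List L.Sorts) (q : Tup (fun s => M s × N s) Θ) (σ : Tup (L.Term (s :: Θ)) Δ),
      (∀ j, (⟨_, q j⟩ : Σ s : L.Sorts, M s × N s) ∈ R) ∧
      (fun j => (σ j).realize (Tup.cons b fun j => (q j).1)) = (fun j => (p j).1) ∧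
      (fun j => (σ j).realize (Tup.cons b' fun j => (q j).2)) = (fun j => (p j).2)
  | [], p, _ => ⟨[], fun j => j.elim0, fun j => j.elim0, fun j => j.elim0,
      funext fun j => j.elim0, funext fun j => j.elim0⟩
  | t :: Δ, p, hp => by
    obtain ⟨Θ, q, σ, hq, h1, h2⟩ := exists_subst_of_forall_mem_insert b b' (Δ := Δ)
      (fun j => p (Fin.succ j)) fun j => hp (Fin.succ j)
    obtain ⟨x, p, rfl⟩ : ∃ x p', p = Tup.cons x p' := ⟨_, _, tup_eq_cons p⟩
    have hx : (⟨t, x⟩ : Σ s : L.Sorts, M s × N s) ∈ insert ⟨s, b, b'⟩ R :=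
      hp (0 : Fin (Δ.length + 1))
    change (fun j => (σ j).realize (Tup.cons b fun j => (q j).1)) = (fun j => (p j).1) at h1
    change (fun j => (σ j).realize (Tup.cons b' fun j => (q j).2)) = (fun j => (p j).2) at h2
    rw [cons_fst, cons_snd]
    rcases hx with hx | hx
    · cases hx
      refine ⟨Θ, q, Tup.cons (var₀ _ Θ) σ, hq, ?_, ?_⟩
      · rw [realize_cons, h1]; rfl
      · rw [realize_cons, h2]; rfl
    · refine ⟨t :: Θ, Tup.cons x q, Tup.cons ((var₀ t Θ).subst (shift s (t :: Θ)))
        fun j => (σ j).subst (lift s (shift t Θ)),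
        forall_cons_mem (fun s z => (⟨s, z⟩ : Σ s : L.Sorts, M s × N s) ∈ R) hx hq, ?_, ?_⟩
      · rw [realize_cons, cons_fst, ← h1]
        refine congrArg _ (funext fun j => ?_)
        rw [Term.realize_subst, realize_lift]
        rfl
      · rw [realize_cons, cons_snd, ← h2]
        refine congrArg _ (funext fun j => ?_)
        rw [Term.realize_subst, realize_lift]
        rfl

/-- One-step extension: an element algebraic over the domain of an elementary relation satisfies
a formula over the domain all of whose solutions, in the other structure, extend the relation.
A formula with the least number of solutions will do. -/
theorem IsElementary.exists_isolating {R : Set (Σ s : L.Sorts, M s × N s)} (hR : IsElementary R)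
    {s : L.Sorts} {b : M s} (hb : b ∈ acl (relDom R) s) :
    ∃ (Γ : List L.Sorts) (φ : L.Formula (s :: Γ)) (p : Tup (fun s => M s × N s) Γ),
      (∀ j, (⟨_, p j⟩ : Σ s : L.Sorts, M s × N s) ∈ R) ∧
      {x : M s | φ.Realize (Tup.cons x fun j => (p j).1)}.Finite ∧
      φ.Realize (Tup.cons b fun j => (p j).1) ∧
      ∀ b' : N s, φ.Realize (Tup.cons b' fun j => (p j).2) →
        IsElementary (insert ⟨s, b, b'⟩ R) := by
  classical
  let Q : ℕ → Prop := fun n => ∃ (Γ : List L.Sorts) (φ : L.Formula (s :: Γ))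
    (p : Tup (fun s => M s × N s) Γ), (∀ j, (⟨_, p j⟩ : Σ s : L.Sorts, M s × N s) ∈ R) ∧
      {x : M s | φ.Realize (Tup.cons x fun j => (p j).1)}.Finite ∧
      φ.Realize (Tup.cons b fun j => (p j).1) ∧
      {x : M s | φ.Realize (Tup.cons x fun j => (p j).1)}.ncard = n
  have hQ : ∃ n, Q n := by
    obtain ⟨Γ, φ, a, ha, h1, h2⟩ := hb
    choose a' ha' using ha
    exact ⟨_, Γ, φ, fun j => (a j, a' j), ha', h1, h2, rfl⟩
  obtain ⟨Γ, φ, p, hp, hfin, hφ, hcard⟩ := Nat.find_spec hQ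
  refine ⟨Γ, φ, p, hp, hfin, hφ, fun b' hb' => isElementary_of_imp fun Δ ψ d hd hψ => ?_⟩
  obtain ⟨Θ, q, σ, hq, h1, h2⟩ := exists_subst_of_forall_mem_insert b b' d hd
  -- `φ ∧ ψ` has the same solutions as `φ`, by minimality.
  let τ : Tup (L.Term (s :: (Γ ++ Θ))) (s :: Γ) := lift s (inl Γ Θ)
  let τ' : Tup (L.Term (s :: (Γ ++ Θ))) (s :: Θ) := lift s (inr Γ Θ)
  let χ : L.Formula (s :: (Γ ++ Θ)) := (φ.subst τ).and ((ψ.subst σ).subst τ')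
  have hpq : ∀ j, (⟨_, p.append q j⟩ : Σ s : L.Sorts, M s × N s) ∈ R :=
    forall_append_mem (fun s z => (⟨s, z⟩ : Σ s : L.Sorts, M s × N s) ∈ R) hp hq
  have e1 : (fun j => (p.append q j).1) = Tup.append (fun j => (p j).1) fun j => (q j).1 :=
    append_fst p q
  have e2 : (fun j => (p.append q j).2) = Tup.append (fun j => (p j).2) fun j => (q j).2 :=
    append_snd p q
  have hχ : ∀ x : M s, χ.Realize (Tup.cons x fun j => (p.append q j).1) ↔
      φ.Realize (Tup.cons x fun j => (p j).1) ∧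
        (ψ.subst σ).Realize (Tup.cons x fun j => (q j).1) := fun x => by
    rw [e1, Formula.realize_and, Formula.realize_subst φ, Formula.realize_subst (ψ.subst σ),
      realize_lift, realize_lift, realize_inl, realize_inr]
  have hsub : {x : M s | χ.Realize (Tup.cons x fun j => (p.append q j).1)} ⊆
      {x : M s | φ.Realize (Tup.cons x fun j => (p j).1)} := fun x hx => ((hχ x).1 hx).1
  have hmin : Nat.find hQ ≤ {x : M s | χ.Realize (Tup.cons x fun j => (p.append q j).1)}.ncard :=
    Nat.find_min' hQ ⟨_, χ, p.append q, hpq, hfin.subset hsub,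
      (hχ b).2 ⟨hφ, by rw [Formula.realize_subst, h1]; exact hψ⟩, rfl⟩
  have heq := Set.eq_of_subset_of_ncard_le hsub (hcard.trans_le hmin) hfin
  have hall := (hR (Γ ++ Θ) (.all s (.imp (φ.subst τ) ((ψ.subst σ).subst τ')))
    (p.append q) hpq).1 fun x => by
      intro h
      have h' : x ∈ {x : M s | φ.Realize (Tup.cons x fun j => (p j).1)} := by
        rw [e1, Formula.realize_subst φ, realize_lift, realize_inl] at h
        exact h
      rw [← heq] at h'
      exact ((Formula.realize_and _ _ _).1 h').2
  have := hall b'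
  rw [Formula.realize_imp, e2, Formula.realize_subst φ, Formula.realize_subst (ψ.subst σ),
    realize_lift, realize_lift, realize_inl, realize_inr, Formula.realize_subst, h2] at this
  exact this hb'

/-- An elementary relation extends to one whose domain and range are algebraically closed. -/
theorem IsElementary.exists_maximal {R₀ : Set (Σ s : L.Sorts, M s × N s)}
    (hR₀ : IsElementary R₀) : ∃ R, R₀ ⊆ R ∧ IsElementary R ∧
      (∀ s, acl (relDom R) s ⊆ relDom R s) ∧
      ∀ s, acl (relDom (relSwap R)) s ⊆ relDom (relSwap R) s := by
  obtain ⟨R, h0, hmax⟩ := zorn_subset_nonempty {R : Set (Σ s : L.Sorts, M s × N s) |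
      IsElementary R} (fun c hc hchain hne => ⟨⋃₀ c, fun Γ φ p hp => by
        obtain ⟨R, hR, h⟩ := hchain.directedOn.exists_mem_subset_of_finite_of_subset_sUnion hne
          (Set.finite_range fun j => (⟨_, p j⟩ : Σ s : L.Sorts, M s × N s))
          (Set.range_subset_iff.2 hp)
        exact hc hR Γ φ p fun j => h ⟨j, rfl⟩, fun R hR => Set.subset_sUnion_of_mem hR⟩) R₀ hR₀
  have key : ∀ {s : L.Sorts} {b : M s} {b' : N s}, IsElementary (insert ⟨s, b, b'⟩ R) →
      (⟨s, b, b'⟩ : Σ s : L.Sorts, M s × N s) ∈ R := fun h =>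
    hmax.le_of_ge h (Set.subset_insert _ _) (Set.mem_insert _ _)
  have hR : IsElementary R := hmax.prop
  refine ⟨R, h0, hR, fun s b hb => ?_, fun s b hb => ?_⟩
  · obtain ⟨Γ, φ, p, hp, -, hφ, h⟩ := hR.exists_isolating hb
    obtain ⟨b', hb'⟩ := (Formula.realize_ex s φ _).1
      ((hR Γ (.ex s φ) p hp).1 ((Formula.realize_ex s φ _).2 ⟨b, hφ⟩))
    exact ⟨b', key (h b' hb')⟩
  · obtain ⟨Γ, φ, p, hp, -, hφ, h⟩ := hR.swap.exists_isolating hb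
    obtain ⟨b', hb'⟩ := (Formula.realize_ex s φ _).1
      ((hR.swap Γ (.ex s φ) p hp).1 ((Formula.realize_ex s φ _).2 ⟨b, hφ⟩))
    refine ⟨b', key ((h b' hb').swap.mono ?_)⟩
    rintro ⟨t, y⟩ (hy | hy)
    · cases hy; exact Or.inl rfl
    · exact Or.inr hy

end Elementary

/-! ### Evaluation of tuples of terms -/

section Eval

variable {L : MSLanguage.{u, uf, ur}} {M : L.Sorts → Type v} [L.Structure M]
  {Γ Δ Θ J : List L.Sorts}

/-- The values of a tuple of terms. -/
def evalTup (a : Tup M Δ) (σ : Tup (L.Term Δ) Γ) : Tup M Γ := fun j => (σ j).realize a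

/-- Substitution into each entry of a tuple of terms. -/
def substTup (σ : Tup (L.Term Δ) Γ) (τ : Tup (L.Term Θ) Δ) : Tup (L.Term Θ) Γ :=
  fun j => (σ j).subst τ

/-- The variables of a context. -/
def vars (Γ : List L.Sorts) : Tup (L.Term Γ) Γ := fun j => .var j

theorem realize_subst_eval (φ : L.Formula Γ) (σ : Tup (L.Term Δ) Γ) (a : Tup M Δ) :
    (φ.subst σ).Realize a ↔ φ.Realize (evalTup a σ) := Formula.realize_subst φ σ a

theorem term_subst_eval {s : L.Sorts} (t : L.Term Γ s) (σ : Tup (L.Term Δ) Γ) (a : Tup M Δ) :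
    (t.subst σ).realize a = t.realize (evalTup a σ) := Term.realize_subst σ a t

theorem eval_substTup (σ : Tup (L.Term Δ) Γ) (τ : Tup (L.Term Θ) Δ) (a : Tup M Θ) :
    evalTup a (substTup σ τ) = evalTup (evalTup a τ) σ :=
  funext fun j => Term.realize_subst τ a (σ j)

theorem eval_vars (a : Tup M Γ) : evalTup a (vars (L := L) Γ) = a := rfl

theorem eval_inl (a : Tup M Γ) (b : Tup M Δ) : evalTup (a.append b) (inl (L := L) Γ Δ) = a :=
  realize_inl a b

theorem eval_inr (a : Tup M Γ) (b : Tup M Δ) : evalTup (a.append b) (inr (L := L) Γ Δ) = b :=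
  realize_inr a b

theorem eval_append (σ : Tup (L.Term Δ) Γ) (τ : Tup (L.Term Δ) J) (a : Tup M Δ) :
    evalTup a (σ.append τ) = (evalTup a σ).append (evalTup a τ) := realize_append σ τ a

theorem eval_cons {s : L.Sorts} (t : L.Term Δ s) (τ : Tup (L.Term Δ) J) (a : Tup M Δ) :
    evalTup a (Tup.cons t τ) = Tup.cons (t.realize a) (evalTup a τ) := realize_cons t τ a

theorem eval_shift {s : L.Sorts} (x : M s) (a : Tup M Γ) :
    evalTup (Tup.cons x a) (shift (L := L) s Γ) = a := rfl

theorem equalTup_eval (σ τ : Tup (L.Term Δ) Γ) (a : Tup M Δ) :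
    (Formula.equalTup σ τ).Realize a ↔ evalTup a σ = evalTup a τ :=
  Formula.realize_equalTup σ τ a

/-- A formula with finitely many solutions over elements algebraic over `A` has its solutions
algebraic over `A`; the algebraic parameters are removed one at a time by quantifying over the
solutions of a formula defining them. -/
theorem mem_acl_of_finite_over_acl {A : ∀ s : L.Sorts, Set (M s)} {s : L.Sorts} {b : M s} :
    ∀ (Γ : List L.Sorts) {Δ : List L.Sorts} (φ : L.Formula (s :: (Γ ++ Δ))) (a : Tup M Γ)
    (d : Tup M Δ), (∀ j, a j ∈ acl A (Γ.get j)) → (∀ j, d j ∈ A (Δ.get j)) →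
    {x : M s | φ.Realize (Tup.cons x (a.append d))}.Finite →
    φ.Realize (Tup.cons b (a.append d)) → b ∈ acl A s
  | [], Δ, φ, a, d, _, hd, h1, h2 => ⟨Δ, φ, d, hd, h1, h2⟩
  | t :: Γ, Δ, φ, a, d, ha, hd, h1, h2 => by
    obtain ⟨c, a, rfl⟩ : ∃ x p', a = Tup.cons x p' := ⟨_, _, tup_eq_cons a⟩
    obtain ⟨Θ, χ, e, he, hχ, hc⟩ := ha (0 : Fin (Γ.length + 1))
    change L.Formula (t :: Θ) at χ
    change χ.Realize (Tup.cons c e) at hc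
    change {z : M t | χ.Realize (Tup.cons z e)}.Finite at hχ
    let φ' : L.Formula (s :: t :: (Γ ++ Δ)) := φ
    change {x : M s | φ'.Realize (Tup.cons x (Tup.cons c (a.append d)))}.Finite at h1
    change φ'.Realize (Tup.cons b (Tup.cons c (a.append d))) at h2
    let n := {x : M s | φ'.Realize (Tup.cons x (Tup.cons c (a.append d)))}.ncard
    let up : Tup (L.Term (t :: s :: (Γ ++ (Θ ++ Δ)))) (Γ ++ (Θ ++ Δ)) :=
      substTup (shift s (Γ ++ (Θ ++ Δ))) (shift t (s :: (Γ ++ (Θ ++ Δ))))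
    let γ : Tup (L.Term (t :: s :: (Γ ++ (Θ ++ Δ)))) (Γ ++ Δ) := substTup
      ((inl Γ (Θ ++ Δ)).append (substTup (inr Θ Δ) (inr Γ (Θ ++ Δ)))) up
    let θ : Tup (L.Term (t :: s :: (Γ ++ (Θ ++ Δ)))) Θ :=
      substTup (substTup (inl Θ Δ) (inr Γ (Θ ++ Δ))) up
    let z : L.Term (t :: s :: (Γ ++ (Θ ++ Δ))) t := var₀ t (s :: (Γ ++ (Θ ++ Δ)))
    let x : L.Term (t :: s :: (Γ ++ (Θ ++ Δ))) s :=
      (var₀ s (Γ ++ (Θ ++ Δ))).subst (shift t (s :: (Γ ++ (Θ ++ Δ))))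
    let ψ : L.Formula (s :: (Γ ++ (Θ ++ Δ))) := .ex t <| (χ.subst (Tup.cons z θ)).and <|
      (φ'.subst (Tup.cons x (Tup.cons z γ))).and ((φ'.cardLe s n).subst (Tup.cons z γ))
    have hψ : ∀ y : M s, ψ.Realize (Tup.cons y (a.append (e.append d))) ↔
        ∃ w : M t, χ.Realize (Tup.cons w e) ∧
          φ'.Realize (Tup.cons y (Tup.cons w (a.append d))) ∧
          {x : M s | φ'.Realize (Tup.cons x (Tup.cons w (a.append d)))}.encard ≤ n := fun y => by
      rw [Formula.realize_ex]
      refine exists_congr fun w => ?_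
      rw [Formula.realize_and, Formula.realize_and, realize_subst_eval χ, realize_subst_eval φ',
        realize_subst_eval, Formula.realize_cardLe]
      simp only [eval_cons, eval_substTup, eval_append, eval_inl, eval_inr, θ, γ, up, eval_shift,
        x, z, term_subst_eval, realize_var₀]
    refine mem_acl_of_finite_over_acl Γ ψ a (e.append d) (fun j => ha (Fin.succ j))
      (forall_append_mem (fun s y => y ∈ A s) he hd) ?_ ((hψ b).2 ⟨c, hc, h2, ?_⟩)
    · refine (hχ.biUnion fun w _ => (?_ : {x : M s | φ'.Realize
        (Tup.cons x (Tup.cons w (a.append d))) ∧ {x : M s | φ'.Realize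
          (Tup.cons x (Tup.cons w (a.append d)))}.encard ≤ n}.Finite)).subset fun y hy => ?_
      · by_cases h : {x : M s | φ'.Realize (Tup.cons x (Tup.cons w (a.append d)))}.encard ≤ n
        · exact (Set.finite_of_encard_le_coe h).subset fun y hy => hy.1
        · exact Set.finite_empty.subset fun y hy => h hy.2
      · obtain ⟨w, hw, hy⟩ := (hψ y).1 hy
        exact Set.mem_biUnion (show w ∈ {z : M t | χ.Realize (Tup.cons z e)} from hw) hy
    · exact h1.cast_ncard_eq.ge

theorem acl_acl_subset (A : ∀ s : L.Sorts, Set (M s)) (s : L.Sorts) :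
    acl (acl A) s ⊆ acl A s := by
  rintro b ⟨Γ, φ, a, ha, h1, h2⟩
  let σ : Tup (L.Term (s :: (Γ ++ []))) (s :: Γ) := lift s (inl Γ [])
  have h : ∀ x : M s, (φ.subst σ).Realize (Tup.cons x (a.append fun j => j.elim0)) ↔
      φ.Realize (Tup.cons x a) := fun x => by
    rw [Formula.realize_subst, realize_lift, realize_inl]
  exact mem_acl_of_finite_over_acl Γ (φ.subst σ) a (fun j => j.elim0) ha (fun j => j.elim0)
    (by simpa only [h] using h1) ((h b).2 h2)

end Eval

/-! ### Transfer between elementarily equivalent structures -/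

section Transfer

variable {L : MSLanguage.{u, uf, ur}} {M : L.Sorts → Type v} [L.Structure M]
  {N : L.Sorts → Type v'} [L.Structure N]

theorem ElementarilyEquivalent.forall_realize_iff (h : L.ElementarilyEquivalent M N)
    {Γ : List L.Sorts} (φ : L.Formula Γ) :
    (∀ a : Tup M Γ, φ.Realize a) ↔ ∀ a : Tup N Γ, φ.Realize a := by
  rw [← Formula.realize_close, ← Formula.realize_close]
  exact h φ.close

theorem ElementarilyEquivalent.realize_iff (h : L.ElementarilyEquivalent M N)
    {Γ : List L.Sorts} {φ ψ : L.Formula Γ} (hM : ∀ a : Tup M Γ, φ.Realize a ↔ ψ.Realize a)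
    (a : Tup N Γ) : φ.Realize a ↔ ψ.Realize a :=
  (Formula.realize_iff φ ψ a).1 <| (h.forall_realize_iff (φ.iff ψ)).1
    (fun a => (Formula.realize_iff φ ψ a).2 (hM a)) a

theorem HasUniformEI.of_elementarilyEquivalent (hEI : HasUniformEI L M)
    (h : L.ElementarilyEquivalent M N) : HasUniformEI L N := fun J E hE => by
  have hE' : Equivalence fun a b : Tup M J => E.Realize (a.append b) := by
    refine ⟨fun a => ?_, fun {a b} => ?_, fun {a b c} => ?_⟩
    · have := (h.forall_realize_iff (E.subst ((vars J).append (vars J)))).2 (fun a => by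
        rw [realize_subst_eval, eval_append, eval_vars]; exact hE.refl a) a
      rwa [realize_subst_eval, eval_append, eval_vars] at this
    · have := (h.forall_realize_iff (E.imp (E.subst ((inr J J).append (inl J J))))).2
        (forall_append_iff.2 fun a b => by
          rw [Formula.realize_imp, realize_subst_eval, eval_append, eval_inl, eval_inr]
          exact hE.symm) (a.append b)
      rwa [Formula.realize_imp, realize_subst_eval, eval_append, eval_inl, eval_inr] at this
    · let i₁ := substTup (inl J J) (inr (L := L) J (J ++ J))
      let i₂ := substTup (inr J J) (inr (L := L) J (J ++ J))
      have := (h.forall_realize_iff ((E.subst ((inl J (J ++ J)).append i₁)).imp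
          ((E.subst (i₁.append i₂)).imp (E.subst ((inl J (J ++ J)).append i₂))))).2
        (forall_append_iff.2 fun a => forall_append_iff.2 fun b c => by
          simp only [Formula.realize_imp, realize_subst_eval, eval_append, eval_inl, eval_inr,
            eval_substTup, i₁, i₂]
          exact hE.trans) (a.append (b.append c))
      simpa only [Formula.realize_imp, realize_subst_eval, eval_append, eval_inl, eval_inr,
            eval_substTup, i₁, i₂] using this
  obtain ⟨J', F, f, hF, hf⟩ := hEI J E hE'
  have hex : ∀ a : Tup N J, ∃ c : Tup N J', F.Realize (a.append c) := fun a => by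
    have := (h.forall_realize_iff
      (Formula.exBlock J' (F.subst ((inr J' J).append (inl J' J))))).1 (fun a => by
        simp only [Formula.realize_exBlock, realize_subst_eval, eval_append, eval_inl, eval_inr]
        exact ⟨f a, (hF a _).2 rfl⟩) a
    simpa only [Formula.realize_exBlock, realize_subst_eval, eval_append, eval_inl, eval_inr]
      using this
  choose g hg using hex
  have huniq : ∀ (a : Tup N J) (c c' : Tup N J'), F.Realize (a.append c) →
      F.Realize (a.append c') → c = c' := fun a c c' => by
    let i₁ := substTup (inl J' J') (inr (L := L) J (J' ++ J'))
    let i₂ := substTup (inr J' J') (inr (L := L) J (J' ++ J'))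
    have := (h.forall_realize_iff ((F.subst ((inl J (J' ++ J')).append i₁)).imp
      ((F.subst ((inl J (J' ++ J')).append i₂)).imp (.equalTup i₁ i₂)))).1
      (forall_append_iff.2 fun a => forall_append_iff.2 fun c c' => by
        simp only [Formula.realize_imp, realize_subst_eval, eval_append, eval_inl, eval_inr,
          eval_substTup, equalTup_eval, i₁, i₂]
        exact fun h1 h2 => ((hF a c).1 h1).symm.trans ((hF a c').1 h2))
      (a.append (c.append c'))
    simpa only [Formula.realize_imp, realize_subst_eval, eval_append, eval_inl, eval_inr,
          eval_substTup, equalTup_eval, i₁, i₂] using this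
  refine ⟨J', F, g, fun a c => ⟨huniq a _ _ (hg a), fun h => h ▸ hg a⟩, fun a b => ?_⟩
  let i₁ := substTup (inl J J) (inr (L := L) J' (J ++ J))
  let i₂ := substTup (inr J J) (inr (L := L) J' (J ++ J))
  have := (h.forall_realize_iff (E.iff (Formula.exBlock J'
      ((F.subst (i₁.append (inl J' (J ++ J)))).and (F.subst (i₂.append (inl J' (J ++ J)))))))).1
    (forall_append_iff.2 fun a b => by
      simp only [Formula.realize_iff, Formula.realize_exBlock, Formula.realize_and,
        realize_subst_eval, eval_append, eval_inl, eval_inr, eval_substTup, i₁, i₂, hF, hf]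
      exact ⟨fun h => ⟨_, rfl, h.symm⟩, fun ⟨_, h, h'⟩ => h.trans h'.symm⟩) (a.append b)
  simp only [Formula.realize_iff, Formula.realize_exBlock, Formula.realize_and,
        realize_subst_eval, eval_append, eval_inl, eval_inr, eval_substTup, i₁, i₂] at this
  rw [this]
  exact ⟨fun ⟨c, h1, h2⟩ => (huniq a _ _ (hg a) h1).trans (huniq b _ _ (hg b) h2).symm,
    fun h => ⟨g a, hg a, h ▸ hg b⟩⟩

end Transfer

/-! ### Codes for finite sets -/

section Codes

variable {L : MSLanguage.{u, uf, ur}} {M : L.Sorts → Type v} [L.Structure M]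

/-- Canonical parameters: with uniform elimination of imaginaries, the sets defined by the
instances of a formula are coded by the values of a definable function. -/
theorem HasUniformEI.exists_canonicalParameter (hEI : HasUniformEI L M) {Γ Δ : List L.Sorts}
    (φ : L.Formula (Γ ++ Δ)) : ∃ (J : List L.Sorts) (F : L.Formula (Δ ++ J))
      (f : Tup M Δ → Tup M J), (∀ d c, F.Realize (d.append c) ↔ f d = c) ∧
      ∀ d d' : Tup M Δ, f d = f d' ↔
        ∀ x : Tup M Γ, φ.Realize (x.append d) ↔ φ.Realize (x.append d') := by
  let E : L.Formula (Δ ++ Δ) := Formula.allBlock Γ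
    ((φ.subst ((inl Γ (Δ ++ Δ)).append (substTup (inl Δ Δ) (inr Γ (Δ ++ Δ))))).iff
      (φ.subst ((inl Γ (Δ ++ Δ)).append (substTup (inr Δ Δ) (inr Γ (Δ ++ Δ))))))
  have hE : ∀ d d' : Tup M Δ, E.Realize (d.append d') ↔
      ∀ x : Tup M Γ, φ.Realize (x.append d) ↔ φ.Realize (x.append d') := fun d d' => by
    simp only [E, Formula.realize_allBlock, Formula.realize_iff, realize_subst_eval, eval_append,
      eval_inl, eval_inr, eval_substTup]
  obtain ⟨J, F, f, hF, hf⟩ := hEI Δ E (by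
    simp only [hE]
    exact ⟨fun _ _ => Iff.rfl, fun h x => (h x).symm, fun h h' x => (h x).trans (h' x)⟩)
  exact ⟨J, F, f, hF, fun d d' => (hf d d').symm.trans (hE d d')⟩

/-- The context consisting of `n` copies of `Γ`. -/
def copies {S : Type u} (Γ : List S) : ℕ → List S
  | 0 => []
  | n + 1 => Γ ++ copies Γ n

/-- The concatenation of `n` tuples of the same sorts. -/
def concat {S : Type u} {M : S → Type v} {Γ : List S} :
    {n : ℕ} → (Fin n → Tup M Γ) → Tup M (copies Γ n)
  | 0, _ => fun j => j.elim0
  | _ + 1, y => (y 0).append (concat fun m => y m.succ)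

theorem map_concat {S : Type u} {M : S → Type v} {N : S → Type v'} {Γ : List S}
    (g : ∀ s, M s → N s) : ∀ {n : ℕ} (y : Fin n → Tup M Γ),
    (fun j => g _ (concat y j)) = concat fun m j => g _ (y m j)
  | 0, _ => funext fun j => j.elim0
  | _ + 1, y => (map_append g _ _).trans (congrArg _ (map_concat g fun m => y m.succ))

theorem forall_concat_mem {S : Type u} {M : S → Type v} {Γ : List S} (p : ∀ s, M s → Prop) :
    ∀ {n : ℕ} {y : Fin n → Tup M Γ}, (∀ m j, p _ (y m j)) → ∀ j, p _ (concat y j)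
  | 0, _, _ => fun j => j.elim0
  | _ + 1, _, h => forall_append_mem p (h 0) (forall_concat_mem p fun m => h m.succ)

/-- The formula `x = y₁ ∨ ⋯ ∨ x = yₙ` in tuples of variables. -/
def memCopies (Γ : List L.Sorts) : (n : ℕ) → L.Formula (Γ ++ copies Γ n)
  | 0 => .falsum
  | n + 1 =>
    let y := inr Γ (Γ ++ copies Γ n)
    (Formula.equalTup (inl Γ (Γ ++ copies Γ n)) (substTup (inl Γ (copies Γ n)) y)).or
      ((memCopies Γ n).subst
        ((inl Γ (Γ ++ copies Γ n)).append (substTup (inr Γ (copies Γ n)) y)))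

theorem realize_memCopies {Γ : List L.Sorts} : ∀ {n : ℕ} (x : Tup M Γ) (y : Fin n → Tup M Γ),
    (memCopies Γ n).Realize (x.append (concat y)) ↔ ∃ m, x = y m
  | 0, x, y => ⟨False.elim, fun ⟨m, _⟩ => m.elim0⟩
  | n + 1, x, y => by
    have h : ∀ (y₀ : Tup M Γ) (c : Tup M (copies Γ n)),
        ((Formula.equalTup (inl Γ (Γ ++ copies Γ n))
          (substTup (inl Γ (copies Γ n)) (inr Γ (Γ ++ copies Γ n)))).or
          ((memCopies Γ n).subst ((inl Γ (Γ ++ copies Γ n)).append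
            (substTup (inr Γ (copies Γ n)) (inr Γ (Γ ++ copies Γ n)))))).Realize
          (x.append (y₀.append c)) ↔ x = y₀ ∨ (memCopies Γ n).Realize (x.append c) :=
      fun y₀ c => by
        rw [Formula.realize_or, equalTup_eval, realize_subst_eval, eval_append, eval_inl,
          eval_substTup, eval_substTup, eval_inr, eval_inl, eval_inr]
    refine (h (y 0) (concat fun m => y m.succ)).trans ?_
    rw [realize_memCopies]
    exact (Fin.exists_fin_succ (P := fun m => x = y m)).symm

end Codes

/-! ### The action of the absolute Galois group -/

section Galois

variable {L : MSLanguage.{u, uf, ur}} {M : L.Sorts → Type v} [L.Structure M]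

/-- The action of `G(K)` on tuples from `acl(K)`. -/
def actTup {K : L.Substructure M} (σ : absGal K) {Γ : List L.Sorts}
    (a : Tup (fun s => acl K.carrier s) Γ) : Tup (fun s => acl K.carrier s) Γ :=
  fun j => σ.1 _ (a j)

variable {K : L.Substructure M} {Γ Δ : List L.Sorts}

theorem actTup_one (a : Tup (fun s => acl K.carrier s) Γ) : actTup (1 : absGal K) a = a := rfl

theorem actTup_mul (σ τ : absGal K) (a : Tup (fun s => acl K.carrier s) Γ) :
    actTup (σ * τ) a = actTup σ (actTup τ a) := rfl

theorem actTup_injective (σ : absGal K) :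
    Function.Injective (actTup σ (Γ := Γ)) :=
  fun _ _ h => funext fun j => (σ.1 _).injective (congrFun h j)

theorem actTup_cons (σ : absGal K) {s : L.Sorts} (x : acl K.carrier s)
    (a : Tup (fun s => acl K.carrier s) Γ) :
    actTup σ (Tup.cons (M := fun s => acl K.carrier s) x a) =
      Tup.cons (M := fun s => acl K.carrier s) (σ.1 s x) (actTup σ a) :=
  map_cons (M := fun s => acl K.carrier s) (fun s => σ.1 s) x a

theorem actTup_append (σ : absGal K) (a : Tup (fun s => acl K.carrier s) Γ)
    (b : Tup (fun s => acl K.carrier s) Δ) :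
    actTup σ (a.append b) = (actTup σ a).append (actTup σ b) :=
  map_append (M := fun s => acl K.carrier s) (fun s => σ.1 s) a b

theorem realize_actTup (σ : absGal K) (φ : L.Formula Γ) (a : Tup (fun s => acl K.carrier s) Γ) :
    φ.Realize (valTup (actTup σ a)) ↔ φ.Realize (valTup a) := σ.2.1 Γ φ a

theorem actTup_of_mem (σ : absGal K) {a : Tup (fun s => acl K.carrier s) Γ}
    (ha : ∀ j, (a j).1 ∈ K.carrier (Γ.get j)) : actTup σ a = a :=
  funext fun j => σ.2.2 _ _ (ha j)

/-- A formula over `K` is preserved by `G(K)`. -/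
theorem realize_apply_iff (σ : absGal K) {s : L.Sorts} (x : acl K.carrier s)
    (φ : L.Formula (s :: Γ)) {a : Tup M Γ} (ha : ∀ j, a j ∈ K.carrier (Γ.get j)) :
    φ.Realize (Tup.cons (σ.1 s x).1 a) ↔ φ.Realize (Tup.cons x.1 a) := by
  let a' : Tup (fun s => acl K.carrier s) Γ := fun j => ⟨a j, subset_acl _ _ (ha j)⟩
  have := realize_actTup σ φ (Tup.cons (M := fun s => acl K.carrier s) x a')
  rwa [actTup_cons, valTup_cons, valTup_cons, actTup_of_mem σ ha] at this

/-- The pairs `(x, x)` with `x` in `K`. -/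
def diagonal (K : L.Substructure M) : Set (Σ s : L.Sorts, M s × M s) :=
  {p | p.2.1 ∈ K.carrier p.1 ∧ p.2.2 = p.2.1}

theorem isElementary_diagonal (K : L.Substructure M) : IsElementary (diagonal K) :=
  fun Γ φ p hp => by
    rw [show (fun j => (p j).2) = fun j => (p j).1 from funext fun j => (hp j).2]

theorem acl_subset_acl_relDom {R : Set (Σ s : L.Sorts, M s × M s)} (h : diagonal K ⊆ R)
    (s : L.Sorts) : acl K.carrier s ⊆ acl (relDom R) s :=
  acl_mono (A' := relDom R) (fun t x hx => ⟨x, h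
    (show (⟨t, x, x⟩ : Σ s : L.Sorts, M s × M s) ∈ diagonal K from
    ⟨hx, rfl⟩)⟩) s

theorem mem_acl_of_isElementary {R : Set (Σ s : L.Sorts, M s × M s)} (hR : IsElementary R)
    (h : diagonal K ⊆ R) {s : L.Sorts} {x y : M s} (hxy : ⟨s, x, y⟩ ∈ R)
    (hx : x ∈ acl K.carrier s) : y ∈ acl K.carrier s := by
  obtain ⟨Γ, φ, a, ha, h1, h2⟩ := hx
  exact ⟨Γ, φ, a, ha, h1, (hR.realize_cons_iff hxy φ (fun j => (a j, a j))
    fun j => h ⟨ha j, rfl⟩).1 h2⟩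

/-- Homogeneity of `acl(K)`: an elementary relation over `K` is induced by an element of
`G(K)`. -/
theorem exists_absGal_of_isElementary {R₀ : Set (Σ s : L.Sorts, M s × M s)}
    (hR₀ : IsElementary R₀) (h₀ : diagonal K ⊆ R₀) :
    ∃ σ : absGal K, ∀ (s : L.Sorts) (x : acl K.carrier s) (y : M s),
      (⟨s, x.1, y⟩ : Σ s : L.Sorts, M s × M s) ∈ R₀ → (σ.1 s x).1 = y := by
  obtain ⟨R, h0, hR, hdom, hran⟩ := hR₀.exists_maximal
  have h1 : diagonal K ⊆ R := h₀.trans h0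
  have h2 : diagonal K ⊆ relSwap R := fun ⟨s, x, y⟩ ⟨hx, hy⟩ => by
    change y = x at hy
    subst hy
    exact h1 ⟨hx, rfl⟩
  have hf : ∀ (s : L.Sorts) (x : acl K.carrier s), ∃ y : acl K.carrier s,
      (⟨s, x.1, y.1⟩ : Σ s : L.Sorts, M s × M s) ∈ R := fun s x => by
    obtain ⟨y, hy⟩ := hdom s (acl_subset_acl_relDom h1 s x.2)
    exact ⟨⟨y, mem_acl_of_isElementary hR h1 hy x.2⟩, hy⟩
  have hg : ∀ (s : L.Sorts) (x : acl K.carrier s), ∃ y : acl K.carrier s,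
      (⟨s, y.1, x.1⟩ : Σ s : L.Sorts, M s × M s) ∈ R := fun s x => by
    obtain ⟨y, hy⟩ := hran s (acl_subset_acl_relDom h2 s x.2)
    exact ⟨⟨y, mem_acl_of_isElementary hR.swap h2 hy x.2⟩, hy⟩
  choose f hf using hf
  choose g hg using hg
  refine ⟨⟨fun s => ⟨f s, g s, fun x => ?_, fun x => ?_⟩, fun Γ φ b => ?_, fun s x hx => ?_⟩,
    fun s x y hxy => ?_⟩
  · exact Subtype.ext ((hR.eq_iff (hg s (f s x)) (hf s x)).2 rfl)
  · exact Subtype.ext ((hR.eq_iff (hf s (g s x)) (hg s x)).1 rfl)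
  · exact (hR Γ φ (fun j => ((b j).1, (f _ (b j)).1)) fun j => hf _ (b j)).symm
  · exact Subtype.ext ((hR.eq_iff (hf s x) (h1 ⟨hx, rfl⟩)).1 rfl)
  · exact (hR.eq_iff (hf s x) (h0 hxy)).1 rfl

/-- The fixed points of `G(K)` in `acl(K)` are the elements of the definably closed `K`. -/
theorem Substructure.IsDefinablyClosed.mem_of_fixed (hK : K.IsDefinablyClosed) {s : L.Sorts}
    (x : acl K.carrier s) (hx : ∀ σ : absGal K, σ.1 s x = x) : x.1 ∈ K.carrier s := by
  rw [← hK s]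
  obtain ⟨Γ, φ, p, hp, -, hφ, h⟩ := (isElementary_diagonal K).exists_isolating
    (acl_subset_acl_relDom subset_rfl s x.2)
  refine ⟨Γ, φ, fun j => (p j).1, fun j => (hp j).1, Set.eq_singleton_iff_unique_mem.2
    ⟨hφ, fun y hy => ?_⟩⟩
  obtain ⟨σ, hσ⟩ := exists_absGal_of_isElementary (K := K) (h y (by
    rwa [show (fun j => (p j).2) = fun j => (p j).1 from funext fun j => (hp j).2]))
    (Set.subset_insert _ _)
  rw [← hσ s x y (Set.mem_insert _ _), hx σ]

/-- A bound for the size of an orbit of `G(K)` on tuples. -/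
theorem ncard_orbit_le (c : Tup (fun s => acl K.carrier s) Γ) (n : Fin Γ.length → ℕ)
    (h : ∀ j, ∃ (Θ : List L.Sorts) (φ : L.Formula (Γ.get j :: Θ)) (a : Tup M Θ),
      (∀ i, a i ∈ K.carrier (Θ.get i)) ∧
      {x : M (Γ.get j) | φ.Realize (Tup.cons x a)}.encard ≤ n j ∧
      φ.Realize (Tup.cons (c j).1 a)) :
    (Set.range fun σ : absGal K => actTup σ c).Finite ∧
      (Set.range fun σ : absGal K => actTup σ c).ncard ≤ ∏ j, n j := by
  choose Θ φ a ha hn hφ using h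
  let S : ∀ j, Set (acl K.carrier (Γ.get j)) := fun j => {x | (φ j).Realize (Tup.cons x.1 (a j))}
  have hS : ∀ j, (S j).encard ≤ n j := fun j => by
    rw [← Subtype.val_injective.encard_image]
    refine (Set.encard_le_encard ?_).trans (hn j)
    rintro _ ⟨x, hx, rfl⟩
    exact hx
  have hfin : ∀ j, (S j).Finite := fun j => Set.finite_of_encard_le_coe (hS j)
  have hsub : (Set.range fun σ : absGal K => actTup σ c) ⊆ Set.univ.pi S := by
    rintro _ ⟨σ, rfl⟩ j -
    exact (realize_apply_iff σ (c j) (φ j) (ha j)).2 (hφ j)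
  have hpi : (Set.univ.pi S).Finite := Set.Finite.pi' hfin |>.subset fun x hx j => hx j trivial
  refine ⟨hpi.subset hsub, (Set.ncard_le_ncard hsub hpi).trans ?_⟩
  rw [← Nat.card_coe_set_eq, Nat.card_congr (Equiv.Set.univPi S), Nat.card_pi]
  refine Finset.prod_le_prod' fun j _ => ?_
  rw [Nat.card_coe_set_eq]
  exact_mod_cast (hfin j).cast_ncard_eq.trans_le (hS j)

theorem finite_orbit (c : Tup (fun s => acl K.carrier s) Γ) :
    (Set.range fun σ : absGal K => actTup σ c).Finite := by
  have h := fun j => (c j).2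
  choose Θ φ a ha hfin hφ using h
  exact (ncard_orbit_le c _ fun j => ⟨Θ j, φ j, a j, ha j, (hfin j).cast_ncard_eq.ge, hφ j⟩).1

/-- Finite sets of tuples of bounded size from `acl(K)` are coded in `acl(K)`, uniformly in the
set and in `K`; the code is fixed by the automorphisms that preserve the set. -/
theorem HasUniformEI.exists_code (hEI : HasUniformEI L M) (Γ : List L.Sorts) (n : ℕ) :
    ∃ (J : List L.Sorts) (μ : L.Formula (Γ ++ J)), ∀ (K : L.Substructure M)
      (X : Set (Tup (fun s => acl K.carrier s) Γ)), X.Finite → X.Nonempty → X.ncard ≤ n →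
      ∃ e : Tup (fun s => acl K.carrier s) J,
        (∀ x : Tup M Γ, μ.Realize (x.append (valTup e)) ↔ ∃ y ∈ X, x = valTup y) ∧
        ∀ σ : absGal K, (∀ y ∈ X, actTup σ y ∈ X) → actTup σ e = e := by
  obtain ⟨J, F, f, hF, hf⟩ := hEI.exists_canonicalParameter (memCopies Γ n)
  let μ : L.Formula (Γ ++ J) := Formula.exBlock (copies Γ n) <|
    (F.subst ((inl (copies Γ n) (Γ ++ J)).append
      (substTup (inr Γ J) (inr (copies Γ n) (Γ ++ J))))).and
    ((memCopies Γ n).subst ((substTup (inl Γ J) (inr (copies Γ n) (Γ ++ J))).append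
      (inl (copies Γ n) (Γ ++ J))))
  refine ⟨J, μ, fun K X hX hne hcard => ?_⟩
  obtain ⟨y, rfl⟩ : ∃ y : Fin n → Tup (fun s => acl K.carrier s) Γ, X = Set.range y := by
    classical
    have := hX.fintype
    obtain ⟨g⟩ := Function.Embedding.nonempty_of_card_le (α := X) (β := Fin n) (by
      rwa [Fintype.card_fin, ← Nat.card_eq_fintype_card])
    have : Nonempty X := hne.to_subtype
    refine ⟨fun m => (Function.invFun g m).1, ?_⟩
    have := (Function.invFun_surjective g.injective).range_eq
    rw [show (fun m => (Function.invFun g m).1) = Subtype.val ∘ Function.invFun g from rfl,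
      Set.range_comp, this]
    simp
  have hval : ∀ z : Fin n → Tup (fun s => acl K.carrier s) Γ,
      valTup (concat z) = concat fun m => valTup (z m) := fun z =>
    map_concat (M := fun s => acl K.carrier s) (fun _ x => x.1) z
  have hmem : ∀ j, f (valTup (concat y)) j ∈ acl K.carrier (J.get j) := fun j => by
    let ε : L.Formula (J.get j :: copies Γ n) := Formula.exBlock J <|
      (F.subst ((substTup (shift (J.get j) (copies Γ n))
        (inr J (J.get j :: copies Γ n))).append (inl J (J.get j :: copies Γ n)))).and
      (.equal (inl J (J.get j :: copies Γ n) j)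
        ((var₀ (J.get j) (copies Γ n)).subst (inr J (J.get j :: copies Γ n))))
    have hε : ∀ (z : M (J.get j)) (d : Tup M (copies Γ n)),
        ε.Realize (Tup.cons z d) ↔ f d j = z := fun z d => by
      simp only [ε, Formula.realize_exBlock, Formula.realize_and, realize_subst_eval, eval_append,
        eval_substTup, eval_inl, eval_inr, eval_shift, hF, Formula.realize_equal, term_subst_eval,
        realize_var₀]
      have : ∀ a : Tup M J, (inl (L := L) J (J.get j :: copies Γ n) j).realize
          (a.append (Tup.cons z d)) = a j := fun a => congrFun (eval_inl a _) j
      simp only [this]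
      exact ⟨fun ⟨a, h, h'⟩ => h ▸ h', fun h => ⟨_, rfl, h⟩⟩
    refine acl_acl_subset _ _ ⟨_, ε, valTup (concat y), fun i => (concat y i).2, ?_, ?_⟩
    · refine (Set.finite_singleton (f (valTup (concat y)) j)).subset fun z hz => ?_
      exact ((hε _ _).1 hz).symm
    · exact (hε _ _).2 rfl
  refine ⟨fun j => ⟨f (valTup (concat y)) j, hmem j⟩, fun x => ?_, fun σ hσ => ?_⟩
  · change μ.Realize (x.append (f (valTup (concat y)))) ↔ _
    simp only [μ, Formula.realize_exBlock, Formula.realize_and, realize_subst_eval, eval_append,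
        eval_substTup, eval_inl, eval_inr, hF]
    have h : (∃ a, f a = f (valTup (concat y)) ∧ (memCopies Γ n).Realize (x.append a)) ↔
        (memCopies Γ n).Realize (x.append (valTup (concat y))) :=
      ⟨fun ⟨a, h, h'⟩ => ((hf _ _).1 h x).1 h', fun h => ⟨_, rfl, h⟩⟩
    rw [h, hval, realize_memCopies]
    simp
  · apply valTup_injective
    set e : Tup (fun s => acl K.carrier s) J := fun j => ⟨f (valTup (concat y)) j, hmem j⟩
    have he : f (valTup (concat y)) = valTup e := rfl
    have h1 := (realize_actTup σ F ((concat y).append e)).2 (by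
      rw [valTup_append]; exact (hF _ _).2 he)
    rw [actTup_append, valTup_append, hF] at h1
    rw [← h1, ← he, hf]
    have h2 : actTup σ (concat y) = concat fun m => actTup σ (y m) :=
      map_concat (M := fun s => acl K.carrier s) (fun s => σ.1 s) y
    have h3 : actTup σ '' Set.range y = Set.range y :=
      Set.eq_of_subset_of_ncard_le (Set.image_subset_iff.2 hσ)
        (Set.ncard_image_of_injective _ (actTup_injective σ)).ge hX
    intro x
    rw [h2, hval, hval, realize_memCopies, realize_memCopies]
    rw [← Set.range_comp] at h3
    constructor
    · rintro ⟨m, rfl⟩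
      obtain ⟨m', hm'⟩ : actTup σ (y m) ∈ Set.range y := h3 ▸ ⟨m, rfl⟩
      exact ⟨m', by rw [hm']⟩
    · rintro ⟨m, rfl⟩
      obtain ⟨m', hm'⟩ : y m ∈ Set.range (actTup σ ∘ y) := h3 ▸ ⟨m, rfl⟩
      exact ⟨m', by rw [← hm']; rfl⟩

end Galois

/-! ### Open subgroups and their fixed points -/

section Correspondence

variable {L : MSLanguage.{u, uf, ur}} {M : L.Sorts → Type v} [L.Structure M]
  {K : L.Substructure M} {Γ : List L.Sorts}

/-- The pointwise stabilizer of a tuple. -/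
def fixer (c : Tup (fun s => acl K.carrier s) Γ) : Subgroup (absGal K) where
  carrier := {σ | actTup σ c = c}
  one_mem' := rfl
  mul_mem' {σ τ} hσ hτ := by
    change actTup (σ * τ) c = c
    rw [actTup_mul, show actTup τ c = c from hτ, show actTup σ c = c from hσ]
  inv_mem' {σ} hσ := by
    change actTup σ⁻¹ c = c
    apply actTup_injective σ
    rw [← actTup_mul, mul_inv_cancel, actTup_one, show actTup σ c = c from hσ]

theorem mem_fixer {c : Tup (fun s => acl K.carrier s) Γ} {σ : absGal K} :
    σ ∈ fixer c ↔ actTup σ c = c := Iff.rfl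

theorem isOpen_fixer (c : Tup (fun s => acl K.carrier s) Γ) :
    IsOpen (fixer c : Set (absGal K)) := by
  have h : (fixer c : Set (absGal K)) = ⋂ j, {σ | σ.1 _ (c j) = c j} := by
    ext σ
    simp only [SetLike.mem_coe, mem_fixer, Set.mem_iInter, Set.mem_ofPred_eq]
    exact funext_iff
  rw [h]
  refine isOpen_iInter_of_finite fun j => ?_
  let _ : ∀ p : Σ s : L.Sorts, acl K.carrier s, TopologicalSpace (acl K.carrier p.1) := fun _ => ⊥
  have : ∀ p : Σ s : L.Sorts, acl K.carrier s, DiscreteTopology (acl K.carrier p.1) :=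
    fun _ => ⟨rfl⟩
  let p : Σ s : L.Sorts, acl K.carrier s := ⟨_, c j⟩
  exact isOpen_induced_iff.2 ⟨(fun f => f p) ⁻¹' {p.2},
    (isOpen_discrete {p.2}).preimage (continuous_apply p), rfl⟩

/-- An open subgroup contains the stabilizer of a finite tuple. -/
theorem exists_fixer_le {H : Subgroup (absGal K)} (hH : IsOpen (H : Set (absGal K))) :
    ∃ (Γ : List L.Sorts) (c : Tup (fun s => acl K.carrier s) Γ), fixer c ≤ H := by
  let _ : ∀ p : Σ s : L.Sorts, acl K.carrier s, TopologicalSpace (acl K.carrier p.1) := fun _ => ⊥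
  obtain ⟨V, hV, hVH⟩ := isOpen_induced_iff.1 hH
  have h1 : (fun p : Σ s : L.Sorts, acl K.carrier s => (1 : absGal K).1 p.1 p.2) ∈ V := by
    change (1 : absGal K) ∈ (fun (σ : absGal K) (p : Σ s : L.Sorts, acl K.carrier s) =>
      σ.1 p.1 p.2) ⁻¹' V
    rw [hVH]
    exact H.one_mem
  obtain ⟨F, W, hW, hFW⟩ := isOpen_pi_iff.1 hV _ h1
  obtain ⟨Γ, c, hc⟩ := exists_tup_range_eq (M := fun s => acl K.carrier s) F.finite_toSet
  refine ⟨Γ, c, fun σ hσ => ?_⟩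
  have : σ ∈ (fun (σ : absGal K) (p : Σ s : L.Sorts, acl K.carrier s) => σ.1 p.1 p.2) ⁻¹' V := by
    refine hFW fun p hp => ?_
    obtain ⟨j, rfl⟩ : p ∈ Set.range fun j => (⟨_, c j⟩ : Σ s : L.Sorts, acl K.carrier s) :=
      hc ▸ hp
    have h2 : σ.1 _ (c j) = c j := congrFun hσ j
    change σ.1 _ (c j) ∈ _
    rw [h2]
    exact (hW _ hp).2
  rw [hVH] at this
  exact this

theorem mem_fixedPts_of_forall {H : Subgroup (absGal K)} {s : L.Sorts} {x : acl K.carrier s}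
    (h : ∀ τ ∈ H, τ.1 s x = x) : x.1 ∈ fixedPts K H s := ⟨x.2, h⟩

/-- Orbits of bounded size are uniformly definable over a definably closed `K`. -/
theorem HasUniformEI.exists_code_orbit (hEI : HasUniformEI L M) (Γ : List L.Sorts) (n : ℕ) :
    ∃ (J : List L.Sorts) (μ : L.Formula (Γ ++ J)), ∀ (K : L.Substructure M),
      K.IsDefinablyClosed → ∀ c : Tup (fun s => acl K.carrier s) Γ,
      (Set.range fun σ : absGal K => actTup σ c).ncard ≤ n →
      ∃ e : Tup M J, (∀ j, e j ∈ K.carrier (J.get j)) ∧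
        ∀ x : Tup M Γ, μ.Realize (x.append e) ↔ ∃ σ : absGal K, x = valTup (actTup σ c) := by
  obtain ⟨J, μ, hμ⟩ := hEI.exists_code Γ n
  refine ⟨J, μ, fun K hK c hc => ?_⟩
  obtain ⟨e, he, hfix⟩ := hμ K _ (finite_orbit c) (Set.range_nonempty _) hc
  refine ⟨valTup e, fun j => hK.mem_of_fixed _ fun σ => ?_, fun x => (he x).trans (by simp)⟩
  refine congrFun (hfix σ ?_) j
  rintro _ ⟨τ, rfl⟩
  exact ⟨σ * τ, rfl⟩

/-- One half of the Galois correspondence: an element of `G(K)` that fixes the fixed points of an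
open subgroup `H` lies in `H`. If the stabilizer of the tuple `c` is contained in `H`, the code of
the finite set `H c` is fixed by `H`. -/
theorem HasUniformEI.mem_of_forall_fixedPts (hEI : HasUniformEI L M) {H : Subgroup (absGal K)}
    (hH : IsOpen (H : Set (absGal K))) {σ : absGal K}
    (hσ : ∀ (s : L.Sorts) (x : acl K.carrier s), (∀ τ ∈ H, τ.1 s x = x) → σ.1 s x = x) :
    σ ∈ H := by
  obtain ⟨Γ, c, hc⟩ := exists_fixer_le hH
  let X : Set (Tup (fun s => acl K.carrier s) Γ) := (fun τ : absGal K => actTup τ c) '' H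
  have hX : X.Finite := (finite_orbit c).subset (Set.image_subset_range _ _)
  have hcX : c ∈ X := ⟨1, H.one_mem, rfl⟩
  obtain ⟨J, μ, hμ⟩ := hEI.exists_code Γ X.ncard
  obtain ⟨e, he, hfix⟩ := hμ K X hX ⟨c, hcX⟩ le_rfl
  have hτ : ∀ τ ∈ H, actTup τ e = e := fun τ hτ => hfix τ <| by
    rintro _ ⟨ρ, hρ, rfl⟩
    exact ⟨τ * ρ, H.mul_mem hτ hρ, rfl⟩
  have hσe : actTup σ e = e := funext fun j => hσ _ _ fun τ h => congrFun (hτ τ h) j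
  have h1 := (realize_actTup σ μ (c.append e)).2 (by
    rw [valTup_append]; exact (he _).2 ⟨c, hcX, rfl⟩)
  rw [actTup_append, valTup_append, hσe, he] at h1
  obtain ⟨_, ⟨τ, hτH, rfl⟩, h2⟩ := h1
  have h3 : actTup σ c = actTup τ c := valTup_injective h2
  have h4 : τ⁻¹ * σ ∈ H := hc <| by
    rw [mem_fixer, actTup_mul, h3, ← actTup_mul, inv_mul_cancel, actTup_one]
  simpa using H.mul_mem hτH h4

/-- Restriction of automorphisms to the fixed points of a normal subgroup. -/
def restrictFixedPts (H : Subgroup (absGal K)) [hH : H.Normal] :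
    absGal K →* autGroup (fixedPts K H) K.carrier :=
  have key : ∀ (σ : absGal K) (s : L.Sorts) (x : fixedPts K H s),
      (σ.1 s ⟨x.1, x.2.1⟩).1 ∈ fixedPts K H s := fun σ s x => mem_fixedPts_of_forall fun τ hτ => by
    have h1 : (σ⁻¹ * τ * σ).1 s ⟨x.1, x.2.1⟩ = ⟨x.1, x.2.1⟩ :=
      x.2.2 _ (by simpa using hH.conj_mem τ hτ σ⁻¹)
    have h2 : (σ * (σ⁻¹ * τ * σ)).1 s ⟨x.1, x.2.1⟩ = σ.1 s ⟨x.1, x.2.1⟩ := congrArg (σ.1 s) h1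
    rwa [show σ * (σ⁻¹ * τ * σ) = τ * σ by group] at h2
  { toFun := fun σ => ⟨fun s =>
      { toFun := fun x => ⟨(σ.1 s ⟨x.1, x.2.1⟩).1, key σ s x⟩
        invFun := fun x => ⟨(σ⁻¹.1 s ⟨x.1, x.2.1⟩).1, key σ⁻¹ s x⟩
        left_inv := fun x => Subtype.ext (Subtype.ext_iff.1
          ((σ.1 s).symm_apply_apply ⟨x.1, x.2.1⟩) :)
        right_inv := fun x => Subtype.ext (Subtype.ext_iff.1
          ((σ.1 s).apply_symm_apply ⟨x.1, x.2.1⟩) :) },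
      fun Γ φ b => σ.2.1 Γ φ fun j => ⟨(b j).1, (b j).2.1⟩,
      fun s x hx => Subtype.ext (Subtype.ext_iff.1 (σ.2.2 s ⟨x.1, x.2.1⟩ hx) :)⟩
    map_one' := rfl
    map_mul' := fun _ _ => rfl }

theorem restrictFixedPts_surjective (H : Subgroup (absGal K)) [hH : H.Normal] :
    Function.Surjective (restrictFixedPts H) := fun τ => by
  let R : Set (Σ s : L.Sorts, M s × M s) :=
    {p | ∃ x : fixedPts K H p.1, x.1 = p.2.1 ∧ (τ.1 p.1 x).1 = p.2.2}
  have hR : IsElementary R := fun Γ φ p hp => by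
    choose x h1 h2 using hp
    rw [show (fun j => (p j).1) = fun j => (x j).1 from funext fun j => (h1 j).symm,
      show (fun j => (p j).2) = fun j => (τ.1 _ (x j)).1 from funext fun j => (h2 j).symm]
    exact (τ.2.1 Γ φ x).symm
  obtain ⟨σ, hσ⟩ := exists_absGal_of_isElementary (K := K) hR fun ⟨s, x, y⟩ ⟨hx, hy⟩ => by
    change y = x at hy
    subst hy
    have hy : y ∈ fixedPts K H s := ⟨subset_acl _ _ hx, fun σ _ => σ.2.2 s _ hx⟩
    exact ⟨⟨y, hy⟩, rfl, congrArg Subtype.val (τ.2.2 s ⟨y, hy⟩ hx)⟩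
  exact ⟨σ, Subtype.ext (funext fun s => Equiv.ext fun x => Subtype.ext
    (hσ s ⟨x.1, x.2.1⟩ _ ⟨x, rfl, rfl⟩))⟩

theorem HasUniformEI.ker_restrictFixedPts (hEI : HasUniformEI L M) {H : Subgroup (absGal K)}
    [hH : H.Normal] (hHo : IsOpen (H : Set (absGal K))) : (restrictFixedPts H).ker = H := by
  ext σ
  constructor
  · intro h
    refine hEI.mem_of_forall_fixedPts hHo fun s x hx => ?_
    have := congrArg (fun τ => (τ.1 s ⟨x.1, mem_fixedPts_of_forall hx⟩).1) (MonoidHom.mem_ker.1 h)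
    exact Subtype.ext this
  · exact fun h => MonoidHom.mem_ker.2 (Subtype.ext (funext fun s => Equiv.ext fun x =>
      Subtype.ext (Subtype.ext_iff.1 (x.2.2 σ h) :)))

/-- The sorting data of `H` consist of the tuples `J` of sorts such that `G(K)/H` acts faithfully
on `S_J(acl(K)^H)`. -/
theorem HasUniformEI.mem_sortData_iff (hEI : HasUniformEI L M) (H : OpenNormalSubgroup (absGal K))
    (hfin : H.toSubgroup.FiniteIndex) (J : List L.Sorts) :
    J ∈ sortData K H ↔ ∀ σ : absGal K, (∀ c : Tup (fun s => acl K.carrier s) J,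
      (∀ τ ∈ H.toSubgroup, actTup τ c = c) → actTup σ c = c) → σ ∈ H.toSubgroup := by
  have hker := hEI.ker_restrictFixedPts H.isOpen'
  have hsurj := restrictFixedPts_surjective (K := K) H.toSubgroup
  have : Finite (autGroup (fixedPts K H.toSubgroup) K.carrier) := by
    have h := hfin
    rw [← hker] at h
    exact Finite.of_equiv _
      (QuotientGroup.quotientKerEquivOfSurjective (restrictFixedPts H.toSubgroup) hsurj).toEquiv
  let f : autGroup (fixedPts K H.toSubgroup) K.carrier →
      Equiv.Perm (Tup (fun s => fixedPts K H.toSubgroup s) J) :=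
    fun σ => Equiv.piCongrRight fun j => σ.1 (J.get j)
  have hcard : J ∈ sortData K H ↔ Function.Injective f := by
    constructor
    · intro h x y hxy
      have hb := (Set.rangeFactorization_surjective (f := f)).bijective_of_nat_card_le
        (le_of_eq (Eq.symm h))
      exact hb.1 (Subtype.ext hxy)
    · intro h
      exact Nat.card_congr (Equiv.ofInjective f h).symm
  -- the image of `σ` under `f` agrees with that of `τ` iff `σ` and `τ` agree on fixed tuples
  have hf : ∀ σ τ : absGal K,
      f (restrictFixedPts H.toSubgroup σ) = f (restrictFixedPts H.toSubgroup τ) ↔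
        ∀ c : Tup (fun s => acl K.carrier s) J,
          (∀ ρ ∈ H.toSubgroup, actTup ρ c = c) → actTup σ c = actTup τ c := by
    intro σ τ
    constructor
    · intro h c hc
      have := congrArg (fun π => π fun j => ⟨(c j).1,
        mem_fixedPts_of_forall fun ρ hρ => congrFun (hc ρ hρ) j⟩) h
      exact funext fun j => Subtype.ext (Subtype.ext_iff.1 (congrFun this j) :)
    · intro h
      refine Equiv.ext fun c => funext fun j => Subtype.ext ?_
      exact (Subtype.ext_iff.1 (congrFun (h (fun j => ⟨(c j).1, (c j).2.1⟩)
        fun ρ hρ => funext fun j => (c j).2.2 ρ hρ) j) :)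
  rw [hcard]
  constructor
  · intro h σ hσ
    rw [← hker, MonoidHom.mem_ker, ← map_one (restrictFixedPts H.toSubgroup)]
    exact h ((hf σ 1).2 hσ)
  · intro h x y hxy
    obtain ⟨σ, rfl⟩ := hsurj x
    obtain ⟨τ, rfl⟩ := hsurj y
    have h1 : τ⁻¹ * σ ∈ H.toSubgroup := h _ fun c hc => by
      rw [actTup_mul, (hf σ τ).1 hxy c hc, ← actTup_mul, inv_mul_cancel, actTup_one]
    rw [← hker, MonoidHom.mem_ker, map_mul, map_inv, inv_mul_eq_one] at h1
    exact h1.symm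

/-- A converse to `HasUniformEI.exists_generators`. -/
theorem HasUniformEI.mem_sortData (hEI : HasUniformEI L M) (H : OpenNormalSubgroup (absGal K))
    (hfin : H.toSubgroup.FiniteIndex) {J : List L.Sorts} {n : ℕ}
    {c : Fin n → Tup (fun s => acl K.carrier s) J} (hc : H.toSubgroup = ⨅ m, fixer (c m)) :
    J ∈ sortData K H := by
  refine (hEI.mem_sortData_iff H hfin J).2 fun σ hσ => ?_
  rw [hc, Subgroup.mem_iInf]
  intro m
  refine hσ (c m) fun τ hτ => ?_
  rw [hc, Subgroup.mem_iInf] at hτ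
  exact hτ m

/-- A subgroup `H` with `J` among its sorting data is the stabilizer of fewer than `[G(K) : H]`
tuples of sorts `J`: for each nontrivial coset, one that is fixed by `H` and moved by the coset. -/
theorem HasUniformEI.exists_generators (hEI : HasUniformEI L M)
    (H : OpenNormalSubgroup (absGal K)) (hfin : H.toSubgroup.FiniteIndex) {J : List L.Sorts}
    (hJ : J ∈ sortData K H) : ∃ n < H.toSubgroup.index,
      ∃ c : Fin n → Tup (fun s => acl K.carrier s) J, H.toSubgroup = ⨅ m, fixer (c m) := by
  classical
  suffices h : ∃ n < H.toSubgroup.index, ∃ c : Fin n → Tup (fun s => acl K.carrier s) J,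
      ∀ σ : absGal K, σ ∈ H.toSubgroup ↔ ∀ m, actTup σ (c m) = c m by
    obtain ⟨n, hn, c, hc⟩ := h
    exact ⟨n, hn, c, Subgroup.ext fun σ => (hc σ).trans
      (by simp only [Subgroup.mem_iInf, mem_fixer])⟩
  have : Finite (absGal K ⧸ H.toSubgroup) := Subgroup.finite_quotient_of_finiteIndex
  let Q := {q : absGal K ⧸ H.toSubgroup // q ≠ 1}
  have key : ∀ q : Q, ∃ c : Tup (fun s => acl K.carrier s) J,
      (∀ τ ∈ H.toSubgroup, actTup τ c = c) ∧ actTup q.1.out c ≠ c := fun q => by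
    by_contra! h
    refine q.2 ?_
    rw [← q.1.out_eq']
    exact (QuotientGroup.eq_one_iff _).2
      ((hEI.mem_sortData_iff H hfin J).1 hJ q.1.out fun c hc => h c hc)
  choose c hc hc' using key
  refine ⟨Nat.card Q, ?_, fun m => c ((Finite.equivFin Q).symm m), fun σ =>
    ⟨fun hσ m => hc _ σ hσ, fun h => ?_⟩⟩
  · exact Finite.card_subtype_lt (x := (1 : absGal K ⧸ H.toSubgroup)) (by simp)
  · by_contra hσ
    let q : Q := ⟨QuotientGroup.mk σ, fun h1 => hσ ((QuotientGroup.eq_one_iff σ).1 h1)⟩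
    have h1 := h (Finite.equivFin Q q)
    simp only [Equiv.symm_apply_apply] at h1
    have h2 : σ⁻¹ * q.1.out ∈ H.toSubgroup := QuotientGroup.eq.1 (q.1.out_eq').symm
    refine hc' q ?_
    conv_rhs => rw [← h1, ← hc q _ h2]
    rw [← actTup_mul, mul_inv_cancel_left]

end Correspondence

/-! ### Ultraproducts and the theorem of Łoś -/

section Los

variable {L : MSLanguage.{u, uf, ur}} {I : Type w} {U : Ultrafilter I}

section Rep

variable {S : Type u} {M : I → S → Type v}

theorem Ultraproduct.rep_mk {s : S} (x : PartialSection U M s) :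
    ∀ᶠ i in (U : Filter I), (Ultraproduct.rep U (Quotient.mk _ x)).1 i = x.1 i :=
  Quotient.mk_out (s := PartialSection.setoid U M s) x

theorem Ultraproduct.eq_iff {s : S} {x y : Ultraproduct U M s} :
    x = y ↔ ∀ᶠ i in (U : Filter I), (x.rep U).1 i = (y.rep U).1 i :=
  (Quotient.out_equiv_out (s := PartialSection.setoid U M s)).symm

/-- `a` is the tuple of values at `i` of the chosen representatives of `x`. -/
def IsValue {Γ : List S} (x : Tup (Ultraproduct U M) Γ) (i : I) (a : Tup (M i) Γ) : Prop :=
  ∀ j, ((x j).rep U).1 i = some (a j)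

theorem IsValue.unique {Γ : List S} {x : Tup (Ultraproduct U M) Γ} {i : I} {a b : Tup (M i) Γ}
    (ha : IsValue x i a) (hb : IsValue x i b) : a = b :=
  funext fun j => Option.some_injective _ ((ha j).symm.trans (hb j))

theorem eventually_exists_isValue {Γ : List S} (x : Tup (Ultraproduct U M) Γ) :
    ∀ᶠ i in (U : Filter I), ∃ a, IsValue x i a := by
  filter_upwards [eventually_all.2 fun j => ((x j).rep U).2] with i hi
  exact ⟨fun j => ((x j).rep U |>.1 i).get (hi j), fun j => by simp⟩

theorem IsValue.cons {Γ : List S} {s : S} {x : Tup (Ultraproduct U M) Γ}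
    {y : Ultraproduct U M s} {i : I} {a : Tup (M i) Γ} {b : M i s} (ha : IsValue x i a)
    (hb : (y.rep U).1 i = some b) : IsValue (Tup.cons y x) i (Tup.cons b a) :=
  forall_cons (M := Ultraproduct U M) (N := M i) (fun _ y b => (y.rep U).1 i = some b) hb ha

/-- Elements of the ultraproduct are found by choosing coordinates almost everywhere. -/
theorem exists_ultraproduct {s : S} {p : ∀ i, M i s → Prop}
    (h : ∀ᶠ i in (U : Filter I), ∃ y, p i y) :
    ∃ x : Ultraproduct U M s, ∀ᶠ i in (U : Filter I), ∃ y, (x.rep U).1 i = some y ∧ p i y := by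
  classical
  let f : PartialSection U M s := ⟨fun i => if h : ∃ y, p i y then some h.choose else none, by
    filter_upwards [h] with i hi
    simp [hi]⟩
  refine ⟨Quotient.mk _ f, ?_⟩
  filter_upwards [h, Ultraproduct.rep_mk f] with i hi hf
  exact ⟨hi.choose, by rw [hf]; exact dif_pos hi, hi.choose_spec⟩

end Rep

variable {M : I → L.Sorts → Type v} [∀ i, L.Structure (M i)]

theorem eventually_rep_funMap {J : List L.Sorts} {s : L.Sorts} (f : L.Functions J s)
    (x : Tup (Ultraproduct U M) J) : ∀ᶠ i in (U : Filter I), ∀ a, IsValue x i a →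
      ((Structure.funMap f x).rep U).1 i = some (Structure.funMap f a) := by
  classical
  filter_upwards [Ultraproduct.rep_mk (U := U) (M := M) (s := s)
    ⟨fun i => if h : ∀ j, (((x j).rep U).1 i).isSome then
        some (Structure.funMap f fun j => (((x j).rep U).1 i).get (h j)) else none, by
      filter_upwards [eventually_all.2 fun j => ((x j).rep U).2] with i hi
      simp [hi]⟩] with i hi a ha
  refine Eq.trans ?_ (hi.trans ?_)
  · rfl
  · have h : ∀ j, (((x j).rep U).1 i).isSome := fun j => by rw [ha j]; rfl
    refine (dif_pos h).trans ?_
    have h2 : (fun j => (((x j).rep U).1 i).get (h j)) = a :=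
      funext fun j => Option.some_injective _ (by rw [Option.some_get]; exact ha j)
    rw [h2]

theorem eventually_rep_realize {Γ : List L.Sorts} (x : Tup (Ultraproduct U M) Γ) :
    ∀ {s : L.Sorts} (t : L.Term Γ s), ∀ᶠ i in (U : Filter I), ∀ a, IsValue x i a →
      ((t.realize x).rep U).1 i = some (t.realize a)
  | _, .var j => Eventually.of_forall fun _ _ ha => ha j
  | _, .func f t => by
    filter_upwards [eventually_rep_funMap f fun j => (t j).realize x,
      eventually_all.2 fun j => eventually_rep_realize x (t j)] with i h1 h2 a ha
    exact h1 _ fun j => h2 j a ha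

/-- The theorem of Łoś. -/
theorem realize_ultraproduct_iff : ∀ {Γ : List L.Sorts} (φ : L.Formula Γ)
    (x : Tup (Ultraproduct U M) Γ),
    φ.Realize x ↔ ∀ᶠ i in (U : Filter I), ∃ a, IsValue x i a ∧ φ.Realize a
  | _, .falsum, x => by
    simp [Formula.Realize, U.neBot.ne]
  | _, .equal t t', x => by
    change t.realize x = t'.realize x ↔ _
    rw [Ultraproduct.eq_iff]
    refine eventually_congr ?_
    filter_upwards [eventually_rep_realize x t, eventually_rep_realize x t',
      eventually_exists_isValue x] with i h h' ⟨a, ha⟩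
    rw [h a ha, h' a ha]
    constructor
    · exact fun e => ⟨a, ha, Option.some_injective _ e⟩
    · rintro ⟨b, hb, e⟩
      obtain rfl := ha.unique hb
      exact congrArg _ e
  | _, .rel R t, x => by
    change (∀ᶠ i in (U : Filter I), ∃ a, IsValue (fun j => (t j).realize x) i a ∧
      Structure.RelMap R a) ↔ _
    refine eventually_congr ?_
    filter_upwards [eventually_all.2 fun j => eventually_rep_realize x (t j),
      eventually_exists_isValue x] with i h ⟨a, ha⟩
    have h1 : IsValue (fun j => (t j).realize x) i fun j => (t j).realize a := fun j => h j a ha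
    constructor
    · rintro ⟨b, hb, e⟩
      obtain rfl := h1.unique hb
      exact ⟨a, ha, e⟩
    · rintro ⟨b, hb, e⟩
      obtain rfl := ha.unique hb
      exact ⟨_, h1, e⟩
  | _, .imp φ ψ, x => by
    change (φ.Realize x → ψ.Realize x) ↔ _
    rw [realize_ultraproduct_iff φ, realize_ultraproduct_iff ψ, ← Ultrafilter.eventually_imp]
    refine eventually_congr ?_
    filter_upwards [eventually_exists_isValue x] with i ⟨a, ha⟩
    constructor
    · intro h
      refine ⟨a, ha, fun hφ => ?_⟩
      obtain ⟨b, hb, e⟩ := h ⟨a, ha, hφ⟩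
      obtain rfl := ha.unique hb
      exact e
    · rintro ⟨b, hb, e⟩ ⟨c, hc, e'⟩
      obtain rfl := hb.unique hc
      exact ⟨_, hb, e e'⟩
  | _, .all s φ, x => by
    change (∀ y, φ.Realize (Tup.cons y x)) ↔ _
    constructor
    · intro h
      by_contra hn
      rw [← Ultrafilter.eventually_not] at hn
      obtain ⟨y, hy⟩ := exists_ultraproduct (U := U) (M := M) (s := s)
        (p := fun i b => ∃ a, IsValue x i a ∧ ¬ φ.Realize (Tup.cons b a)) (by
          filter_upwards [hn, eventually_exists_isValue x] with i hi ⟨a, ha⟩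
          by_contra! h'
          exact hi ⟨a, ha, fun b => h' b a ha⟩)
      obtain ⟨i, ⟨b, hb, a, ha, h1⟩, c, hc, h2⟩ :=
        (hy.and ((realize_ultraproduct_iff φ _).1 (h y))).exists
      obtain rfl := (ha.cons hb).unique hc
      exact h1 h2
    · intro h y
      rw [realize_ultraproduct_iff φ]
      filter_upwards [h, (y.rep U).2] with i ⟨a, ha, h'⟩ hy
      exact ⟨_, ha.cons (Option.some_get hy).symm, h' _⟩

/-- An ultrapower of `C` is elementarily equivalent to `C`. -/
theorem elementarilyEquivalent_ultrapower (C : L.Sorts → Type v) [L.Structure C]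
    (U : Ultrafilter I) : L.ElementarilyEquivalent C (Ultraproduct U fun _ => C) := fun φ => by
  rw [realize_ultraproduct_iff]
  constructor
  · exact fun h => Eventually.of_forall fun i => ⟨fun j => j.elim0, fun j => j.elim0, h⟩
  · intro h
    obtain ⟨i, a, -, ha⟩ := h.exists
    rwa [show a = fun j => j.elim0 from funext fun j => j.elim0] at ha

end Los

section Embedding

variable {L : MSLanguage.{u, uf, ur}}

theorem Embedding.map_realize {M : L.Sorts → Type v} [L.Structure M] {N : L.Sorts → Type v'}
    [L.Structure N] (ι : L.Embedding M N) {Γ : List L.Sorts} (a : Tup M Γ) :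
    ∀ {s : L.Sorts} (t : L.Term Γ s),
      ι.toFun s (t.realize a) = t.realize fun j => ι.toFun _ (a j)
  | _, .var _ => rfl
  | _, .func f t => (ι.map_fun f _).trans
      (congrArg _ (funext fun j => Embedding.map_realize ι a (t j)))

theorem Embedding.realize_iff_of_isQF {M : L.Sorts → Type v} [L.Structure M]
    {N : L.Sorts → Type v'} [L.Structure N] (ι : L.Embedding M N) : ∀ {Γ : List L.Sorts}
    (φ : L.Formula Γ) (_ : φ.IsQF) (a : Tup M Γ),
      φ.Realize (fun j => ι.toFun _ (a j)) ↔ φ.Realize a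
  | _, .falsum, _, _ => Iff.rfl
  | _, .equal t t', _, a => by
    change t.realize _ = t'.realize _ ↔ _
    rw [← ι.map_realize, ← ι.map_realize]
    exact (ι.injective _).eq_iff
  | _, .rel R t, _, a => by
    change Structure.RelMap R (fun j => (t j).realize _) ↔ _
    simp only [← ι.map_realize]
    exact ι.map_rel R _
  | _, .imp φ ψ, h, a =>
    imp_congr (ι.realize_iff_of_isQF φ h.1 a) (ι.realize_iff_of_isQF ψ h.2 a)

variable {I : Type w} {U : Ultrafilter I} {C : L.Sorts → Type v} [L.Structure C]

/-- The image of an element of an ultraproduct of substructures of `C` in the ultrapower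
of `C`. -/
noncomputable def ultraInclFun (K : I → L.Substructure C) (s : L.Sorts)
    (x : Ultraproduct U (fun i => (K i).toFam) s) : Ultraproduct U (fun _ => C) s :=
  Quotient.mk _ ⟨fun i => ((x.rep U).1 i).map Subtype.val, (x.rep U).2.mono fun i hi => by
    simpa using hi⟩

theorem rep_ultraInclFun (K : I → L.Substructure C) {s : L.Sorts}
    (x : Ultraproduct U (fun i => (K i).toFam) s) : ∀ᶠ i in (U : Filter I),
      ((ultraInclFun K s x).rep U).1 i = ((x.rep U).1 i).map Subtype.val :=
  Ultraproduct.rep_mk (U := U) (M := fun _ => C) _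

theorem eventually_isValue_ultraInclFun (K : I → L.Substructure C) {Γ : List L.Sorts}
    (x : Tup (Ultraproduct U fun i => (K i).toFam) Γ) : ∀ᶠ i in (U : Filter I), ∀ a,
      IsValue x i a → IsValue (fun j => ultraInclFun K _ (x j)) i fun j => (a j).1 := by
  filter_upwards [eventually_all.2 fun j => rep_ultraInclFun K (x j)] with i hi a ha j
  rw [hi j, ha j]
  rfl

/-- The embedding of an ultraproduct of substructures of `C` into the ultrapower of `C`. -/
noncomputable def ultraIncl (U : Ultrafilter I) (K : I → L.Substructure C) :
    L.Embedding (Ultraproduct U fun i => (K i).toFam) (Ultraproduct U fun _ => C) where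
  toFun := ultraInclFun K
  injective s x y h := by
    rw [Ultraproduct.eq_iff] at h ⊢
    filter_upwards [h, rep_ultraInclFun K x, rep_ultraInclFun K y] with i h h1 h2
    rw [h1, h2] at h
    exact Option.map_injective Subtype.val_injective h
  map_fun f a := by
    rw [Ultraproduct.eq_iff]
    filter_upwards [rep_ultraInclFun K (Structure.funMap f a), eventually_rep_funMap f a,
      eventually_rep_funMap f fun j => ultraInclFun K _ (a j), eventually_exists_isValue a,
      eventually_isValue_ultraInclFun K a] with i h1 h2 h3 ⟨b, hb⟩ h4
    rw [h1, h2 b hb, h3 _ (h4 b hb)]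
    rfl
  map_rel R a := by
    refine eventually_congr ?_
    filter_upwards [eventually_exists_isValue a, eventually_isValue_ultraInclFun K a]
      with i ⟨b, hb⟩ h
    constructor
    · rintro ⟨c, hc, hR⟩
      obtain rfl := (h b hb).unique hc
      exact ⟨b, hb, hR⟩
    · rintro ⟨c, hc, hR⟩
      exact ⟨_, h c hc, hR⟩

end Embedding

/-! ### Coordinates for the algebraic closure of the ultraproduct -/

section Coordinates

variable {L : MSLanguage.{u, uf, ur}} {I : Type w}

/-- Coordinates, in copies of `C` indexed by `I`, for the elements of `acl(A)`, where `A` is a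
substructure of a model `N` of `Th(C)` playing the role of the ultraproduct of the substructures
`K i` of `C`. Such coordinates amount to an elementary map over the ultraproduct from `acl(A)`
onto its algebraic closure in the ultrapower of `C`. As sorts with an element in `N` are
nonempty in `C`, coordinates can be chosen everywhere and not only almost everywhere. -/
structure Coordinates {C : L.Sorts → Type v} [L.Structure C] (U : Ultrafilter I)
    (K : I → L.Substructure C) {N : L.Sorts → Type v'} [L.Structure N]
    (A : L.Substructure N) where
  coord : ∀ s : L.Sorts, acl A.carrier s → I → C s
  realize_iff : ∀ {Γ : List L.Sorts} (φ : L.Formula Γ) (b : Tup (fun s => acl A.carrier s) Γ),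
    φ.Realize (valTup b) ↔ ∀ᶠ i in (U : Filter I), φ.Realize fun j => coord _ (b j) i
  eventually_mem : ∀ {s : L.Sorts} (b : acl A.carrier s), b.1 ∈ A.carrier s →
    ∀ᶠ i in (U : Filter I), coord s b i ∈ (K i).carrier s
  exists_of_mem : ∀ {s : L.Sorts} (x : I → C s),
    (∀ᶠ i in (U : Filter I), x i ∈ (K i).carrier s) →
    ∃ b : acl A.carrier s, b.1 ∈ A.carrier s ∧ ∀ᶠ i in (U : Filter I), coord s b i = x i
  exists_of_encard_le : ∀ {s : L.Sorts} {Γ : List L.Sorts} (φ : L.Formula (s :: Γ))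
    (a : Tup (fun s => acl A.carrier s) Γ) (_ : ∀ j, (a j).1 ∈ A.carrier (Γ.get j)) (k : ℕ)
    (x : I → C s), (∀ᶠ i in (U : Filter I),
      {y : C s | φ.Realize (Tup.cons y fun j => coord _ (a j) i)}.encard ≤ k ∧
        φ.Realize (Tup.cons (x i) fun j => coord _ (a j) i)) →
    ∃ b : acl A.carrier s, ∀ᶠ i in (U : Filter I), coord s b i = x i

variable {C : L.Sorts → Type v} [L.Structure C] {U : Ultrafilter I}
  {N : L.Sorts → Type v'} [L.Structure N]

theorem Ultraproduct.exists_total_rep {S : Type u} {C : S → Type v} {s : S}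
    (x : Ultraproduct U (fun _ : I => C) s) :
    ∃ f : I → C s, ∀ᶠ i in (U : Filter I), (x.rep U).1 i = some (f i) :=
  ((x.rep U).2.mono fun _ hi => Option.isSome_iff_exists.1 hi).choice

theorem Ultraproduct.eq_of_total_rep {S : Type u} {C : S → Type v} {s : S}
    {x : Ultraproduct U (fun _ : I => C) s} {f g : I → C s}
    (hf : ∀ᶠ i in (U : Filter I), (x.rep U).1 i = some (f i))
    (hg : ∀ᶠ i in (U : Filter I), (x.rep U).1 i = some (g i)) :
    ∀ᶠ i in (U : Filter I), f i = g i := by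
  filter_upwards [hf, hg] with i h1 h2
  exact Option.some_injective _ (h1.symm.trans h2)

/-- Over an embedded ultraproduct of substructures, the truth of formulas does not depend on the
surrounding model, by quantifier elimination. -/
theorem isElementary_ultraproduct (hQE : HasQE L C) (hN : L.ElementarilyEquivalent C N)
    (K : I → L.Substructure C) (ι : L.Embedding (Ultraproduct U fun i => (K i).toFam) N) :
    IsElementary {p : Σ s : L.Sorts, N s × Ultraproduct U (fun _ => C) s |
      ∃ k, ι.toFun _ k = p.2.1 ∧ ultraInclFun K _ k = p.2.2} := fun Γ φ p hp => by
  choose k h1 h2 using hp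
  obtain ⟨ψ, hψ, h⟩ := hQE Γ φ
  rw [hN.realize_iff h, (elementarilyEquivalent_ultrapower C U).realize_iff h,
    show (fun j => (p j).1) = fun j => ι.toFun _ (k j) from funext fun j => (h1 j).symm,
    show (fun j => (p j).2) = fun j => (ultraIncl U K).toFun _ (k j) from
      funext fun j => (h2 j).symm,
    ι.realize_iff_of_isQF ψ hψ, (ultraIncl U K).realize_iff_of_isQF ψ hψ]

theorem exists_coordinates (hQE : HasQE L C) (hN : L.ElementarilyEquivalent C N)
    (K : I → L.Substructure C) (ι : L.Embedding (Ultraproduct U fun i => (K i).toFam) N) :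
    Nonempty (Coordinates U K ι.range) := by
  obtain ⟨R, h0, hR, hdom, hran⟩ := (isElementary_ultraproduct hQE hN K ι).exists_maximal
  have hex : ∀ (s : L.Sorts) (b : acl ι.range.carrier s),
      ∃ y : Ultraproduct U (fun _ => C) s, (⟨s, b.1, y⟩ : Σ s : L.Sorts, N s × _) ∈ R := fun s b =>
    hdom s (acl_mono (A := ι.range.carrier) (A' := relDom R)
      (fun t x ⟨k, hk⟩ => ⟨ultraInclFun K t k, h0 ⟨k, hk, rfl⟩⟩) s b.2)
  choose y hy using hex
  have hrep := fun s (b : acl ι.range.carrier s) => (y s b).exists_total_rep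
  choose f hf using hrep
  have hmem : ∀ {s : L.Sorts} (k : Ultraproduct U (fun i => (K i).toFam) s)
      (b : acl ι.range.carrier s), ι.toFun s k = b.1 → ∀ᶠ i in (U : Filter I),
        ((k.rep U).1 i).map Subtype.val = some (f s b i) := fun {s} k b hk => by
    have h1 : y s b = ultraInclFun K s k := (hR.eq_iff (hy s b) (h0 ⟨k, hk, rfl⟩)).1 rfl
    filter_upwards [hf s b, rep_ultraInclFun K k] with i h2 h3
    rw [← h3, ← h1, h2]
  have hval : ∀ {Γ : List L.Sorts} (b : Tup (fun s => acl ι.range.carrier s) Γ),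
      ∀ᶠ i in (U : Filter I), IsValue (M := fun _ => C) (fun j => y _ (b j)) i
        fun j => f _ (b j) i := fun b => eventually_all.2 fun j => hf _ (b j)
  have hlos : ∀ {Γ : List L.Sorts} (φ : L.Formula Γ) (b : Tup (fun s => acl ι.range.carrier s) Γ),
      φ.Realize (fun j => y _ (b j)) ↔
        ∀ᶠ i in (U : Filter I), φ.Realize fun j => f _ (b j) i := fun φ b => by
    rw [realize_ultraproduct_iff]
    refine eventually_congr ?_
    filter_upwards [hval b] with i hi
    exact ⟨fun ⟨a, ha, h⟩ => ha.unique hi ▸ h, fun h => ⟨_, hi, h⟩⟩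
  refine ⟨⟨f, fun {Γ} φ b => ?_, ?_, ?_, ?_⟩⟩
  · rw [← hlos]
    exact hR Γ φ (fun j => ((b j).1, y _ (b j))) fun j => hy _ (b j)
  · rintro s b ⟨k, hk⟩
    filter_upwards [hmem k b hk, (k.rep U).2] with i h1 h2
    obtain ⟨z, hz⟩ := Option.isSome_iff_exists.1 h2
    rw [hz] at h1
    rw [← Option.some_injective _ h1]
    exact z.2
  · intro s x hx
    obtain ⟨k, hk⟩ := exists_ultraproduct (U := U) (M := fun i => (K i).toFam) (s := s)
      (p := fun i z => z.1 = x i) (hx.mono fun i hi => ⟨⟨x i, hi⟩, rfl⟩)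
    refine ⟨⟨ι.toFun s k, subset_acl _ _ ⟨k, rfl⟩⟩, ⟨k, rfl⟩, ?_⟩
    filter_upwards [hk, hmem k ⟨ι.toFun s k, subset_acl _ _ ⟨k, rfl⟩⟩ rfl] with i ⟨z, h1, h2⟩ h3
    rw [h1] at h3
    rw [← Option.some_injective _ h3]
    exact h2
  · intro s Γ φ a ha k x hx
    obtain ⟨z, hz⟩ := exists_ultraproduct (U := U) (M := fun _ => C) (s := s)
      (p := fun i z => z = x i) (Eventually.of_forall fun i => ⟨x i, rfl⟩)
    have hz : ∀ᶠ i in (U : Filter I), (z.rep U).1 i = some (x i) := hz.mono fun i ⟨y, h, h'⟩ =>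
      h' ▸ h
    have hcard : (φ.cardLe s k).Realize fun j => y _ (a j) := by
      rw [hlos]
      filter_upwards [hx] with i hi
      exact (Formula.realize_cardLe s k φ _).2 hi.1
    have hφ : φ.Realize (Tup.cons z fun j => y _ (a j)) := by
      rw [realize_ultraproduct_iff]
      filter_upwards [hx, hz, hval a] with i h1 h2 h3
      exact ⟨_, h3.cons h2, h1.2⟩
    obtain ⟨b, hb⟩ := hran s ⟨Γ, φ, fun j => y _ (a j), fun j => ⟨_, hy _ (a j)⟩,
      Set.finite_of_encard_le_coe ((Formula.realize_cardLe s k φ _).1 hcard), hφ⟩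
    have hcard' := (hR _ (φ.cardLe s k) (fun j => ((a j).1, y _ (a j))) fun j => hy _ (a j)).2 hcard
    have hb' : b ∈ acl ι.range.carrier s := ⟨Γ, φ, valTup a, ha,
      Set.finite_of_encard_le_coe ((Formula.realize_cardLe s k φ _).1 hcard'),
      (hR.realize_cons_iff hb φ (fun j => ((a j).1, y _ (a j))) fun j => hy _ (a j)).2 hφ⟩
    have h1 : y s ⟨b, hb'⟩ = z := (hR.eq_iff (hy s ⟨b, hb'⟩) hb).1 rfl
    exact ⟨⟨b, hb'⟩, Ultraproduct.eq_of_total_rep (h1 ▸ hf s ⟨b, hb'⟩) hz⟩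

end Coordinates

/-! ### Limits of automorphisms -/

section Limits

variable {L : MSLanguage.{u, uf, ur}}

section ExtAct

variable {M : L.Sorts → Type v} [L.Structure M] {K : L.Substructure M}

open Classical in
/-- The action of `G(K)` on elements of the model, extended by the identity outside `acl(K)`. -/
noncomputable def extAct (σ : absGal K) (s : L.Sorts) (x : M s) : M s :=
  if hx : x ∈ acl K.carrier s then (σ.1 s ⟨x, hx⟩).1 else x

theorem extAct_val (σ : absGal K) {s : L.Sorts} (x : acl K.carrier s) :
    extAct σ s x.1 = (σ.1 s x).1 := dif_pos x.2

theorem extAct_valTup (σ : absGal K) {Γ : List L.Sorts} (a : Tup (fun s => acl K.carrier s) Γ) :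
    (fun j => extAct σ _ (valTup a j)) = valTup (actTup σ a) :=
  funext fun j => extAct_val σ (a j)

theorem extAct_of_notMem (σ : absGal K) {s : L.Sorts} {x : M s} (hx : x ∉ acl K.carrier s) :
    extAct σ s x = x := dif_neg hx

theorem extAct_of_mem (σ : absGal K) {s : L.Sorts} {x : M s} (hx : x ∈ K.carrier s) :
    extAct σ s x = x :=
  (extAct_val σ ⟨x, subset_acl _ _ hx⟩).trans (congrArg Subtype.val (σ.2.2 s _ hx))

theorem extAct_one (s : L.Sorts) (x : M s) : extAct (1 : absGal K) s x = x := by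
  by_cases hx : x ∈ acl K.carrier s
  · exact extAct_val 1 ⟨x, hx⟩
  · exact extAct_of_notMem _ hx

theorem extAct_mul (σ τ : absGal K) (s : L.Sorts) (x : M s) :
    extAct (σ * τ) s x = extAct σ s (extAct τ s x) := by
  by_cases hx : x ∈ acl K.carrier s
  · rw [show x = (⟨x, hx⟩ : acl K.carrier s).1 from rfl, extAct_val, extAct_val, extAct_val]
    rfl
  · rw [extAct_of_notMem _ hx, extAct_of_notMem _ hx, extAct_of_notMem _ hx]

theorem extAct_inv_extAct (σ : absGal K) (s : L.Sorts) (x : M s) :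
    extAct σ⁻¹ s (extAct σ s x) = x := by
  rw [← extAct_mul, inv_mul_cancel, extAct_one]

/-- The size of the orbit of a tuple fixed by a subgroup is at most the index of the subgroup. -/
theorem ncard_orbit_le_index {H : Subgroup (absGal K)} (hH : H.FiniteIndex) {Γ : List L.Sorts}
    {c : Tup (fun s => acl K.carrier s) Γ} (hc : ∀ σ ∈ H, actTup σ c = c) :
    (Set.range fun σ : absGal K => actTup σ c).ncard ≤ H.index := by
  have : Finite (absGal K ⧸ H) := Subgroup.finite_quotient_of_finiteIndex
  have hsub : (Set.range fun σ : absGal K => actTup σ c) ⊆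
      (fun q : absGal K ⧸ H => actTup q.out c) '' Set.univ := by
    rintro _ ⟨σ, rfl⟩
    refine ⟨QuotientGroup.mk σ, trivial, ?_⟩
    have h : σ⁻¹ * (QuotientGroup.mk σ : absGal K ⧸ H).out ∈ H :=
      QuotientGroup.eq.1 (QuotientGroup.out_eq' _).symm
    change actTup _ c = actTup σ c
    conv_rhs => rw [← hc _ h]
    rw [← actTup_mul, mul_inv_cancel_left]
  refine (Set.ncard_le_ncard hsub (Set.toFinite _)).trans ((Set.ncard_image_le).trans ?_)
  rw [Set.ncard_univ]
  rfl

end ExtAct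

variable {I : Type w} {U : Ultrafilter I}

/-- Choice along an ultrafilter, for families of nonempty types. -/
theorem exists_forall_eventually {β : I → Type*} [∀ i, Nonempty (β i)] {p : ∀ i, β i → Prop}
    (h : ∀ᶠ i in (U : Filter I), ∃ y, p i y) :
    ∃ f : ∀ i, β i, ∀ᶠ i in (U : Filter I), p i (f i) := by
  classical
  refine ⟨fun i => if h : ∃ y, p i y then h.choose else Classical.arbitrary _, ?_⟩
  filter_upwards [h] with i hi
  rw [dif_pos hi]
  exact hi.choose_spec

/-- A property holding almost everywhere along every section holds for all elements of almost
every factor. -/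
theorem eventually_forall_of_forall_section {β : I → Type*} [∀ i, Nonempty (β i)]
    {p : ∀ i, β i → Prop} (h : ∀ f : ∀ i, β i, ∀ᶠ i in (U : Filter I), p i (f i)) :
    ∀ᶠ i in (U : Filter I), ∀ y, p i y := by
  by_contra hn
  rw [← Ultrafilter.eventually_not] at hn
  obtain ⟨f, hf⟩ := exists_forall_eventually (p := fun i y => ¬ p i y)
    (hn.mono fun i hi => not_forall.1 hi)
  obtain ⟨i, h1, h2⟩ := (hf.and (h f)).exists
  exact h1 h2

namespace Coordinates

variable {C : L.Sorts → Type v} [L.Structure C] {K : I → L.Substructure C}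
  {N : L.Sorts → Type v'} [L.Structure N] {A : L.Substructure N} (S : Coordinates U K A)
  {Γ : List L.Sorts} {s : L.Sorts}

/-- The coordinates of a tuple. -/
def tup (b : Tup (fun s => acl A.carrier s) Γ) (i : I) : Tup C Γ := fun j => S.coord _ (b j) i

theorem tup_cons (x : acl A.carrier s) (b : Tup (fun s => acl A.carrier s) Γ) (i : I) :
    S.tup (Tup.cons (M := fun s => acl A.carrier s) x b) i = Tup.cons (S.coord s x i) (S.tup b i) :=
  map_cons (M := fun s => acl A.carrier s) (fun s x => S.coord s x i) x b

theorem tup_append {Δ : List L.Sorts} (a : Tup (fun s => acl A.carrier s) Γ)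
    (b : Tup (fun s => acl A.carrier s) Δ) (i : I) :
    S.tup (a.append b) i = (S.tup a i).append (S.tup b i) :=
  map_append (M := fun s => acl A.carrier s) (fun s x => S.coord s x i) a b

theorem realize_cons_iff (φ : L.Formula (s :: Γ)) (x : acl A.carrier s)
    (a : Tup (fun s => acl A.carrier s) Γ) : φ.Realize (Tup.cons x.1 (valTup a)) ↔
      ∀ᶠ i in (U : Filter I), φ.Realize (Tup.cons (S.coord s x i) (S.tup a i)) := by
  rw [← valTup_cons, S.realize_iff]
  exact eventually_congr (Eventually.of_forall fun i => by rw [← S.tup_cons]; rfl)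

theorem eq_iff {x y : acl A.carrier s} :
    x = y ↔ ∀ᶠ i in (U : Filter I), S.coord s x i = S.coord s y i :=
  Subtype.ext_iff.trans (S.realize_cons_iff
    (.equal (var₀ s [s]) ((var₀ s []).subst (shift s [s]))) x
      (Tup.cons (M := fun s => acl A.carrier s) y fun j => j.elim0))

/-- An element of `acl(A)` solves a formula over `A` whose number of solutions is bounded
uniformly in the coordinates. -/
theorem exists_formula (b : acl A.carrier s) : ∃ (Γ : List L.Sorts) (φ : L.Formula (s :: Γ))
    (a : Tup (fun s => acl A.carrier s) Γ) (n : ℕ), (∀ j, (a j).1 ∈ A.carrier (Γ.get j)) ∧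
      ∀ᶠ i in (U : Filter I), (∀ j, S.tup a i j ∈ (K i).carrier (Γ.get j)) ∧
        {x : C s | φ.Realize (Tup.cons x (S.tup a i))}.encard ≤ n ∧
        φ.Realize (Tup.cons (S.coord s b i) (S.tup a i)) := by
  obtain ⟨Γ, φ, a, ha, hfin, hφ⟩ := b.2
  let a' : Tup (fun s => acl A.carrier s) Γ := fun j => ⟨a j, subset_acl _ _ (ha j)⟩
  refine ⟨Γ, φ, a', {x | φ.Realize (Tup.cons x a)}.ncard, ha, ?_⟩
  have h := (S.realize_iff (φ.cardLe s _) a').1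
    ((Formula.realize_cardLe s _ φ (valTup a')).2 hfin.cast_ncard_eq.ge)
  filter_upwards [h, (S.realize_cons_iff φ b a').1 hφ,
    eventually_all.2 fun j => S.eventually_mem (a' j) (ha j)] with i h1 h2 h3
  exact ⟨h3, (Formula.realize_cardLe s _ φ _).1 h1, h2⟩

theorem eventually_mem_acl (b : acl A.carrier s) :
    ∀ᶠ i in (U : Filter I), S.coord s b i ∈ acl (K i).carrier s := by
  obtain ⟨Γ, φ, a, n, -, h⟩ := S.exists_formula b
  filter_upwards [h] with i ⟨h1, h2, h3⟩
  exact ⟨Γ, φ, _, h1, Set.finite_of_encard_le_coe h2, h3⟩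

theorem eventually_exists_valTup (b : Tup (fun s => acl A.carrier s) Γ) :
    ∀ᶠ i in (U : Filter I), ∃ c : Tup (fun s => acl (K i).carrier s) Γ, S.tup b i = valTup c := by
  filter_upwards [eventually_all.2 fun j => S.eventually_mem_acl (b j)] with i hi
  exact ⟨fun j => ⟨_, hi j⟩, rfl⟩

theorem mem_iff (b : acl A.carrier s) : b.1 ∈ A.carrier s ↔
    ∀ᶠ i in (U : Filter I), S.coord s b i ∈ (K i).carrier s := by
  refine ⟨S.eventually_mem b, fun h => ?_⟩
  obtain ⟨b', hb', h'⟩ := S.exists_of_mem _ h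
  rwa [← S.eq_iff.2 h']

/-- If the `K i` are definably closed, so is `A`. -/
theorem isDefinablyClosed (S : Coordinates U K A) (hK : ∀ i, (K i).IsDefinablyClosed) :
    A.IsDefinablyClosed := fun s => by
  refine Set.Subset.antisymm ?_ fun x hx => ?_
  · rintro b ⟨Γ, φ, a, ha, hb⟩
    have hφ : φ.Realize (Tup.cons b a) := hb.ge rfl
    let a' : Tup (fun s => acl A.carrier s) Γ := fun j => ⟨a j, subset_acl _ _ (ha j)⟩
    let b' : acl A.carrier s := ⟨b, Γ, φ, a, ha, hb ▸ Set.finite_singleton b, hφ⟩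
    have h1 := (S.realize_iff (φ.cardLe s 1) a').1
      ((Formula.realize_cardLe s 1 φ (valTup a')).2 (by
        change {x | φ.Realize (Tup.cons x a)}.encard ≤ _
        rw [hb, Set.encard_singleton]; rfl))
    refine (S.mem_iff b').2 ?_
    filter_upwards [h1, (S.realize_cons_iff φ b' a').1 hφ,
      eventually_all.2 fun j => S.eventually_mem (a' j) (ha j)] with i h1 h2 h3
    rw [← hK i s]
    refine ⟨Γ, φ, _, h3, Set.eq_singleton_iff_unique_mem.2 ⟨h2, fun y hy => ?_⟩⟩
    exact Set.encard_le_one_iff.1 (by exact_mod_cast (Formula.realize_cardLe s 1 φ _).1 h1) _ _ hy h2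
  · obtain ⟨b, hb⟩ : ∃ b : acl A.carrier s, b.1 = x := ⟨⟨x, subset_acl _ _ hx⟩, rfl⟩
    exact ⟨[s], .equal (var₀ s [s]) ((var₀ s []).subst (shift s [s])),
      Tup.cons x fun j => j.elim0, forall_cons_mem (fun s z => z ∈ A.carrier s) hx fun j => j.elim0,
      rfl⟩

/-- A sequence of automorphisms acts on `acl(A)` through the coordinates. -/
theorem exists_coord_eq_extAct (σ : ∀ i, absGal (K i)) (b : acl A.carrier s) :
    ∃ b' : acl A.carrier s, ∀ᶠ i in (U : Filter I),
      S.coord s b' i = extAct (σ i) s (S.coord s b i) := by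
  obtain ⟨Γ, φ, a, n, ha, h⟩ := S.exists_formula b
  refine S.exists_of_encard_le φ a ha n _ ?_
  filter_upwards [h, S.eventually_mem_acl b] with i ⟨h1, h2, h3⟩ h4
  refine ⟨h2, ?_⟩
  rw [extAct_val (σ i) ⟨_, h4⟩]
  exact (realize_apply_iff (σ i) ⟨_, h4⟩ φ h1).2 h3

/-- The limit of a sequence of automorphisms, as a function. -/
noncomputable def limFun (σ : ∀ i, absGal (K i)) (s : L.Sorts) (b : acl A.carrier s) :
    acl A.carrier s := (S.exists_coord_eq_extAct σ b).choose

theorem coord_limFun (σ : ∀ i, absGal (K i)) (b : acl A.carrier s) :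
    ∀ᶠ i in (U : Filter I), S.coord s (S.limFun σ s b) i = extAct (σ i) s (S.coord s b i) :=
  (S.exists_coord_eq_extAct σ b).choose_spec

theorem limFun_mul (σ τ : ∀ i, absGal (K i)) (b : acl A.carrier s) :
    S.limFun (σ * τ) s b = S.limFun σ s (S.limFun τ s b) := by
  rw [S.eq_iff]
  filter_upwards [S.coord_limFun (σ * τ) b, S.coord_limFun τ b,
    S.coord_limFun σ (S.limFun τ s b)] with i h1 h2 h3
  rw [h1, h3, h2, Pi.mul_apply, extAct_mul]

theorem limFun_one (b : acl A.carrier s) : S.limFun (1 : ∀ i, absGal (K i)) s b = b := by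
  rw [S.eq_iff]
  filter_upwards [S.coord_limFun 1 b] with i h
  rw [h, Pi.one_apply, extAct_one]

/-- The homomorphism from the product of the groups `G(K i)` to `G(A)` that takes a sequence of
automorphisms to its limit along the ultrafilter. -/
noncomputable def lim : (∀ i, absGal (K i)) →* absGal A where
  toFun σ := ⟨fun s =>
    { toFun := S.limFun σ s
      invFun := S.limFun σ⁻¹ s
      left_inv := fun b => by rw [← limFun_mul, inv_mul_cancel, limFun_one]
      right_inv := fun b => by rw [← limFun_mul, mul_inv_cancel, limFun_one] },
    fun Γ φ b => by
      change φ.Realize (valTup fun j => S.limFun σ _ (b j)) ↔ φ.Realize (valTup b)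
      rw [S.realize_iff, S.realize_iff]
      refine eventually_congr ?_
      filter_upwards [eventually_all.2 fun j => S.coord_limFun σ (b j),
        S.eventually_exists_valTup b] with i h1 ⟨c, hc⟩
      simp only [h1]
      change φ.Realize (fun j => extAct (σ i) _ (S.tup b i j)) ↔ φ.Realize (S.tup b i)
      rw [hc, extAct_valTup, realize_actTup],
    fun s b hb => S.eq_iff.2 <| by
      filter_upwards [S.coord_limFun σ b, S.eventually_mem b hb] with i h1 h2
      exact h1.trans (extAct_of_mem _ h2)⟩
  map_one' := Subtype.ext (funext fun s => Equiv.ext fun b => S.limFun_one b)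
  map_mul' σ τ := Subtype.ext (funext fun s => Equiv.ext fun b => S.limFun_mul σ τ b)

theorem coord_lim (σ : ∀ i, absGal (K i)) (b : acl A.carrier s) :
    ∀ᶠ i in (U : Filter I), S.coord s ((S.lim σ).1 s b) i = extAct (σ i) s (S.coord s b i) :=
  S.coord_limFun σ b

theorem lim_apply_eq_iff (σ : ∀ i, absGal (K i)) (b b' : acl A.carrier s) :
    (S.lim σ).1 s b = b' ↔
      ∀ᶠ i in (U : Filter I), extAct (σ i) s (S.coord s b i) = S.coord s b' i := by
  rw [S.eq_iff]
  refine eventually_congr ?_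
  filter_upwards [S.coord_lim σ b] with i h
  rw [h]

/-- Limits of sequences of automorphisms are dense in `G(A)`: on a given tuple every element of
`G(A)` agrees with a limit. The orbits of the coordinates of the tuple are coded, uniformly, by
elements of the `K i`, and the resulting code in `A` is fixed by `G(A)`. -/
theorem exists_lim_eq_on (hEI : HasUniformEI L C) (hK : ∀ i, (K i).IsDefinablyClosed)
    (σ : absGal A) (c : Tup (fun s => acl A.carrier s) Γ) :
    ∃ τ : ∀ i, absGal (K i), actTup (S.lim τ) c = actTup σ c := by
  have hb := fun j => S.exists_formula (c j)
  choose Θ φ a n _ hb using hb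
  obtain ⟨J, μ, hμ⟩ := hEI.exists_code_orbit Γ (∏ j, n j)
  have he : ∀ᶠ i in (U : Filter I), ∃ e : Tup C J, (∀ j, e j ∈ (K i).carrier (J.get j)) ∧
      ∀ x : Tup C Γ, μ.Realize (x.append e) ↔
        ∃ τ : absGal (K i), x = fun j => extAct τ _ (S.tup c i j) := by
    filter_upwards [eventually_all.2 hb, S.eventually_exists_valTup c] with i hi ⟨d, hd⟩
    obtain ⟨e, he, h⟩ := hμ (K i) (hK i) d (ncard_orbit_le d n fun j =>
      ⟨Θ j, φ j, S.tup (a j) i, (hi j).1, (hi j).2.1, by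
        rw [show (d j).1 = S.coord _ (c j) i from (congrFun hd j).symm]; exact (hi j).2.2⟩).2
    refine ⟨e, he, fun x => (h x).trans (exists_congr fun τ => ?_)⟩
    rw [hd, extAct_valTup]
  obtain ⟨e, he⟩ := he.choice
  have hε := fun j : Fin J.length => S.exists_of_mem (fun i => e i j) (he.mono fun i hi => hi.1 j)
  choose ε hεA hε using hε
  have hε' : ∀ᶠ i in (U : Filter I), S.tup ε i = e i :=
    (eventually_all.2 hε).mono fun i hi => funext hi
  have h1 : μ.Realize (valTup (c.append ε)) := by
    rw [S.realize_iff]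
    filter_upwards [hε', he] with i h1 h2
    change μ.Realize (S.tup (c.append ε) i)
    rw [S.tup_append, h1, h2.2]
    exact ⟨1, funext fun j => (extAct_one _ _).symm⟩
  rw [← realize_actTup σ, actTup_append, actTup_of_mem σ hεA, S.realize_iff] at h1
  obtain ⟨τ, hτ⟩ := exists_forall_eventually (U := U) (β := fun i => absGal (K i))
    (p := fun i τ => S.tup (actTup σ c) i = fun j => extAct τ _ (S.tup c i j)) (by
      filter_upwards [h1, hε', he] with i h1 h2 h3
      change μ.Realize (S.tup ((actTup σ c).append ε) i) at h1
      rw [S.tup_append, h2, h3.2] at h1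
      exact h1)
  refine ⟨τ, funext fun j => (S.lim_apply_eq_iff τ _ _).2 ?_⟩
  exact hτ.mono fun i hi => (congrFun hi j).symm

/-- Every element of `G(A)` is congruent to a limit modulo a given open subgroup. -/
theorem exists_lim_inv_mul_mem (hEI : HasUniformEI L C) (hK : ∀ i, (K i).IsDefinablyClosed)
    {H : Subgroup (absGal A)} (hH : IsOpen (H : Set (absGal A))) (σ : absGal A) :
    ∃ τ : ∀ i, absGal (K i), (S.lim τ)⁻¹ * σ ∈ H := by
  obtain ⟨Γ, c, hc⟩ := exists_fixer_le hH
  obtain ⟨τ, hτ⟩ := S.exists_lim_eq_on hEI hK σ c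
  refine ⟨τ, hc ?_⟩
  rw [mem_fixer, actTup_mul, ← hτ, ← actTup_mul, inv_mul_cancel, actTup_one]

/-- A sequence of elements of `acl(K i)` with boundedly many conjugates is the sequence of
coordinates of an element of `acl(A)`. -/
theorem exists_coord_eq (hEI : HasUniformEI L C) (hK : ∀ i, (K i).IsDefinablyClosed) (k : ℕ)
    (x : I → C s) (hx : ∀ᶠ i in (U : Filter I), ∃ y : acl (K i).carrier s, y.1 = x i ∧
      ∃ H : Subgroup (absGal (K i)), H.FiniteIndex ∧ H.index ≤ k ∧ ∀ σ ∈ H, σ.1 s y = y) :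
    ∃ b : acl A.carrier s, ∀ᶠ i in (U : Filter I), S.coord s b i = x i := by
  obtain ⟨J, μ, hμ⟩ := hEI.exists_code_orbit [s] k
  have he : ∀ᶠ i in (U : Filter I), ∃ e : Tup C J, (∀ j, e j ∈ (K i).carrier (J.get j)) ∧
      {y : C s | μ.Realize (Tup.cons y e)}.encard ≤ k ∧ μ.Realize (Tup.cons (x i) e) := by
    filter_upwards [hx] with i ⟨y, hy, H, hfin, hk, hH⟩
    let c : Tup (fun s => acl (K i).carrier s) [s] :=
      Tup.cons (M := fun s => acl (K i).carrier s) y fun j => j.elim0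
    have hc : (Set.range fun σ : absGal (K i) => actTup σ c).ncard ≤ k := by
      refine (ncard_orbit_le_index hfin fun σ hσ => ?_).trans hk
      rw [actTup_cons, hH σ hσ]
      exact congrArg _ (funext fun j => j.elim0)
    obtain ⟨e, he, h⟩ := hμ (K i) (hK i) c hc
    refine ⟨e, he, ?_, ?_⟩
    · have hfin' := finite_orbit c
      refine le_trans ?_ (Nat.cast_le.2 hc : _ ≤ (k : ℕ∞))
      rw [hfin'.cast_ncard_eq]
      refine le_trans (Set.encard_le_encard fun z hz => ?_) (Set.encard_image_le
        (fun d : Tup (fun s => acl (K i).carrier s) [s] => (d (0 : Fin 1)).1) _)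
      obtain ⟨σ, hσ⟩ := (h (Tup.cons z fun j => j.elim0)).1 hz
      exact ⟨_, ⟨σ, rfl⟩, (congrFun hσ (0 : Fin 1)).symm⟩
    · refine (h (Tup.cons (x i) fun j => j.elim0)).2 ⟨1, ?_⟩
      rw [actTup_one, valTup_cons, hy]
      exact congrArg _ (funext fun j => j.elim0)
  obtain ⟨e, he⟩ := he.choice
  have hε := fun j : Fin J.length => S.exists_of_mem (fun i => e i j) (he.mono fun i hi => hi.1 j)
  choose ε hεA hε using hε
  refine S.exists_of_encard_le (Γ := J) μ ε hεA k x ?_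
  filter_upwards [he, eventually_all.2 hε] with i h1 h2
  simp only [h2]
  exact h1.2

end Coordinates

end Limits

/-! ### Limits of subgroups -/

section Subgroups

/-- An index is at most `k` if there are no `k + 1` elements in distinct cosets. `Subgroup.index` is
`0` for subgroups of infinite index, so finiteness is stated separately. -/
theorem finiteIndex_and_index_le_iff {G : Type*} [Group G] (H : Subgroup G) (k : ℕ) :
    H.FiniteIndex ∧ H.index ≤ k ↔
      ¬ ∃ f : Fin (k + 1) → G, ∀ m m', m ≠ m' → (f m)⁻¹ * f m' ∉ H := by
  constructor
  · rintro ⟨hfin, hk⟩ ⟨f, hf⟩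
    have : Finite (G ⧸ H) := Subgroup.finite_quotient_of_finiteIndex
    have hinj : Function.Injective fun m => (QuotientGroup.mk (f m) : G ⧸ H) := fun m m' h => by
      by_contra hne
      exact hf m m' hne (QuotientGroup.eq.1 h)
    have := Nat.card_le_card_of_injective _ hinj
    rw [Nat.card_fin] at this
    exact absurd (this.trans hk) (by omega)
  · intro h
    have key : ¬ Nonempty (Fin (k + 1) ↪ G ⧸ H) := fun ⟨g⟩ => h ⟨fun m => (g m).out,
      fun m m' hne hmem => hne (g.injective (by
        rw [← QuotientGroup.eq, QuotientGroup.out_eq', QuotientGroup.out_eq'] at hmem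
        exact hmem))⟩
    have : Finite (G ⧸ H) := by
      by_contra hinf
      rw [not_finite_iff_infinite] at hinf
      exact key ⟨(Fin.valEmbedding).trans (Infinite.natEmbedding _)⟩
    refine ⟨Subgroup.finiteIndex_of_finite_quotient, ?_⟩
    by_contra! hlt
    refine key ?_
    have e := Finite.equivFin (G ⧸ H)
    exact ⟨(Fin.castLEEmb (show k + 1 ≤ Nat.card (G ⧸ H) from hlt)).trans e.symm.toEmbedding⟩

variable {L : MSLanguage.{u, uf, ur}} {I : Type w} {U : Ultrafilter I}

namespace Coordinates

variable {C : L.Sorts → Type v} [L.Structure C] {K : I → L.Substructure C}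
  {N : L.Sorts → Type v'} [L.Structure N] {A : L.Substructure N} (S : Coordinates U K A)

/-- The subgroup `H'` of `G(A)` is the limit of the subgroups `H i` of `G(K i)`. -/
def IsLimit (H : ∀ i, Subgroup (absGal (K i))) (H' : Subgroup (absGal A)) : Prop :=
  ∀ σ : ∀ i, absGal (K i), S.lim σ ∈ H' ↔ ∀ᶠ i in (U : Filter I), σ i ∈ H i

variable {S} {H H₁ H₂ : ∀ i, Subgroup (absGal (K i))} {H' H₁' H₂' : Subgroup (absGal A)}

theorem IsLimit.congr (h : S.IsLimit H₁ H') (hH : ∀ᶠ i in (U : Filter I), H₁ i = H₂ i) :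
    S.IsLimit H₂ H' := fun σ => (h σ).trans <| eventually_congr <| hH.mono fun i hi => by rw [hi]

theorem IsLimit.eventually_normal (h : S.IsLimit H H') (hn : H'.Normal) :
    ∀ᶠ i in (U : Filter I), (H i).Normal := by
  refine (eventually_forall_of_forall_section (β := fun i => absGal (K i) × absGal (K i))
    (p := fun i g => g.1 ∈ H i → g.2 * g.1 * g.2⁻¹ ∈ H i) fun f => ?_).mono
      fun i hi => ⟨fun σ hσ τ => hi (σ, τ) hσ⟩
  rw [Ultrafilter.eventually_imp]
  intro h1
  have h2 := hn.conj_mem _ ((h fun i => (f i).1).2 h1) (S.lim fun i => (f i).2)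
  rw [← map_mul, ← map_inv, ← map_mul] at h2
  exact (h _).1 h2

variable (hEI : HasUniformEI L C) (hK : ∀ i, (K i).IsDefinablyClosed)
include hEI hK

theorem IsLimit.le_iff (h₁ : S.IsLimit H₁ H₁') (h₂ : S.IsLimit H₂ H₂')
    (ho₁ : IsOpen (H₁' : Set (absGal A))) (ho₂ : IsOpen (H₂' : Set (absGal A))) :
    H₁' ≤ H₂' ↔ ∀ᶠ i in (U : Filter I), H₁ i ≤ H₂ i := by
  constructor
  · intro h
    refine eventually_forall_of_forall_section (β := fun i => absGal (K i))
      (p := fun i g => g ∈ H₁ i → g ∈ H₂ i) fun f => ?_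
    rw [Ultrafilter.eventually_imp]
    exact fun hf => (h₂ f).1 (h ((h₁ f).2 hf))
  · intro h σ hσ
    obtain ⟨τ, hτ⟩ := S.exists_lim_inv_mul_mem hEI hK
      (H := H₁' ⊓ H₂') (ho₁.inter ho₂) σ
    have h1 : S.lim τ ∈ H₁' := by
      have := H₁'.mul_mem hσ (H₁'.inv_mem hτ.1)
      simpa using this
    have h2 : S.lim τ ∈ H₂' := (h₂ τ).2 <| by
      filter_upwards [h, (h₁ τ).1 h1] with i hi hτi
      exact hi hτi
    simpa using H₂'.mul_mem h2 hτ.2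

/-- A limit of normal subgroups is normal. Since `H'` is open, only the action on a finite tuple
matters, and by density conjugation can be carried out with limits of sequences. -/
theorem IsLimit.normal (h : S.IsLimit H H') (ho : IsOpen (H' : Set (absGal A)))
    (hn : ∀ᶠ i in (U : Filter I), (H i).Normal) : H'.Normal := by
  constructor
  intro σ hσ τ
  obtain ⟨Γ, c, hc⟩ := exists_fixer_le ho
  obtain ⟨τ', hτ'⟩ := S.exists_lim_inv_mul_mem hEI hK ho τ
  -- `τ` may be replaced by `lim τ'`, and `σ` by a limit that agrees with it on `(lim τ')⁻¹ c`.
  have hρ : (S.lim τ')⁻¹ * τ * σ * ((S.lim τ')⁻¹ * τ)⁻¹ ∈ H' :=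
    H'.mul_mem (H'.mul_mem hτ' hσ) (H'.inv_mem hτ')
  set ρ := (S.lim τ')⁻¹ * τ * σ * ((S.lim τ')⁻¹ * τ)⁻¹ with hρ_def
  obtain ⟨ρ', h1, h2⟩ := S.exists_lim_inv_mul_mem hEI hK
    (H := H' ⊓ fixer (actTup (S.lim τ')⁻¹ c)) (ho.inter (isOpen_fixer _)) ρ
  have h3 : S.lim ρ' ∈ H' := by
    have := H'.mul_mem hρ (H'.inv_mem h1)
    simpa using this
  have h4 : S.lim (τ' * ρ' * τ'⁻¹) ∈ H' := (h _).2 <| by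
    filter_upwards [hn, (h _).1 h3] with i hi hρi
    exact hi.conj_mem _ hρi _
  have h5 : S.lim τ' * ((S.lim ρ')⁻¹ * ρ) * (S.lim τ')⁻¹ ∈ H' := hc <| by
    rw [mem_fixer, actTup_mul, actTup_mul, mem_fixer.1 h2, ← actTup_mul, mul_inv_cancel, actTup_one]
  have h6 := H'.mul_mem h4 h5
  rw [map_mul, map_mul, map_inv, hρ_def] at h6
  convert h6 using 1
  group

/-- Bounds on the index pass to limits in both directions, because they concern finitely many
representatives at a time. -/
theorem IsLimit.index_le_iff (h : S.IsLimit H H') (ho : IsOpen (H' : Set (absGal A))) (k : ℕ) :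
    (H'.FiniteIndex ∧ H'.index ≤ k) ↔
      ∀ᶠ i in (U : Filter I), (H i).FiniteIndex ∧ (H i).index ≤ k := by
  simp only [finiteIndex_and_index_le_iff, Ultrafilter.eventually_not]
  refine not_congr ⟨fun ⟨f, hf⟩ => ?_, fun hf => ?_⟩
  · have hτ := fun m => S.exists_lim_inv_mul_mem hEI hK ho (f m)
    choose τ hτ using hτ
    have h1 : ∀ᶠ i in (U : Filter I), ∀ m m', m ≠ m' → (τ m i)⁻¹ * τ m' i ∉ H i := by
      refine eventually_all.2 fun m => eventually_all.2 fun m' => ?_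
      by_cases hne : m = m'
      · exact Eventually.of_forall fun i h => absurd hne h
      have h2 : ¬ ∀ᶠ i in (U : Filter I), ((τ m)⁻¹ * τ m') i ∈ H i := fun hmem => by
        refine hf m m' hne ?_
        have h3 := (h _).2 hmem
        rw [map_mul, map_inv] at h3
        have h4 := H'.mul_mem (H'.mul_mem (H'.inv_mem (hτ m)) h3) (hτ m')
        convert h4 using 1
        group
      exact (Ultrafilter.eventually_not.2 h2).mono fun i hi _ => hi
    exact h1.mono fun i hi => ⟨fun m => τ m i, hi⟩
  · obtain ⟨g, hg⟩ := exists_forall_eventually (β := fun i => Fin (k + 1) → absGal (K i))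
      (p := fun i f => ∀ m m', m ≠ m' → (f m)⁻¹ * f m' ∉ H i) hf
    refine ⟨fun m => S.lim fun i => g i m, fun m m' hne hmem => ?_⟩
    rw [← map_inv, ← map_mul] at hmem
    obtain ⟨i, h1, h2⟩ := (hg.and ((h _).1 hmem)).exists
    exact h1 m m' hne h2

omit hEI hK

/-- The stabilizer of the `i`-th coordinates of a family of tuples. -/
def coordFixer (S : Coordinates U K A) {J : List L.Sorts} {n : ℕ}
    (c : Fin n → Tup (fun s => acl A.carrier s) J) (i : I) : Subgroup (absGal (K i)) where
  carrier := {σ | ∀ m j, extAct σ _ (S.coord _ (c m j) i) = S.coord _ (c m j) i}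
  one_mem' := fun _ _ => extAct_one _ _
  mul_mem' {σ τ} hσ hτ := fun m j => by rw [extAct_mul, hτ m j, hσ m j]
  inv_mem' {σ} hσ := fun m j => by
    conv_lhs => rw [← hσ m j]
    exact extAct_inv_extAct σ _ _

theorem isLimit_coordFixer (S : Coordinates U K A) {J : List L.Sorts} {n : ℕ}
    (c : Fin n → Tup (fun s => acl A.carrier s) J) :
    S.IsLimit (S.coordFixer c) (⨅ m, fixer (c m)) := fun σ => by
  simp only [Subgroup.mem_iInf, mem_fixer]
  change (∀ m, actTup (S.lim σ) (c m) = c m) ↔ ∀ᶠ i in (U : Filter I),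
    ∀ m j, extAct (σ i) _ (S.coord _ (c m j) i) = S.coord _ (c m j) i
  rw [eventually_all]
  refine forall_congr' fun m => ?_
  rw [eventually_all]
  exact funext_iff.trans (forall_congr' fun j => S.lim_apply_eq_iff σ _ _)

theorem eventually_coordFixer_eq (S : Coordinates U K A) {J : List L.Sorts} {n : ℕ}
    (c : Fin n → Tup (fun s => acl A.carrier s) J) : ∀ᶠ i in (U : Filter I),
      ∃ d : Fin n → Tup (fun s => acl (K i).carrier s) J, S.coordFixer c i = ⨅ m, fixer (d m) := by
  filter_upwards [eventually_all.2 fun m => S.eventually_exists_valTup (c m)] with i hi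
  choose d hd using hi
  refine ⟨d, Subgroup.ext fun σ => ?_⟩
  simp only [Subgroup.mem_iInf, mem_fixer]
  refine forall_congr' fun m => ?_
  have h1 : (∀ j, extAct σ _ (S.tup (c m) i j) = S.tup (c m) i j) ↔ actTup σ (d m) = d m := by
    rw [hd m, ← valTup_injective.eq_iff, ← extAct_valTup]
    exact funext_iff.symm
  exact h1

end Coordinates

theorem isOpen_iInf_fixer {M : L.Sorts → Type v} [L.Structure M] {K : L.Substructure M}
    {J : List L.Sorts} {n : ℕ} (c : Fin n → Tup (fun s => acl K.carrier s) J) :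
    IsOpen ((⨅ m, fixer (c m) : Subgroup (absGal K)) : Set (absGal K)) := by
  rw [Subgroup.coe_iInf]
  exact isOpen_iInter_of_finite fun m => isOpen_fixer (c m)

end Subgroups

/-! ### The isomorphism of sorted complete systems -/

section Main

theorem SGCoset.eq_of_mk_eq {L : MSLanguage.{u, uf, ur}} {M : L.Sorts → Type v} [L.Structure M]
    {K : L.Substructure M} {k : ℕ} {J : List L.Sorts} {x y : SGCoset K k J}
    (h : x.H.toSubgroup = y.H.toSubgroup) (g : absGal K) (hx : QuotientGroup.mk g = x.coset)
    (hy : QuotientGroup.mk g = y.coset) : x = y := by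
  obtain ⟨H, c, _, _, _⟩ := x
  obtain ⟨H', c', _, _, _⟩ := y
  obtain rfl : H = H' := OpenNormalSubgroup.toSubgroup_injective h
  obtain rfl : c = c' := hx.symm.trans hy
  rfl

variable {L : MSLanguage.{u, uf, ur}} {I : Type w} {U : Ultrafilter I}
  {C : L.Sorts → Type v} [L.Structure C] {K : I → L.Substructure C}
  {N : L.Sorts → Type v'} [L.Structure N] {A : L.Substructure N}

/-- The coset `y` in `SG(A)` is the limit of the cosets `z i` in the `SG(K i)`, which are defined
almost everywhere. -/
structure IsLimitCoset (S : Coordinates U K A) {k : ℕ} {J : List L.Sorts}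
    (z : ∀ i, Option (SGCoset (K i) k J)) (y : SGCoset A k J) : Prop where
  mem_subgroup_iff : ∀ σ : ∀ i, absGal (K i), S.lim σ ∈ y.H.toSubgroup ↔
    ∀ᶠ i in (U : Filter I), ∃ x, z i = some x ∧ σ i ∈ x.H.toSubgroup
  mk_eq_iff : ∀ σ : ∀ i, absGal (K i), QuotientGroup.mk (S.lim σ) = y.coset ↔
    ∀ᶠ i in (U : Filter I), ∃ x, z i = some x ∧ QuotientGroup.mk (σ i) = x.coset

section Limit

variable {S : Coordinates U K A} {k k' : ℕ} {J J' : List L.Sorts}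
  {z : ∀ i, Option (SGCoset (K i) k J)} {y : SGCoset A k J}
  {z' : ∀ i, Option (SGCoset (K i) k' J')} {y' : SGCoset A k' J'}

/-- The subgroup of a coset, with the whole group as the value where no coset is given. -/
def subgroupOfOption {M : L.Sorts → Type v} [L.Structure M] {K : L.Substructure M} {k : ℕ}
    {J : List L.Sorts} : Option (SGCoset K k J) → Subgroup (absGal K)
  | none => ⊤
  | some x => x.H.toSubgroup

theorem IsLimitCoset.isLimit (h : IsLimitCoset S z y)
    (hz : ∀ᶠ i in (U : Filter I), (z i).isSome) :
    S.IsLimit (fun i => subgroupOfOption (z i)) y.H.toSubgroup := fun σ => by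
  rw [h.mem_subgroup_iff]
  refine eventually_congr ?_
  filter_upwards [hz] with i hi
  obtain ⟨x, hx⟩ := Option.isSome_iff_exists.1 hi
  simp [hx, subgroupOfOption]

/-- A limit of subgroups together with a sequence of representatives gives a limit of cosets. -/
theorem IsLimitCoset.of_isLimit (hz : ∀ᶠ i in (U : Filter I), (z i).isSome)
    (h : S.IsLimit (fun i => subgroupOfOption (z i)) y.H.toSubgroup) (g : ∀ i, absGal (K i))
    (hg : ∀ᶠ i in (U : Filter I), ∃ x, z i = some x ∧ QuotientGroup.mk (g i) = x.coset)
    (hy : QuotientGroup.mk (S.lim g) = y.coset) : IsLimitCoset S z y := by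
  constructor
  · intro σ
    rw [h σ]
    refine eventually_congr ?_
    filter_upwards [hz] with i hi
    obtain ⟨x, hx⟩ := Option.isSome_iff_exists.1 hi
    simp [hx, subgroupOfOption]
  · intro σ
    rw [← hy, eq_comm, QuotientGroup.eq, ← map_inv, ← map_mul, h]
    refine eventually_congr ?_
    filter_upwards [hg] with i ⟨x, hx, hgx⟩
    simp only [hx, subgroupOfOption, Pi.mul_apply, Pi.inv_apply, Option.some.injEq,
      exists_eq_left']
    rw [← hgx, eq_comm, QuotientGroup.eq]

variable (hEI : HasUniformEI L C) (hK : ∀ i, (K i).IsDefinablyClosed)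

include hEI hK in
/-- A coset in `SG(A)` contains limits of sequences, arbitrarily close to a given element. -/
theorem exists_lim_mk_eq (S : Coordinates U K A) (y : SGCoset A k J)
    (O : Subgroup (absGal A)) (hO : IsOpen (O : Set (absGal A))) (hOy : O ≤ y.H.toSubgroup)
    (g : absGal A) (hg : y.coset = QuotientGroup.mk g) : ∃ τ, (S.lim τ)⁻¹ * g ∈ O ∧
      QuotientGroup.mk (S.lim τ) = y.coset := by
  obtain ⟨τ, hτ⟩ := S.exists_lim_inv_mul_mem hEI hK hO g
  exact ⟨τ, hτ, by rw [hg]; exact QuotientGroup.eq.2 (hOy hτ)⟩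

include hEI hK in
theorem IsLimitCoset.unique_right {y' : SGCoset A k J} (hz : ∀ᶠ i in (U : Filter I), (z i).isSome)
    (h : IsLimitCoset S z y) (h' : IsLimitCoset S z y') : y = y' := by
  have h1 : y.H.toSubgroup = y'.H.toSubgroup := le_antisymm
    (((h.isLimit hz).le_iff hEI hK (h'.isLimit hz) y.H.isOpen' y'.H.isOpen').2
      (Eventually.of_forall fun _ => le_rfl))
    (((h'.isLimit hz).le_iff hEI hK (h.isLimit hz) y'.H.isOpen' y.H.isOpen').2
      (Eventually.of_forall fun _ => le_rfl))
  obtain ⟨g, hg⟩ := QuotientGroup.mk_surjective y.coset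
  obtain ⟨τ, -, hτ⟩ := exists_lim_mk_eq hEI hK S y _ y.H.isOpen' le_rfl g hg.symm
  exact SGCoset.eq_of_mk_eq h1 _ hτ ((h'.mk_eq_iff τ).2 ((h.mk_eq_iff τ).1 hτ))

include hEI hK in
theorem IsLimitCoset.unique_left {z' : ∀ i, Option (SGCoset (K i) k J)}
    (hz : ∀ᶠ i in (U : Filter I), (z i).isSome) (hz' : ∀ᶠ i in (U : Filter I), (z' i).isSome)
    (h : IsLimitCoset S z y) (h' : IsLimitCoset S z' y) : ∀ᶠ i in (U : Filter I), z i = z' i := by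
  obtain ⟨g, hg⟩ := QuotientGroup.mk_surjective y.coset
  obtain ⟨τ, -, hτ⟩ := exists_lim_mk_eq hEI hK S y _ y.H.isOpen' le_rfl g hg.symm
  filter_upwards [((h.isLimit hz).le_iff hEI hK (h'.isLimit hz') y.H.isOpen' y.H.isOpen').1 le_rfl,
    ((h'.isLimit hz').le_iff hEI hK (h.isLimit hz) y.H.isOpen' y.H.isOpen').1 le_rfl,
    (h.mk_eq_iff τ).1 hτ, (h'.mk_eq_iff τ).1 hτ] with i h1 h2 ⟨x, hx, h3⟩ ⟨x', hx', h4⟩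
  rw [hx, hx'] at h1 h2 ⊢
  rw [SGCoset.eq_of_mk_eq (le_antisymm h1 h2) _ h3 h4]

include hEI hK in
theorem IsLimitCoset.le_iff (hz : ∀ᶠ i in (U : Filter I), (z i).isSome)
    (hz' : ∀ᶠ i in (U : Filter I), (z' i).isSome) (h : IsLimitCoset S z y)
    (h' : IsLimitCoset S z' y') : SGCoset.le y y' ↔
      ∀ᶠ i in (U : Filter I), ∃ x x', z i = some x ∧ z' i = some x' ∧ SGCoset.le x x' := by
  refine ((h.isLimit hz).le_iff hEI hK (h'.isLimit hz') y.H.isOpen' y'.H.isOpen').trans ?_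
  refine eventually_congr ?_
  filter_upwards [hz, hz'] with i hi hi'
  obtain ⟨x, hx⟩ := Option.isSome_iff_exists.1 hi
  obtain ⟨x', hx'⟩ := Option.isSome_iff_exists.1 hi'
  simp [hx, hx', subgroupOfOption, SGCoset.le]

include hEI hK in
theorem IsLimitCoset.C_iff (hz : ∀ᶠ i in (U : Filter I), (z i).isSome)
    (hz' : ∀ᶠ i in (U : Filter I), (z' i).isSome) (h : IsLimitCoset S z y)
    (h' : IsLimitCoset S z' y') : SGCoset.C y y' ↔
      ∀ᶠ i in (U : Filter I), ∃ x x', z i = some x ∧ z' i = some x' ∧ SGCoset.C x x' := by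
  have hle := h.le_iff hEI hK hz hz' h'
  constructor
  · rintro ⟨hyy', g, hg, hg'⟩
    obtain ⟨τ, hτ, h1⟩ := exists_lim_mk_eq hEI hK S y _ y.H.isOpen' le_rfl g hg
    have h2 : QuotientGroup.mk (S.lim τ) = y'.coset := by
      rw [hg']; exact QuotientGroup.eq.2 (hyy' hτ)
    filter_upwards [hle.1 hyy', (h.mk_eq_iff τ).1 h1, (h'.mk_eq_iff τ).1 h2]
      with i ⟨x, x', hx, hx', hxx'⟩ ⟨x₁, hx₁, h3⟩ ⟨x₁', hx₁', h4⟩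
    obtain rfl := Option.some_injective _ (hx.symm.trans hx₁)
    obtain rfl := Option.some_injective _ (hx'.symm.trans hx₁')
    exact ⟨x, x', hx, hx', hxx', τ i, h3.symm, h4.symm⟩
  · intro hC
    obtain ⟨g, hg⟩ := exists_forall_eventually (β := fun i => absGal (K i))
      (p := fun i g => (∃ x, z i = some x ∧ QuotientGroup.mk g = x.coset) ∧
        ∃ x', z' i = some x' ∧ QuotientGroup.mk g = x'.coset)
      (hC.mono fun i ⟨x, x', hx, hx', _, g, h1, h2⟩ => ⟨g, ⟨x, hx, h1.symm⟩, x', hx', h2.symm⟩)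
    exact ⟨hle.2 (hC.mono fun i ⟨x, x', hx, hx', h1, _⟩ => ⟨x, x', hx, hx', h1⟩), S.lim g,
      ((h.mk_eq_iff g).2 (hg.mono fun _ hi => hi.1)).symm,
      ((h'.mk_eq_iff g).2 (hg.mono fun _ hi => hi.2)).symm⟩

include hEI hK in
theorem IsLimitCoset.H_eq_iff {z' : ∀ i, Option (SGCoset (K i) k J)} {y' : SGCoset A k J}
    (hz : ∀ᶠ i in (U : Filter I), (z i).isSome)
    (hz' : ∀ᶠ i in (U : Filter I), (z' i).isSome) (h : IsLimitCoset S z y)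
    (h' : IsLimitCoset S z' y') : y.H = y'.H ↔
      ∀ᶠ i in (U : Filter I), ∃ x x', z i = some x ∧ z' i = some x' ∧ x.H = x'.H := by
  rw [← OpenNormalSubgroup.toSubgroup_injective.eq_iff, le_antisymm_iff]
  refine (and_congr (h.le_iff hEI hK hz hz' h') (h'.le_iff hEI hK hz' hz h)).trans ?_
  rw [← eventually_and]
  refine eventually_congr (Eventually.of_forall fun i => ?_)
  constructor
  · rintro ⟨⟨x, x', hx, hx', h1⟩, x₁', x₁, hx₁', hx₁, h2⟩
    obtain rfl := Option.some_injective _ (hx.symm.trans hx₁)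
    obtain rfl := Option.some_injective _ (hx'.symm.trans hx₁')
    exact ⟨x, x', hx, hx', OpenNormalSubgroup.toSubgroup_injective (le_antisymm h1 h2)⟩
  · rintro ⟨x, x', hx, hx', h1⟩
    exact ⟨⟨x, x', hx, hx', (congrArg (·.toSubgroup) h1).le⟩,
      x', x, hx', hx, (congrArg (·.toSubgroup) h1).ge⟩

include hEI hK in
theorem IsLimitCoset.P_iff {z₁ z₂ z₃ : ∀ i, Option (SGCoset (K i) k J)} {y₁ y₂ y₃ : SGCoset A k J}
    (hz₁ : ∀ᶠ i in (U : Filter I), (z₁ i).isSome) (hz₂ : ∀ᶠ i in (U : Filter I), (z₂ i).isSome)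
    (hz₃ : ∀ᶠ i in (U : Filter I), (z₃ i).isSome) (h₁ : IsLimitCoset S z₁ y₁)
    (h₂ : IsLimitCoset S z₂ y₂) (h₃ : IsLimitCoset S z₃ y₃) : SGCoset.P y₁ y₂ y₃ ↔
      ∀ᶠ i in (U : Filter I), ∃ x₁ x₂ x₃, z₁ i = some x₁ ∧ z₂ i = some x₂ ∧ z₃ i = some x₃ ∧
        SGCoset.P x₁ x₂ x₃ := by
  constructor
  · rintro ⟨h12, h23, g₁, g₂, hg₁, hg₂, hg₃⟩
    obtain ⟨τ₁, hτ₁, h1⟩ := exists_lim_mk_eq hEI hK S y₁ _ y₁.H.isOpen' le_rfl g₁ hg₁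
    obtain ⟨τ₂, hτ₂, h2⟩ := exists_lim_mk_eq hEI hK S y₂ _ y₂.H.isOpen' le_rfl g₂ hg₂
    have h3 : QuotientGroup.mk (S.lim (τ₁ * τ₂)) = y₃.coset := by
      have e1 : (QuotientGroup.mk (S.lim τ₁) : absGal A ⧸ y₃.H.toSubgroup) = QuotientGroup.mk g₁ :=
        QuotientGroup.eq.2 (h23 ▸ h12 ▸ hτ₁)
      have e2 : (QuotientGroup.mk (S.lim τ₂) : absGal A ⧸ y₃.H.toSubgroup) = QuotientGroup.mk g₂ :=
        QuotientGroup.eq.2 (h23 ▸ hτ₂)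
      rw [hg₃, map_mul, QuotientGroup.mk_mul, QuotientGroup.mk_mul, e1, e2]
    filter_upwards [(h₁.H_eq_iff hEI hK hz₁ hz₂ h₂).1 h12, (h₂.H_eq_iff hEI hK hz₂ hz₃ h₃).1 h23,
      (h₁.mk_eq_iff τ₁).1 h1, (h₂.mk_eq_iff τ₂).1 h2, (h₃.mk_eq_iff _).1 h3]
      with i ⟨x₁, x₂, hx₁, hx₂, e1⟩ ⟨x₂', x₃, hx₂', hx₃, e2⟩ ⟨w₁, hw₁, e3⟩ ⟨w₂, hw₂, e4⟩
        ⟨w₃, hw₃, e5⟩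
    obtain rfl := Option.some_injective _ (hx₂.symm.trans hx₂')
    obtain rfl := Option.some_injective _ (hx₁.symm.trans hw₁)
    obtain rfl := Option.some_injective _ (hx₂.symm.trans hw₂)
    obtain rfl := Option.some_injective _ (hx₃.symm.trans hw₃)
    exact ⟨x₁, x₂, x₃, hx₁, hx₂, hx₃, e1, e2, τ₁ i, τ₂ i, e3.symm, e4.symm, e5.symm⟩
  · intro hP
    obtain ⟨g, hg⟩ := exists_forall_eventually (β := fun i => absGal (K i) × absGal (K i))
      (p := fun i g => (∃ x, z₁ i = some x ∧ QuotientGroup.mk g.1 = x.coset) ∧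
        (∃ x, z₂ i = some x ∧ QuotientGroup.mk g.2 = x.coset) ∧
        ∃ x, z₃ i = some x ∧ QuotientGroup.mk (g.1 * g.2) = x.coset)
      (hP.mono fun i ⟨x₁, x₂, x₃, hx₁, hx₂, hx₃, _, _, g₁, g₂, e1, e2, e3⟩ =>
        ⟨(g₁, g₂), ⟨x₁, hx₁, e1.symm⟩, ⟨x₂, hx₂, e2.symm⟩, x₃, hx₃, e3.symm⟩)
    refine ⟨(h₁.H_eq_iff hEI hK hz₁ hz₂ h₂).2
      (hP.mono fun i ⟨x₁, x₂, x₃, hx₁, hx₂, hx₃, e, _⟩ => ⟨x₁, x₂, hx₁, hx₂, e⟩),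
      (h₂.H_eq_iff hEI hK hz₂ hz₃ h₃).2
      (hP.mono fun i ⟨x₁, x₂, x₃, hx₁, hx₂, hx₃, _, e, _⟩ => ⟨x₂, x₃, hx₂, hx₃, e⟩),
      S.lim fun i => (g i).1, S.lim fun i => (g i).2,
      ((h₁.mk_eq_iff _).2 (hg.mono fun _ hi => hi.1)).symm,
      ((h₂.mk_eq_iff _).2 (hg.mono fun _ hi => hi.2.1)).symm, ?_⟩
    rw [← map_mul]
    exact ((h₃.mk_eq_iff _).2 (hg.mono fun _ hi => hi.2.2)).symm

include hEI hK in
/-- Every sequence of cosets has a limit. The subgroups are stabilizers of a bounded number of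
tuples whose entries have boundedly many conjugates, so these tuples are coordinates of tuples from
`acl(A)`, and the stabilizer of the latter is the limit of the subgroups. -/
theorem exists_isLimitCoset (S : Coordinates U K A) (hEI' : HasUniformEI L N)
    (z : ∀ i, Option (SGCoset (K i) k J)) (hz : ∀ᶠ i in (U : Filter I), (z i).isSome) :
    ∃ y : SGCoset A k J, IsLimitCoset S z y := by
  have h1 : ∀ᶠ i in (U : Filter I), ∃ n ∈ Set.Iio k,
      ∃ c : Fin n → Tup (fun s => acl (K i).carrier s) J,
        subgroupOfOption (z i) = ⨅ m, fixer (c m) := by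
    filter_upwards [hz] with i hi
    obtain ⟨x, hx⟩ := Option.isSome_iff_exists.1 hi
    obtain ⟨n, hn, c, hc⟩ := hEI.exists_generators x.H x.finiteIndex x.mem_sortData
    exact ⟨n, hn.trans_le x.index_le, c, by rw [hx]; exact hc⟩
  obtain ⟨n, -, h1⟩ := (Ultrafilter.eventually_exists_mem_iff (Set.finite_Iio k)).1 h1
  have h2 : ∀ᶠ i in (U : Filter I), ∃ d : Fin n → Tup C J,
      ∃ c : Fin n → Tup (fun s => acl (K i).carrier s) J, (∀ m, d m = valTup (c m)) ∧
        subgroupOfOption (z i) = ⨅ m, fixer (c m) :=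
    h1.mono fun i ⟨c, hc⟩ => ⟨fun m => valTup (c m), c, fun _ => rfl, hc⟩
  obtain ⟨d, hd⟩ := h2.choice
  have h3 := fun (m : Fin n) (j : Fin J.length) =>
    S.exists_coord_eq hEI hK k (fun i => d i m j) (by
      filter_upwards [hd, hz] with i ⟨c, hdc, hc⟩ hi
      obtain ⟨x, hx⟩ := Option.isSome_iff_exists.1 hi
      rw [hx] at hc
      refine ⟨c m j, (congrFun (hdc m) j).symm, x.H.toSubgroup, x.finiteIndex, x.index_le,
        fun σ hσ => ?_⟩
      rw [show x.H.toSubgroup = _ from hc, Subgroup.mem_iInf] at hσ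
      exact congrFun (hσ m) j)
  choose b hb using h3
  have hlim : S.IsLimit (fun i => subgroupOfOption (z i)) (⨅ m, fixer (b m)) := by
    refine (S.isLimit_coordFixer b).congr ?_
    filter_upwards [hd, eventually_all.2 fun m => eventually_all.2 (hb m)] with i ⟨c, hdc, hc⟩ hi
    rw [hc]
    refine Subgroup.ext fun σ => ?_
    simp only [Subgroup.mem_iInf, mem_fixer]
    change (∀ m j, extAct σ _ (S.coord _ (b m j) i) = S.coord _ (b m j) i) ↔ _
    refine forall_congr' fun m => ?_
    rw [← valTup_injective.eq_iff, ← extAct_valTup, ← hdc m]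
    simp only [hi]
    exact funext_iff.symm
  have hopen := isOpen_iInf_fixer b
  let H : OpenNormalSubgroup (absGal A) :=
    { toSubgroup := ⨅ m, fixer (b m)
      isOpen' := hopen
      isNormal' := hlim.normal hEI hK hopen (by
        filter_upwards [hz] with i hi
        obtain ⟨x, hx⟩ := Option.isSome_iff_exists.1 hi
        rw [hx]
        exact x.H.isNormal') }
  have hidx := (hlim.index_le_iff hEI hK hopen k).2 (by
    filter_upwards [hz] with i hi
    obtain ⟨x, hx⟩ := Option.isSome_iff_exists.1 hi
    rw [hx]
    exact ⟨x.finiteIndex, x.index_le⟩)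
  obtain ⟨g, hg⟩ := exists_forall_eventually (β := fun i => absGal (K i))
    (p := fun i g => ∃ x, z i = some x ∧ QuotientGroup.mk g = x.coset) (by
      filter_upwards [hz] with i hi
      obtain ⟨x, hx⟩ := Option.isSome_iff_exists.1 hi
      obtain ⟨g, hg⟩ := QuotientGroup.mk_surjective x.coset
      exact ⟨g, x, hx, hg⟩)
  exact ⟨⟨H, QuotientGroup.mk (S.lim g), hidx.1, hidx.2, hEI'.mem_sortData H hidx.1 rfl⟩,
    IsLimitCoset.of_isLimit hz hlim g hg rfl⟩

include hEI hK in
/-- Every coset in `SG(A)` is a limit: its subgroup is the stabilizer of finitely many tuples, and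
the stabilizers of their coordinates inherit normality, the bound on the index, and the sorting
data. -/
theorem exists_isLimitCoset_of_mem (S : Coordinates U K A) (hEI' : HasUniformEI L N)
    (y : SGCoset A k J) : ∃ z : ∀ i, Option (SGCoset (K i) k J),
      (∀ᶠ i in (U : Filter I), (z i).isSome) ∧ IsLimitCoset S z y := by
  classical
  obtain ⟨n, -, c, hc⟩ := hEI'.exists_generators y.H y.finiteIndex y.mem_sortData
  have hlim : S.IsLimit (S.coordFixer c) y.H.toSubgroup := hc ▸ S.isLimit_coordFixer c
  obtain ⟨g, hg⟩ := QuotientGroup.mk_surjective y.coset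
  obtain ⟨τ, -, hτ⟩ := exists_lim_mk_eq hEI hK S y _ y.H.isOpen' le_rfl g hg.symm
  have hex : ∀ᶠ i in (U : Filter I), ∃ x : SGCoset (K i) k J,
      x.H.toSubgroup = S.coordFixer c i ∧ QuotientGroup.mk (τ i) = x.coset := by
    filter_upwards [hlim.eventually_normal y.H.isNormal', S.eventually_coordFixer_eq c,
      (hlim.index_le_iff hEI hK y.H.isOpen' k).1 ⟨y.finiteIndex, y.index_le⟩]
      with i h1 ⟨d, hd⟩ ⟨h2, h3⟩
    let H : OpenNormalSubgroup (absGal (K i)) :=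
      { toSubgroup := S.coordFixer c i
        isOpen' := by
          have := isOpen_iInf_fixer d
          rw [← hd] at this
          exact this
        isNormal' := h1 }
    exact ⟨⟨H, QuotientGroup.mk (τ i), h2, h3, hEI.mem_sortData H h2 hd⟩, rfl, rfl⟩
  let z : ∀ i, Option (SGCoset (K i) k J) := fun i =>
    if h : ∃ x : SGCoset (K i) k J,
      x.H.toSubgroup = S.coordFixer c i ∧ QuotientGroup.mk (τ i) = x.coset
    then some h.choose else none
  have hz : ∀ᶠ i in (U : Filter I), ∃ x, z i = some x ∧ x.H.toSubgroup = S.coordFixer c i ∧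
      QuotientGroup.mk (τ i) = x.coset := hex.mono fun i hi =>
    ⟨hi.choose, dif_pos hi, hi.choose_spec⟩
  have hz' : ∀ᶠ i in (U : Filter I), (z i).isSome := hz.mono fun i ⟨x, hx, _⟩ => by rw [hx]; rfl
  refine ⟨z, hz', IsLimitCoset.of_isLimit hz' (hlim.congr ?_) τ
    (hz.mono fun i ⟨x, hx, _, h⟩ => ⟨x, hx, h⟩) hτ⟩
  filter_upwards [hz] with i ⟨x, hx, h, _⟩
  rw [hx]
  exact h.symm

end Limit

/-- The isomorphism between the ultraproduct of the systems `SG(K i)` and `SG(A)` that takes a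
sequence of cosets to its limit. -/
theorem nonempty_iso_SG (hEI : HasUniformEI L C) (hK : ∀ i, (K i).IsDefinablyClosed)
    (hEI' : HasUniformEI L N) (S : Coordinates U K A) :
    Nonempty ((LG L.Sorts).Iso (Ultraproduct U fun i => SG (K i)) (SG A)) := by
  let rep : ∀ (m : (LG L.Sorts).Sorts), Ultraproduct U (fun i => SG (K i)) m →
      ∀ i, Option (SGCoset (K i) m.1 m.2) := fun m x => (x.rep U).1
  have hrep : ∀ m x, ∀ᶠ i in (U : Filter I), (rep m x i).isSome := fun m x => (x.rep U).2
  have hex := fun m x => exists_isLimitCoset hEI hK S hEI' (rep m x) (hrep m x)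
  choose f hf using hex
  have hbij : ∀ m, Function.Bijective (f m) := fun m => by
    refine ⟨fun x x' h => ?_, fun y => ?_⟩
    · exact Ultraproduct.eq_iff.2
        ((hf m x).unique_left hEI hK (hrep m x) (hrep m x') (h ▸ hf m x'))
    · obtain ⟨z, hz, h⟩ := exists_isLimitCoset_of_mem hEI hK S hEI' y
      let w : PartialSection U (fun i => SG (K i)) m := ⟨z, hz⟩
      refine ⟨Quotient.mk _ w, (hf m (Quotient.mk _ w)).unique_right hEI hK (hrep m _) ?_⟩
      have hw : ∀ᶠ i in (U : Filter I), rep m (Quotient.mk _ w) i = z i :=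
        Ultraproduct.rep_mk w
      constructor
      · intro σ
        exact (h.mem_subgroup_iff σ).trans (eventually_congr (hw.mono fun i hi => by rw [hi]))
      · intro σ
        exact (h.mk_eq_iff σ).trans (eventually_congr (hw.mono fun i hi => by rw [hi]))
  refine ⟨⟨fun m => Equiv.ofBijective (f m) (hbij m), fun e => Empty.elim e, fun {w} R x => ?_⟩⟩
  cases R with
  | le m m' =>
    refine ((hf _ _).le_iff hEI hK (hrep _ (x (0 : Fin 2))) (hrep _ (x (1 : Fin 2)))
      (hf _ _)).trans (eventually_congr (Eventually.of_forall fun i => ?_))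
    constructor
    · rintro ⟨z, z', h, h', hz⟩
      exact ⟨Tup.cons z (Tup.cons z' fun j => j.elim0), fun j => by
        fin_cases j; exacts [h, h'], hz⟩
    · rintro ⟨a, ha, h⟩
      exact ⟨_, _, ha (0 : Fin 2), ha (1 : Fin 2), h⟩
  | C m m' =>
    refine ((hf _ _).C_iff hEI hK (hrep _ (x (0 : Fin 2))) (hrep _ (x (1 : Fin 2)))
      (hf _ _)).trans (eventually_congr (Eventually.of_forall fun i => ?_))
    constructor
    · rintro ⟨z, z', h, h', hz⟩
      exact ⟨Tup.cons z (Tup.cons z' fun j => j.elim0), fun j => by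
        fin_cases j; exacts [h, h'], hz⟩
    · rintro ⟨a, ha, h⟩
      exact ⟨_, _, ha (0 : Fin 2), ha (1 : Fin 2), h⟩
  | P m =>
    refine ((hf _ _).P_iff hEI hK (hrep _ (x (0 : Fin 3))) (hrep _ (x (1 : Fin 3)))
      (hrep _ (x (2 : Fin 3))) (hf _ _) (hf _ _)).trans
      (eventually_congr (Eventually.of_forall fun i => ?_))
    constructor
    · rintro ⟨z₁, z₂, z₃, h₁, h₂, h₃, hz⟩
      exact ⟨Tup.cons z₁ (Tup.cons z₂ (Tup.cons z₃ fun j => j.elim0)), fun j => by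
        fin_cases j; exacts [h₁, h₂, h₃], hz⟩
    · rintro ⟨a, ha, h⟩
      exact ⟨_, _, _, ha (0 : Fin 3), ha (1 : Fin 3), ha (2 : Fin 3), h⟩

end Main

end MSLanguage

theorem mainTheorem11 {L : MSLanguage.{u, uf, ur}} (C : L.Sorts → Type v) [L.Structure C]
    (hQE : MSLanguage.HasQE L C) (hEI : MSLanguage.HasUniformEI L C)
    {I : Type w} [Infinite I] (U : Ultrafilter I)
    (K : I → L.Substructure C) (hK : ∀ i, (K i).IsDefinablyClosed) :
    (∃ (N : L.Sorts → Type (max v w)) (_ : L.Structure N),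
      L.ElementarilyEquivalent C N ∧
        Nonempty (L.Embedding (MSLanguage.Ultraproduct U fun i => (K i).toFam) N)) ∧
    ∀ (N : L.Sorts → Type v') [L.Structure N], L.ElementarilyEquivalent C N →
      ∀ ι : L.Embedding (MSLanguage.Ultraproduct U fun i => (K i).toFam) N,
        ι.range.IsDefinablyClosed ∧
        Nonempty ((MSLanguage.LG L.Sorts).Iso
          (MSLanguage.Ultraproduct U fun i => MSLanguage.SG (K i))
          (MSLanguage.SG ι.range)) := by
  refine ⟨⟨_, _, MSLanguage.elementarilyEquivalent_ultrapower C U, ⟨MSLanguage.ultraIncl U K⟩⟩, ?_⟩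
  intro N _ hN ι
  obtain ⟨S⟩ := MSLanguage.exists_coordinates hQE hN K ι
  exact ⟨S.isDefinablyClosed hK,
    MSLanguage.nonempty_iso_SG hEI hK (hEI.of_elementarilyEquivalent hN) S⟩
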